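/- Let $X$ be a complex manifold of dimension $n$, let $E$ be a holomorphic vector bundle of rank $r$ on $X$ with sheaf of holomorphic sections $\mathcal E$, let $\mathcal A_X$, $\mathcal A^{p,q}_X$, $\mathcal A^*_X$ be the sheaves of complex-valued real-analytic functions, $(p,q)$-forms and differential forms, and let $\tau$ be a real-analytic section of $E^\vee$. All operators below are $\mathbb C$-linear endomorphisms of the sheaf of superalgebras $\mathcal A_X^*\widehat\otimes\bigwedge\mathcal E$. Let $\nabla$ be a flat ($\nabla^2=0$) real-analytic connection of type $(1,0)$ on $E$, extended to the odd superderivation of $\mathcal A_X^*\widehat\otimes\bigwedge\mathcal E$ that restricts to $\partial$ on $\mathcal A_X^*$. Let $\delta=\sum_{k\ge 0}a_k$ be a twisting differential for $\tau$, that is: $a_k$ maps $\mathcal A_X^{0,q}\otimes\bigwedge^m\mathcal E$ to $\mathcal A_X^{0,q+k}\otimes\bigwedge^{m+k-1}\mathcal E$; $a_0=\imath_\tau$ is the contraction by $\tau$ (extended as an odd superderivation vanishing on $\mathcal A_X^*$); $a_1=\overline D$ is a connection of type $(0,1)$ on $E$, extended to an odd superderivation restricting to $\overline\partial$ on $\mathcal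 A_X^*$; for $k\ge 2$, $a_k$ is an odd superderivation vanishing on $\mathcal A_X^*$; and $\delta^2=0$ on $T^*$, where $T^i=\bigoplus_{q-m=i}\mathcal A_X^{0,q}\otimes\bigwedge^m\mathcal E$. Put $A=\nabla+\delta$ and $R_A=A^2$. For a finite-dimensional vector space $W$ and an endomorphism $\varphi$ of $\bigwedge W$ of degree $-m\le 0$, the generalized supertrace $\mathrm{Tr}_\Lambda(\varphi)\in\bigwedge^mW^\vee$ is the linear form $\eta\mapsto(-1)^{|\eta|}\,\mathrm{tr}_s(l_\eta\circ\varphi)$ on $\bigwedge^mW$, where $l_\eta$ is left multiplication by $\eta$ and $\mathrm{tr}_s$ is the supertrace; $\mathrm{Tr}_\Lambda(\varphi)=0$ if $\varphi$ has positive degree. It is extended by $\mathrm{Tr}_\Lambda(\omega\otimes\varphi)=\omega\otimes\mathrm{Tr}_\Lambda(\varphi)$ to $\mathcal A_X^*\widehat\otimes\mathcal{E}\mathit{nd}(\bigwedge E)$, with values in $\mathcal A_X^*\widehat\otimes\bigwedge\mathcal E^\vee$. An element of $\bigwedge E^\vee$ is regarded as an endomorphism of $\bigwedge E$ with values in $\bigwedge^0E$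 through the duality pairing, so that sections of $\mathcal A_X^*\widehat\otimes\bigwedge\mathcal E^\vee$ act on $\mathcal A_X^*\widehat\otimes\bigwedge\mathcal E$, with values in $\mathcal A_X^*$. Then $\frac1{r!}R_A^r$ is the action of a unique section $\psi$ of $\mathcal A_X^*\widehat\otimes\mathcal{E}\mathit{nd}(\bigwedge E)$, the operator $\mathrm{Tr}_\Lambda(\psi)$ preserves real-analyticity, and $$[\delta,\mathrm{Tr}_\Lambda(\psi)]_s=0,\qquad\text{equivalently}\qquad\overline\partial\circ\mathrm{Tr}_\Lambda(\psi)=\mathrm{Tr}_\Lambda(\psi)\circ\delta .$$ Moreover $\delta$ maps $T^i$ to $T^{i+1}$ with $\delta^2=0$, and $\mathrm{Tr}_\Lambda(\psi)$ maps $T^i$ to $\mathcal A_X^{r,r+i}$ for every integer $i$ (to $0$ if $r+i<0$), so that $\mathrm{Tr}_\Lambda(\psi)$ is a cochain map from the twisted complex $(T^*,\delta)$ to the Dolbeault complex $(\mathcal A_X^{r,*}[r],\overline\partial)$, where $\mathcal A_X^{r,*}[r]^i=\mathcal A_X^{r,r+i}$. -/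

import Mathlib

open scoped ContDiff Manifold TensorProduct
open Bundle TopologicalSpace

namespace TwistedDolbeault

noncomputable section

/-! ### Super linear algebra -/

section SuperLinearAlgebra

/-- The super tensor product `⋀C ⊗̂ ⋀W` of two exterior algebras: the tensor product of the
underlying modules, with `(a₁ ⊗ b₁) (a₂ ⊗ b₂) = (-1) ^ (|b₁| |a₂|) a₁ a₂ ⊗ b₁ b₂`. -/
abbrev SuperTensor (C : Type*) [AddCommGroup C] [Module ℂ C]
    (W : Type*) [AddCommGroup W] [Module ℂ W] :=
  GradedTensorProduct ℂ (fun i : ℕ => ⋀[ℂ]^i C) (fun i : ℕ => ⋀[ℂ]^i W)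

variable {C : Type*} [AddCommGroup C] [Module ℂ C]
variable {W : Type*} [AddCommGroup W] [Module ℂ W]
variable {C' : Type*} [AddCommGroup C'] [Module ℂ C']
variable {W' : Type*} [AddCommGroup W'] [Module ℂ W']
variable {C'' : Type*} [AddCommGroup C''] [Module ℂ C'']
variable {W'' : Type*} [AddCommGroup W''] [Module ℂ W'']

theorem map_mem_exteriorPower (f : W →ₗ[ℂ] W') (i : ℕ) {a : ExteriorAlgebra ℂ W}
    (ha : a ∈ ⋀[ℂ]^i W) : ExteriorAlgebra.map f a ∈ ⋀[ℂ]^i W' := by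
  have h : (⋀[ℂ]^i W).map (ExteriorAlgebra.map f).toLinearMap ≤ ⋀[ℂ]^i W' := by
    unfold ExteriorAlgebra.exteriorPower
    rw [Submodule.map_pow]
    refine pow_le_pow_left' ?_ i
    rintro _ ⟨_, ⟨w, rfl⟩, rfl⟩
    exact ⟨f w, by simp⟩
  exact h ⟨a, ha, rfl⟩

/-- The algebra map `⋀f ⊗ ⋀g : ⋀C ⊗̂ ⋀W → ⋀C' ⊗̂ ⋀W'`. -/
def SuperTensor.map (f : C →ₗ[ℂ] C') (g : W →ₗ[ℂ] W') :
    SuperTensor C W →ₐ[ℂ] SuperTensor C' W' :=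
  GradedTensorProduct.lift _ _
    ((GradedTensorProduct.includeLeft _ _).comp (ExteriorAlgebra.map f))
    ((GradedTensorProduct.includeRight _ _).comp (ExteriorAlgebra.map g)) (by
      intro i j a b
      have h := GradedTensorProduct.tmul_coe_mul_coe_tmul (R := ℂ)
        (fun i : ℕ => ⋀[ℂ]^i C') (fun i : ℕ => ⋀[ℂ]^i W') 1
        (⟨_, map_mem_exteriorPower g j b.2⟩ : ⋀[ℂ]^j W')
        (⟨_, map_mem_exteriorPower f i a.2⟩ : ⋀[ℂ]^i C') 1
      have h' := GradedTensorProduct.tmul_one_mul_one_tmul (R := ℂ)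
        (fun i : ℕ => ⋀[ℂ]^i C') (fun i : ℕ => ⋀[ℂ]^i W')
        (ExteriorAlgebra.map f (a : ExteriorAlgebra ℂ C))
        (ExteriorAlgebra.map g (b : ExteriorAlgebra ℂ W))
      simp only [AlgHom.comp_apply, GradedTensorProduct.includeLeft_apply,
        GradedTensorProduct.includeRight_apply] at *
      rw [h', h, smul_smul, Int.units_mul_self, one_smul]
      simp)

theorem SuperTensor.map_tmul (f : C →ₗ[ℂ] C') (g : W →ₗ[ℂ] W')
    (a : ExteriorAlgebra ℂ C) (b : ExteriorAlgebra ℂ W) :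
    SuperTensor.map f g (a ᵍ⊗ₜ[ℂ] b) =
      (ExteriorAlgebra.map f a) ᵍ⊗ₜ[ℂ] (ExteriorAlgebra.map g b) := by
  simp [SuperTensor.map, GradedTensorProduct.tmul_one_mul_one_tmul]

theorem SuperTensor.map_map (f : C →ₗ[ℂ] C') (g : W →ₗ[ℂ] W')
    (f' : C' →ₗ[ℂ] C'') (g' : W' →ₗ[ℂ] W'') (t : SuperTensor C W) :
    SuperTensor.map f' g' (SuperTensor.map f g t) = SuperTensor.map (f' ∘ₗ f) (g' ∘ₗ g) t := by
  have : ((SuperTensor.map f' g').comp (SuperTensor.map f g)).toLinearMap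
      = (SuperTensor.map (f' ∘ₗ f) (g' ∘ₗ g)).toLinearMap := by
    apply GradedTensorProduct.hom_ext
    apply TensorProduct.ext'
    intro a b
    change SuperTensor.map f' g' (SuperTensor.map f g (a ᵍ⊗ₜ[ℂ] b)) =
      SuperTensor.map (f' ∘ₗ f) (g' ∘ₗ g) (a ᵍ⊗ₜ[ℂ] b)
    simp only [SuperTensor.map_tmul, ← ExteriorAlgebra.map_comp_map, AlgHom.comp_apply]
  exact LinearMap.congr_fun this t

/-- The parity involution of `⋀C ⊗̂ ⋀W`: it is `(-1) ^ (i + j)` on `⋀ⁱC ⊗ ⋀ʲW`. -/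
def SuperTensor.parity : SuperTensor C W →ₐ[ℂ] SuperTensor C W :=
  SuperTensor.map (-LinearMap.id) (-LinearMap.id)

/-- The parity involution `ε` of `⋀W`: it is `(-1) ^ i` on `⋀ⁱW`. -/
def eps : Module.End ℂ (ExteriorAlgebra ℂ W) :=
  (CliffordAlgebra.involute (Q := (0 : QuadraticForm ℂ W))).toLinearMap

/-- The supertrace `tr_s φ = tr (ε ∘ φ)` of an endomorphism of `⋀W`. -/
def supertrace : Module.End ℂ (ExteriorAlgebra ℂ W) →ₗ[ℂ] ℂ :=
  LinearMap.trace ℂ (ExteriorAlgebra ℂ W) ∘ₗ LinearMap.mulLeft ℂ eps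

/-- The generalized supertrace of `φ : ⋀W → ⋀W`, an element of `⋀W^∨`, written as the linear form
`η ↦ (-1) ^ |η| tr_s (l_η ∘ φ)` on `⋀W`, where `l_η` is left multiplication by `η`.
As `l_η ∘ φ` is traceless when it has non-zero degree, only the component of `φ` of degree `-n`
contributes to the value on `⋀ⁿW`; in particular the components of `φ` of positive degree have
generalized supertrace `0`. -/
def genSupertrace : Module.End ℂ (ExteriorAlgebra ℂ W) →ₗ[ℂ]
    Module.Dual ℂ (ExteriorAlgebra ℂ W) :=
  LinearMap.mk₂ ℂ (fun φ η => supertrace (LinearMap.mul ℂ (ExteriorAlgebra ℂ W) (eps η) * φ))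
    (by intro φ φ' η; rw [mul_add, map_add])
    (by intro c φ η; rw [mul_smul_comm, map_smul])
    (by intro φ η η'; rw [map_add, map_add, add_mul, map_add])
    (by intro c φ η; rw [map_smul, map_smul, smul_mul_assoc, map_smul])

/-- The inclusion `i : ⋀W^∨ → End(⋀W)`: the form `α` acts by `β ↦ ⟨α, β⟩ ∈ ⋀⁰W`. -/
def dualIncl : Module.Dual ℂ (ExteriorAlgebra ℂ W) →ₗ[ℂ]
    Module.End ℂ (ExteriorAlgebra ℂ W) :=
  LinearMap.mk₂ ℂ (fun α β => α β • (1 : ExteriorAlgebra ℂ W))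
    (by intro α α' β; rw [LinearMap.add_apply, add_smul])
    (by intro c α β; rw [LinearMap.smul_apply, smul_assoc])
    (by intro α β β'; rw [map_add, add_smul])
    (by intro c α β; rw [map_smul, smul_assoc])

/-- The even part of an endomorphism of `⋀W`. -/
def evenPart : Module.End ℂ (ExteriorAlgebra ℂ W) →ₗ[ℂ] Module.End ℂ (ExteriorAlgebra ℂ W) where
  toFun φ := (1 / 2 : ℂ) • (φ + eps * φ * eps)
  map_add' φ φ' := by rw [mul_add, add_mul, add_add_add_comm, smul_add]
  map_smul' c φ := by
    rw [mul_smul_comm, smul_mul_assoc, ← smul_add, RingHom.id_apply, smul_comm]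

/-- The odd part of an endomorphism of `⋀W`. -/
def oddPart : Module.End ℂ (ExteriorAlgebra ℂ W) →ₗ[ℂ] Module.End ℂ (ExteriorAlgebra ℂ W) where
  toFun φ := (1 / 2 : ℂ) • (φ - eps * φ * eps)
  map_add' φ φ' := by rw [mul_add, add_mul, add_sub_add_comm, smul_add]
  map_smul' c φ := by
    rw [mul_smul_comm, smul_mul_assoc, ← smul_sub, RingHom.id_apply, smul_comm]

/-- The action of `⋀C ⊗̂ End(⋀W)` on `⋀C ⊗̂ ⋀W`:
`(θ ⊗ φ) (θ' ⊗ β) = (-1) ^ (|φ| |θ'|) θ θ' ⊗ φ β`. -/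
def act : ExteriorAlgebra ℂ C ⊗[ℂ] Module.End ℂ (ExteriorAlgebra ℂ W) →ₗ[ℂ]
    Module.End ℂ (SuperTensor C W) :=
  (GradedTensorProduct.of ℂ (fun i : ℕ => ⋀[ℂ]^i C) (fun i : ℕ => ⋀[ℂ]^i W)).conj.toLinearMap ∘ₗ
    TensorProduct.lift
      ((TensorProduct.mapBilinear (RingHom.id ℂ) (ExteriorAlgebra ℂ C) (ExteriorAlgebra ℂ W)
          (ExteriorAlgebra ℂ C) (ExteriorAlgebra ℂ W)).compl₁₂
          (LinearMap.mul ℂ (ExteriorAlgebra ℂ C)) evenPart +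
        (TensorProduct.mapBilinear (RingHom.id ℂ) (ExteriorAlgebra ℂ C) (ExteriorAlgebra ℂ W)
          (ExteriorAlgebra ℂ C) (ExteriorAlgebra ℂ W)).compl₁₂
          (LinearMap.mulRight ℂ (eps : Module.End ℂ (ExteriorAlgebra ℂ C)) ∘ₗ
            LinearMap.mul ℂ (ExteriorAlgebra ℂ C)) oddPart)

/-- The extension `θ ⊗ φ ↦ θ ⊗ Tr_Λ φ` of the generalized supertrace to
`⋀C ⊗̂ End(⋀W) → ⋀C ⊗̂ ⋀W^∨`. -/
def genSupertraceExt : ExteriorAlgebra ℂ C ⊗[ℂ] Module.End ℂ (ExteriorAlgebra ℂ W) →ₗ[ℂ]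
    ExteriorAlgebra ℂ C ⊗[ℂ] Module.Dual ℂ (ExteriorAlgebra ℂ W) :=
  LinearMap.lTensor _ genSupertrace

/-- The inclusion of `⋀C ⊗̂ ⋀W^∨` into `⋀C ⊗̂ End(⋀W)` induced by `dualIncl`. -/
def dualInclExt : ExteriorAlgebra ℂ C ⊗[ℂ] Module.Dual ℂ (ExteriorAlgebra ℂ W) →ₗ[ℂ]
    ExteriorAlgebra ℂ C ⊗[ℂ] Module.End ℂ (ExteriorAlgebra ℂ W) :=
  LinearMap.lTensor _ dualIncl

/-- The contraction `θ ⊗ β ↦ (-1) ^ |θ| θ ⊗ ι_t β` by a linear form `t` on `W`: the odd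
superderivation of `⋀C ⊗̂ ⋀W` which vanishes on `⋀C` and equals `t` on `W`. -/
def contraction (t : Module.Dual ℂ W) : Module.End ℂ (SuperTensor C W) :=
  (GradedTensorProduct.of ℂ (fun i : ℕ => ⋀[ℂ]^i C) (fun i : ℕ => ⋀[ℂ]^i W)).conj
    (TensorProduct.map eps
      (CliffordAlgebra.contractLeft (Q := (0 : QuadraticForm ℂ W)) t))

/-- The supercommutator `[a, b]_s = a b - (-1) ^ (|a| |b|) b a` of two endomorphisms of a module
whose `ℤ/2`-grading is given by the involution `e`, extended bilinearly to non-homogeneous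
endomorphisms. Here `½ (a - e a e)` is the odd part of `a`, and
`[a, b]_s = a b - b a + 2 b_odd a_odd`. -/
def superBracket {M : Type*} [AddCommGroup M] [Module ℂ M] (e a b : Module.End ℂ M) :
    Module.End ℂ M :=
  a * b - b * a +
    (2 : ℂ) • (((1 / 2 : ℂ) • (b - e * b * e)) * ((1 / 2 : ℂ) • (a - e * a * e)))

end SuperLinearAlgebra

/-! ### Differential forms on a complex manifold with values in the exterior algebra of a bundle -/

section Forms

variable (V : Type*) [NormedAddCommGroup V] [NormedSpace ℂ V]
variable {X : Type*} [TopologicalSpace X] [ChartedSpace V X]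

/-- The complexified cotangent space: real-linear forms `T_xX → ℂ`. -/
abbrev Cotangent (x : X) := TangentSpace 𝓘(ℂ, V) x →ₗ[ℝ] ℂ

/-- The fibre at `x` of the algebra of complex-valued differential forms. -/
abbrev FormFibre (x : X) := ExteriorAlgebra ℂ (Cotangent V x)

/-- Covectors of type `(1,0)`. -/
def cotangent10 (x : X) : Submodule ℂ (Cotangent V x) where
  carrier := {α | ∀ v, α (Complex.I • v) = Complex.I * α v}
  add_mem' := by
    intro α β hα hβ v
    simp only [Set.mem_ofPred_eq] at hα hβ
    simp [hα v, hβ v, mul_add]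
  zero_mem' := by intro v; simp
  smul_mem' := by
    intro c α hα v
    simp only [Set.mem_ofPred_eq] at hα
    simp [hα v, mul_left_comm]

/-- Covectors of type `(0,1)`. -/
def cotangent01 (x : X) : Submodule ℂ (Cotangent V x) where
  carrier := {α | ∀ v, α (Complex.I • v) = -(Complex.I * α v)}
  add_mem' := by
    intro α β hα hβ v
    simp only [Set.mem_ofPred_eq] at hα hβ
    simp [hα v, hβ v, mul_add, add_comm]
  zero_mem' := by intro v; simp
  smul_mem' := by
    intro c α hα v
    simp only [Set.mem_ofPred_eq] at hα
    simp [hα v, mul_left_comm]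

/-- The fibre at `x` of the bundle of `(p,q)`-forms: the span of the products of `p` covectors of
type `(1,0)` and `q` covectors of type `(0,1)`. -/
def formType (x : X) (p q : ℕ) : Submodule ℂ (FormFibre V x) :=
  (cotangent10 V x).map (ExteriorAlgebra.ι ℂ) ^ p * (cotangent01 V x).map (ExteriorAlgebra.ι ℂ) ^ q

/-- The fibre at `x` of the bundle of superalgebras `⋀T*X ⊗̂ ⋀E`. -/
abbrev Fibre (E : X → Type*) [∀ x, AddCommGroup (E x)] [∀ x, Module ℂ (E x)] (x : X) :=
  SuperTensor (Cotangent V x) (E x)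

/-- The part `A^{p,q} ⊗ ⋀ᵐE` of the fibre at `x`. -/
def fibrePart (E : X → Type*) [∀ x, AddCommGroup (E x)] [∀ x, Module ℂ (E x)] (x : X)
    (p q m : ℕ) : Submodule ℂ (Fibre V E x) :=
  Submodule.span ℂ {t | ∃ a ∈ formType V x p q, ∃ b ∈ ⋀[ℂ]^m (E x), t = a ᵍ⊗ₜ[ℂ] b}

/-- The part of total degree `i` of the fibre at `x` of `A^{0,*} ⊗ ⋀E`, where `A^{0,q} ⊗ ⋀ᵐE` has
degree `q - m`. -/
def twistedPart (E : X → Type*) [∀ x, AddCommGroup (E x)] [∀ x, Module ℂ (E x)] (x : X)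
    (i : ℤ) : Submodule ℂ (Fibre V E x) :=
  ⨆ (q : ℕ) (m : ℕ) (_ : (q : ℤ) - m = i), fibrePart V E x 0 q m

/-- The fibre at `x` of the bundle of `(p, j)`-forms for an integer `j`; it is zero for `j < 0`. -/
def dolbeaultPart (x : X) (p : ℕ) (j : ℤ) : Submodule ℂ (FormFibre V x) :=
  ⨆ (q : ℕ) (_ : (q : ℤ) = j), formType V x p q

variable [FiniteDimensional ℂ V] [IsManifold 𝓘(ℂ, V) ω X]

/-- A covector at `x`, read in the chart centred at `x₀`. -/
def cotangentToModel (x₀ x : X) : Cotangent V x →ₗ[ℂ] (V →ₗ[ℝ] ℂ) :=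
  LinearMap.lcomp ℂ ℂ
    (((trivializationAt V (TangentSpace 𝓘(ℂ, V)) x₀).symmL ℂ x).toLinearMap.restrictScalars ℝ)

/-- A covector of the model space, pulled back to `T_xX` by the differential at `x` of the chart
centred at `x₀`. -/
def modelToCotangent (x₀ x : X) : (V →ₗ[ℝ] ℂ) →ₗ[ℂ] Cotangent V x :=
  LinearMap.lcomp ℂ ℂ
    (((trivializationAt V (TangentSpace 𝓘(ℂ, V)) x₀).continuousLinearMapAt ℂ
      x).toLinearMap.restrictScalars ℝ)

/-! #### The operators `∂` and `∂̄` -/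

variable {V} in
/-- The derivative at `y`, in the direction `v`, of a function with values in the (finite
dimensional) exterior algebra of the model cotangent space. -/
def dirDeriv (g : V → ExteriorAlgebra ℂ (V →ₗ[ℝ] ℂ)) (y v : V) :
    ExteriorAlgebra ℂ (V →ₗ[ℝ] ℂ) :=
  ∑ I, (fderiv ℝ (fun z =>
      (Module.finBasis ℂ (V →ₗ[ℝ] ℂ)).ExteriorAlgebra.coord I (g z)) y v) •
    (Module.finBasis ℂ (V →ₗ[ℝ] ℂ)).ExteriorAlgebra I

/-- The linear coordinates `z_k` of the model space, and their differentials `dz_k`. -/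
def dz (k : Fin (Module.finrank ℂ V)) : V →ₗ[ℝ] ℂ :=
  ((Module.finBasis ℂ V).coord k).restrictScalars ℝ

/-- The conjugate differentials `dz̄_k`. -/
def dzbar (k : Fin (Module.finrank ℂ V)) : V →ₗ[ℝ] ℂ :=
  Complex.conjAe.toLinearMap ∘ₗ dz V k

variable {V} in
/-- `∂g = ∑ dz_k ∧ ∂g/∂z_k`, with `∂/∂z_k = ½ (∂/∂x_k - i ∂/∂y_k)`. -/
def modelDel (g : V → ExteriorAlgebra ℂ (V →ₗ[ℝ] ℂ)) (y : V) : ExteriorAlgebra ℂ (V →ₗ[ℝ] ℂ) :=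
  ∑ k, ExteriorAlgebra.ι ℂ (dz V k) *
    ((1 / 2 : ℂ) • (dirDeriv g y (Module.finBasis ℂ V k) -
      Complex.I • dirDeriv g y (Complex.I • Module.finBasis ℂ V k)))

variable {V} in
/-- `∂̄g = ∑ dz̄_k ∧ ∂g/∂z̄_k`, with `∂/∂z̄_k = ½ (∂/∂x_k + i ∂/∂y_k)`. -/
def modelDelbar (g : V → ExteriorAlgebra ℂ (V →ₗ[ℝ] ℂ)) (y : V) :
    ExteriorAlgebra ℂ (V →ₗ[ℝ] ℂ) :=
  ∑ k, ExteriorAlgebra.ι ℂ (dzbar V k) *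
    ((1 / 2 : ℂ) • (dirDeriv g y (Module.finBasis ℂ V k) +
      Complex.I • dirDeriv g y (Complex.I • Module.finBasis ℂ V k)))

variable {V}

open Classical in
/-- A form on `U`, read in the chart centred at `x₀`. -/
def formCoord {U : Opens X} (θ : ∀ x : U, FormFibre V (x : X)) (x₀ : X) (y : V) :
    ExteriorAlgebra ℂ (V →ₗ[ℝ] ℂ) :=
  if h : (chartAt V x₀).symm y ∈ U then
    ExteriorAlgebra.map (cotangentToModel V x₀ ((chartAt V x₀).symm y)) (θ ⟨_, h⟩)
  else 0

/-- The operator `∂` on differential forms, computed at each point in the chart centred there. -/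
def del {U : Opens X} (θ : ∀ x : U, FormFibre V (x : X)) : ∀ x : U, FormFibre V (x : X) :=
  fun x => ExteriorAlgebra.map (modelToCotangent V (x : X) (x : X))
    (modelDel (formCoord θ x) (chartAt V (x : X) x))

/-- The operator `∂̄` on differential forms, computed at each point in the chart centred there. -/
def delbar {U : Opens X} (θ : ∀ x : U, FormFibre V (x : X)) : ∀ x : U, FormFibre V (x : X) :=
  fun x => ExteriorAlgebra.map (modelToCotangent V (x : X) (x : X))
    (modelDelbar (formCoord θ x) (chartAt V (x : X) x))

/-! #### The sheaf of superalgebras `𝒜* ⊗̂ ⋀ℰ` of real-analytic `⋀E`-valued forms -/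

section Sheaf

variable (F : Type*) [NormedAddCommGroup F] [NormedSpace ℂ F] [FiniteDimensional ℂ F]
variable (E : X → Type*) [∀ x, AddCommGroup (E x)] [∀ x, Module ℂ (E x)]
variable [∀ x, TopologicalSpace (E x)] [TopologicalSpace (TotalSpace F E)]
variable [FiberBundle F E] [VectorBundle ℂ F E]

/-- The fibre of `⋀T*X ⊗̂ ⋀E` at `x`, read in the chart and the trivialization centred at `x₀`. -/
def fibreCoord (x₀ x : X) : Fibre V E x →ₐ[ℂ] SuperTensor (V →ₗ[ℝ] ℂ) F :=
  SuperTensor.map (cotangentToModel V x₀ x)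
    ((trivializationAt F E x₀).continuousLinearMapAt ℂ x).toLinearMap

variable {E} in
open Classical in
/-- A section of `⋀T*X ⊗̂ ⋀E` over `U`, read in the chart and the trivialization centred at
`x₀`. -/
def sectionCoord {U : Opens X} (s : ∀ x : U, Fibre V E (x : X)) (x₀ : X) (y : V) :
    SuperTensor (V →ₗ[ℝ] ℂ) F :=
  if h : (chartAt V x₀).symm y ∈ U then
    fibreCoord F E x₀ ((chartAt V x₀).symm y) (s ⟨_, h⟩)
  else 0

variable {E} in
/-- A section is real-analytic if all its coordinates are, in the chart and the trivialization
centred at any point. -/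
def IsAnalyticSection {U : Opens X} (s : ∀ x : U, Fibre V E (x : X)) : Prop :=
  ∀ (x₀ : U) (l : SuperTensor (V →ₗ[ℝ] ℂ) F →ₗ[ℂ] ℂ),
    AnalyticAt ℝ (fun y => l (sectionCoord F s (x₀ : X) y)) (chartAt V (x₀ : X) x₀)

instance finite_superTensor {C W : Type*} [AddCommGroup C] [Module ℂ C] [Module.Finite ℂ C]
    [AddCommGroup W] [Module ℂ W] [Module.Finite ℂ W] : Module.Finite ℂ (SuperTensor C W) := by
  have h₁ : Module.Finite ℂ (ExteriorAlgebra ℂ C) :=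
    Module.Finite.of_basis (Module.finBasis ℂ C).ExteriorAlgebra
  have h₂ : Module.Finite ℂ (ExteriorAlgebra ℂ W) :=
    Module.Finite.of_basis (Module.finBasis ℂ W).ExteriorAlgebra
  exact Module.Finite.equiv
    (GradedTensorProduct.of ℂ (fun i : ℕ => ⋀[ℂ]^i C) (fun i : ℕ => ⋀[ℂ]^i W))

theorem analyticAt_mul {M : Type*} [Ring M] [Algebra ℂ M] [Module.Finite ℂ M]
    {f g : V → M} {y : V}
    (hf : ∀ l : M →ₗ[ℂ] ℂ, AnalyticAt ℝ (fun z => l (f z)) y)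
    (hg : ∀ l : M →ₗ[ℂ] ℂ, AnalyticAt ℝ (fun z => l (g z)) y) (l : M →ₗ[ℂ] ℂ) :
    AnalyticAt ℝ (fun z => l (f z * g z)) y := by
  let b := Module.finBasis ℂ M
  have h : (fun z => l (f z * g z)) =
      fun z => ∑ i, ∑ j, b.coord i (f z) * b.coord j (g z) * l (b i * b j) := by
    funext z
    conv_lhs => rw [← b.sum_repr (f z), ← b.sum_repr (g z)]
    rw [Finset.sum_mul_sum]
    simp only [map_sum, smul_mul_smul_comm, map_smul, smul_eq_mul, Module.Basis.coord_apply]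
  rw [h]
  refine Finset.analyticAt_fun_sum _ fun i _ => Finset.analyticAt_fun_sum _ fun j _ => ?_
  exact ((hf _).mul (hg _)).mul analyticAt_const

variable (V)

/-- The sections over `U` of the sheaf of superalgebras `𝒜* ⊗̂ ⋀ℰ` of real-analytic
`⋀E`-valued differential forms. -/
def analyticSections (U : Opens X) : Subalgebra ℂ (∀ x : U, Fibre V E (x : X)) where
  carrier := {s | IsAnalyticSection F s}
  mul_mem' := by
    intro s t hs ht x₀ l
    have h : (fun y => l (sectionCoord F (s * t) (x₀ : X) y)) =
        fun y => l (sectionCoord F s (x₀ : X) y * sectionCoord F t (x₀ : X) y) := by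
      funext y
      unfold sectionCoord
      split_ifs <;> simp
    rw [h]
    exact analyticAt_mul (hs x₀) (ht x₀) l
  add_mem' := by
    intro s t hs ht x₀ l
    have h : (fun y => l (sectionCoord F (s + t) (x₀ : X) y)) =
        fun y => l (sectionCoord F s (x₀ : X) y) + l (sectionCoord F t (x₀ : X) y) := by
      funext y
      unfold sectionCoord
      split_ifs <;> simp
    rw [h]
    exact (hs x₀ l).add (ht x₀ l)
  algebraMap_mem' := by
    intro c x₀ l
    have hU : ∀ᶠ y in nhds (chartAt V (x₀ : X) x₀), (chartAt V (x₀ : X)).symm y ∈ U := by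
      have hc := (chartAt V (x₀ : X)).continuousAt_symm
        (x := chartAt V (x₀ : X) x₀) (by simp)
      refine hc.eventually (U.isOpen.mem_nhds ?_)
      simp
    have h : (fun _ => l (algebraMap ℂ (SuperTensor (V →ₗ[ℝ] ℂ) F) c)) =ᶠ[nhds
        (chartAt V (x₀ : X) x₀)]
        fun y => l (sectionCoord F (algebraMap ℂ (∀ x : U, Fibre V E (x : X)) c) (x₀ : X) y) := by
      filter_upwards [hU] with y hy
      simp [sectionCoord, hy]
    exact analyticAt_const.congr h

/-- The parity involution on sections. -/
def parityOp (U : Opens X) : Module.End ℂ (analyticSections V F E U) where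
  toFun s := ⟨fun x => SuperTensor.parity (s.1 x), by
    intro x₀ l
    have h : (fun y => l (sectionCoord F (fun x : U => SuperTensor.parity (s.1 x)) (x₀ : X) y)) =
        fun y => (l ∘ₗ SuperTensor.parity.toLinearMap) (sectionCoord F s.1 (x₀ : X) y) := by
      funext y
      unfold sectionCoord
      split_ifs
      · simp only [LinearMap.comp_apply, AlgHom.toLinearMap_apply, fibreCoord,
          SuperTensor.parity, SuperTensor.map_map]
        congr 3; all_goals (ext; simp)
      · simp
    rw [h]
    exact s.2 x₀ _⟩
  map_add' s t := by ext x; simp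
  map_smul' c s := by ext x; simp

/-- A `ℂ`-linear endomorphism of the sheaf `𝒜* ⊗̂ ⋀ℰ`: a family of `ℂ`-linear endomorphisms of
the spaces of sections over the open sets, compatible with restriction. -/
structure SheafEnd where
  toFun : ∀ U : Opens X, Module.End ℂ (analyticSections V F E U)
  compat : ∀ (U W : Opens X) (h : W ≤ U) (s : analyticSections V F E U)
    (t : analyticSections V F E W), (∀ x : W, t.1 x = s.1 ⟨x, h x.2⟩) →
      ∀ x : W, (toFun W t).1 x = (toFun U s).1 ⟨x, h x.2⟩

variable {V} in
/-- A differential form `θ`, as a `⋀E`-valued form `θ ⊗ 1`. -/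
def formSection {U : Opens X} (θ : ∀ x : U, FormFibre V (x : X)) :
    ∀ x : U, Fibre V E (x : X) :=
  fun x => θ x ᵍ⊗ₜ[ℂ] 1

/-- A section `τ` of `E^∨` is real-analytic if its pairing with every real-analytic local section
of `E` is a real-analytic function. -/
def IsAnalyticDualSection (τ : ∀ x : X, Module.Dual ℂ (E x)) : Prop :=
  ∀ (U : Opens X) (e : ∀ x : U, E (x : X)),
    (fun x : U => (1 : FormFibre V (x : X)) ᵍ⊗ₜ[ℂ] ExteriorAlgebra.ι ℂ (e x)) ∈
      analyticSections V F E U →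
    (fun x : U => algebraMap ℂ (Fibre V E (x : X)) (τ x (e x))) ∈ analyticSections V F E U

variable {V F E}

/-- The section `s` belongs to `𝒜^{p,q} ⊗ ⋀ᵐℰ`. -/
def HasType {U : Opens X} (s : analyticSections V F E U) (p q m : ℕ) : Prop :=
  ∀ x : U, s.1 x ∈ fibrePart V E (x : X) p q m

/-- The section `s` belongs to the term `Tⁱ = ⨁_{q - m = i} 𝒜^{0,q} ⊗ ⋀ᵐℰ`. -/
def InTwisted {U : Opens X} (s : analyticSections V F E U) (i : ℤ) : Prop :=
  ∀ x : U, s.1 x ∈ twistedPart V E (x : X) i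

/-- Odd superderivations of the sheaf of superalgebras `𝒜* ⊗̂ ⋀ℰ`. The parity involution of `s`
is `(-1) ^ |s| s` when `s` is homogeneous. -/
structure IsOddSuperderivation (D : SheafEnd V F E) : Prop where
  odd : ∀ (U : Opens X) (s : analyticSections V F E U),
    D.toFun U (parityOp V F E U s) = -parityOp V F E U (D.toFun U s)
  leibniz : ∀ (U : Opens X) (s t : analyticSections V F E U),
    D.toFun U (s * t) = D.toFun U s * t + parityOp V F E U s * D.toFun U t

/-- The restriction of `D` to the real-analytic forms `𝒜*` is the operator `d`. -/
def RestrictsTo (D : SheafEnd V F E)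
    (d : ∀ {U : Opens X}, (∀ x : U, FormFibre V (x : X)) → ∀ x : U, FormFibre V (x : X)) : Prop :=
  ∀ (U : Opens X) (θ : ∀ x : U, FormFibre V (x : X))
    (hθ : formSection E θ ∈ analyticSections V F E U),
    (D.toFun U ⟨formSection E θ, hθ⟩).1 = formSection E (d θ)

variable (V F E)

/-- A flat real-analytic connection of type `(1,0)` on `E`, given through its unique extension to an
odd superderivation of `𝒜* ⊗̂ ⋀ℰ` which restricts to `∂` on `𝒜*`. -/
structure FlatConnection10 where
  op : SheafEnd V F E
  superderivation : IsOddSuperderivation op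
  restrict_forms : RestrictsTo op del
  type_one_zero : ∀ (U : Opens X) (s : analyticSections V F E U),
    HasType s 0 0 1 → HasType (op.toFun U s) 1 0 1
  flat : ∀ (U : Opens X) (s : analyticSections V F E U),
    HasType s 0 0 1 → op.toFun U (op.toFun U s) = 0

/-- A Koszul-Dolbeault twisting differential `δ = ∑ a_k` for a section `τ` of `E^∨`: the components
`a_k` map `𝒜^{0,q} ⊗ ⋀ᵐℰ` to `𝒜^{0,q+k} ⊗ ⋀^{m+k-1}ℰ`, `a₀` is the contraction `ι_τ`, `a₁` is
(the extension to `𝒜* ⊗̂ ⋀ℰ` of) a connection of type `(0,1)` on `E`, the `a_k` with `k ≥ 2` are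
`𝒜*`-linear superderivations, and `δ² = 0` on `T* = 𝒜^{0,*} ⊗ ⋀ℰ`.
The sum stops at the dimension of `X`, as there are no `(0,k)`-forms beyond it. -/
structure TwistingDifferential (τ : ∀ x : X, Module.Dual ℂ (E x)) where
  a : ℕ → SheafEnd V F E
  bidegree : ∀ (k q m m' : ℕ), m' + 1 = m + k →
    ∀ (U : Opens X) (s : analyticSections V F E U),
      HasType s 0 q m → HasType ((a k).toFun U s) 0 (q + k) m'
  contraction_zero : ∀ (U : Opens X) (s : analyticSections V F E U) (x : U),
    ((a 0).toFun U s).1 x = contraction (τ x) (s.1 x)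
  superderivation : ∀ k, 1 ≤ k → IsOddSuperderivation (a k)
  restrict_forms_one : RestrictsTo (a 1) delbar
  restrict_forms : ∀ k, 2 ≤ k → RestrictsTo (a k) (fun _ _ => 0)
  sq_zero : ∀ (U : Opens X) (i : ℤ) (s : analyticSections V F E U), InTwisted s i →
    (∑ k ∈ Finset.range (Module.finrank ℂ V + 1), (a k).toFun U)
      ((∑ k ∈ Finset.range (Module.finrank ℂ V + 1), (a k).toFun U) s) = 0

variable {V F E}

/-- The operator `δ = ∑ a_k`. -/
def TwistingDifferential.op {τ : ∀ x : X, Module.Dual ℂ (E x)}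
    (δ : TwistingDifferential V F E τ) (U : Opens X) : Module.End ℂ (analyticSections V F E U) :=
  ∑ k ∈ Finset.range (Module.finrank ℂ V + 1), (δ.a k).toFun U

/-- The operator `A = ∇ + δ`. -/
def superconnection {τ : ∀ x : X, Module.Dual ℂ (E x)} (nabla : FlatConnection10 V F E)
    (δ : TwistingDifferential V F E τ) (U : Opens X) : Module.End ℂ (analyticSections V F E U) :=
  nabla.op.toFun U + δ.op U

/-- The curvature `R_A = A²`. -/
def curvature {τ : ∀ x : X, Module.Dual ℂ (E x)} (nabla : FlatConnection10 V F E)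
    (δ : TwistingDifferential V F E τ) (U : Opens X) : Module.End ℂ (analyticSections V F E U) :=
  superconnection nabla δ U * superconnection nabla δ U

variable (V E) in
/-- The fibre at `x` of `𝒜* ⊗̂ ℰnd(⋀E)`. -/
abbrev EndFibre (x : X) := FormFibre V x ⊗[ℂ] Module.End ℂ (ExteriorAlgebra ℂ (E x))

/-- The operators `Φ U` on the sections of `𝒜* ⊗̂ ⋀ℰ` are the action of the section `ψ` of
`𝒜* ⊗̂ ℰnd(⋀E)`. -/
def IsActionOf (ψ : ∀ x : X, EndFibre V E x)
    (Φ : ∀ U : Opens X, Module.End ℂ (analyticSections V F E U)) : Prop :=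
  ∀ (U : Opens X) (s : analyticSections V F E U) (x : U), (Φ U s).1 x = act (ψ x) (s.1 x)

end Sheaf

end Forms

end

end TwistedDolbeault

/-!
Write `R = A² = (∇ + δ)²`. The argument rests on four facts.

**The curvature is an even derivation which kills the forms and commutes with `δ`.** Two odd
superderivations have a derivation as supercommutator. On functions, `∂² = ∂̄² = ∂∂̄ + ∂̄∂ = 0` by
the symmetry of the second derivative (`modelD_modelD`, `formD_formD`). Applied to the coordinate
functions this shows that the coordinate differentials are closed (`IsFormDerivation.closed`), and
the derivations `∇²` and `δ²`, which also vanish on frames of `E` by hypothesis, vanish altogether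
(`FlatConnection10.sq_eq_zero`, `TwistingDifferential.sq_eq_zero`). Hence `R = ∇δ + δ∇`
(`curvature_eq`), so `R` commutes with `δ` (`curvature_comm`) and vanishes on all forms
(`curvature_form`). All this is checked over domains with coordinates, where every section is a
combination, with functions as coefficients, of sections with constant coordinates
(`eq_sum_coeff`); the operators are local, which suffices.

**Powers of `R` are actions of sections.** An operator on `⋀C ⊗̂ ⋀W`, with `W` finite dimensional,
is the action of a unique element of `⋀C ⊗̂ End(⋀W)` if and only if it is linear for the right
multiplication by `⋀C` (`act_mul_inl`, `exists_act_eq`, `act_injective`). As `R` is a derivation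
which vanishes on forms, `R ^ r / r!` is linear over the forms, hence is given by such an element in
each fibre (`exists_isActionOf`).

**The generalized supertrace is a supertrace.** For an even `ψ`, the operator `Tr_Λ(ψ)` is
`s ↦ Str (l_s ∘ ψ) = ∑ J, (-1) ^ |J| c_J (s ψ(e_J))`, where `e_J` is a basis of `⋀W` and `c_J` is
the coefficient of `e_J` (`act_genSupertrace`). In a local frame this formula shows that `Tr_Λ(ψ)`
preserves real-analyticity. It commutes with `δ` because
`Str (l_{δs} ∘ ψ) = Str [δ, l_s ∘ ψ] = δ Str (l_s ∘ ψ)` when `[δ, ψ] = 0`: the connection matrix of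
`δ` drops out, being the supertrace of a supercommutator (`IsSuperFrame.supertrace_comm`). Since
`Tr_Λ(ψ)` has values in the forms, on which `δ` is `∂̄`, it intertwines `δ` and `∂̄`.

**Degrees.** An odd superderivation shifts the form type and the total degree as it does on
functions and frames (`weight_le_of_generators`, `IsOddDer.hasWeight`). So `∇` has bidegree
`(1, 0)`, `δ` has bidegree `(0, 1)`, and `R ^ r` has bidegree `(r, r)`; the supertrace formula then
gives the degrees of `Tr_Λ(ψ)`.
-/

namespace TwistedDolbeault

noncomputable section

/-! ### The superalgebra `⋀C ⊗̂ ⋀W` -/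

section SuperAlgebra

variable {C : Type*} [AddCommGroup C] [Module ℂ C]
variable {W : Type*} [AddCommGroup W] [Module ℂ W]

/-- The inclusion `a ↦ a ⊗ 1` of `⋀C` in `⋀C ⊗̂ ⋀W`. -/
def inl (W : Type*) [AddCommGroup W] [Module ℂ W] :
    ExteriorAlgebra ℂ C →ₐ[ℂ] SuperTensor C W :=
  GradedTensorProduct.includeLeft (fun i : ℕ => ⋀[ℂ]^i C) (fun i : ℕ => ⋀[ℂ]^i W)

/-- The inclusion `b ↦ 1 ⊗ b` of `⋀W` in `⋀C ⊗̂ ⋀W`. -/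
def inr (C : Type*) [AddCommGroup C] [Module ℂ C] :
    ExteriorAlgebra ℂ W →ₐ[ℂ] SuperTensor C W :=
  GradedTensorProduct.includeRight (fun i : ℕ => ⋀[ℂ]^i C) (fun i : ℕ => ⋀[ℂ]^i W)

theorem inl_apply (a : ExteriorAlgebra ℂ C) : inl W a = a ᵍ⊗ₜ[ℂ] 1 := rfl

theorem inr_apply (b : ExteriorAlgebra ℂ W) : inr C b = 1 ᵍ⊗ₜ[ℂ] b := rfl

theorem inl_mul_inr (a : ExteriorAlgebra ℂ C) (b : ExteriorAlgebra ℂ W) :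
    inl W a * inr C b = a ᵍ⊗ₜ[ℂ] b :=
  GradedTensorProduct.tmul_one_mul_one_tmul _ _ a b

theorem inl_mul_tmul (a a' : ExteriorAlgebra ℂ C) (b : ExteriorAlgebra ℂ W) :
    inl W a * (a' ᵍ⊗ₜ[ℂ] b) = (a * a') ᵍ⊗ₜ[ℂ] b := by
  rw [← inl_mul_inr, ← mul_assoc, ← map_mul, inl_mul_inr]

theorem gadd_tmul (a a' : ExteriorAlgebra ℂ C) (b : ExteriorAlgebra ℂ W) :
    ((a + a') ᵍ⊗ₜ[ℂ] b : SuperTensor C W) = a ᵍ⊗ₜ[ℂ] b + a' ᵍ⊗ₜ[ℂ] b :=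
  TensorProduct.add_tmul a a' b

theorem gtmul_add (a : ExteriorAlgebra ℂ C) (b b' : ExteriorAlgebra ℂ W) :
    (a ᵍ⊗ₜ[ℂ] (b + b') : SuperTensor C W) = a ᵍ⊗ₜ[ℂ] b + a ᵍ⊗ₜ[ℂ] b' :=
  TensorProduct.tmul_add a b b'

theorem gsmul_tmul (z : ℂ) (a : ExteriorAlgebra ℂ C) (b : ExteriorAlgebra ℂ W) :
    ((z • a) ᵍ⊗ₜ[ℂ] b : SuperTensor C W) = z • (a ᵍ⊗ₜ[ℂ] b) :=
  TensorProduct.smul_tmul' z a b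

theorem gtmul_smul (z : ℂ) (a : ExteriorAlgebra ℂ C) (b : ExteriorAlgebra ℂ W) :
    (a ᵍ⊗ₜ[ℂ] (z • b) : SuperTensor C W) = z • (a ᵍ⊗ₜ[ℂ] b) :=
  TensorProduct.tmul_smul z a b

theorem gtmul_neg (a : ExteriorAlgebra ℂ C) (b : ExteriorAlgebra ℂ W) :
    (a ᵍ⊗ₜ[ℂ] (-b) : SuperTensor C W) = -(a ᵍ⊗ₜ[ℂ] b) :=
  TensorProduct.tmul_neg a b

theorem gtmul_sub (a : ExteriorAlgebra ℂ C) (b b' : ExteriorAlgebra ℂ W) :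
    (a ᵍ⊗ₜ[ℂ] (b - b') : SuperTensor C W) = a ᵍ⊗ₜ[ℂ] b - a ᵍ⊗ₜ[ℂ] b' :=
  TensorProduct.tmul_sub a b b'

theorem gzero_tmul (b : ExteriorAlgebra ℂ W) :
    ((0 : ExteriorAlgebra ℂ C) ᵍ⊗ₜ[ℂ] b : SuperTensor C W) = 0 :=
  TensorProduct.zero_tmul _ b

theorem gtmul_zero (a : ExteriorAlgebra ℂ C) :
    (a ᵍ⊗ₜ[ℂ] (0 : ExteriorAlgebra ℂ W) : SuperTensor C W) = 0 :=
  TensorProduct.tmul_zero _ a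

theorem ι_mem_exteriorPower_one (w : W) : ExteriorAlgebra.ι ℂ w ∈ ⋀[ℂ]^1 W := by
  rw [ExteriorAlgebra.exteriorPower, pow_one]
  exact ⟨w, rfl⟩

@[elab_as_elim]
theorem tmul_induction {P : SuperTensor C W → Prop} (t : SuperTensor C W)
    (tmul : ∀ a b, P (a ᵍ⊗ₜ[ℂ] b)) (add : ∀ s t, P s → P t → P (s + t)) : P t := by
  refine TensorProduct.induction_on (motive := fun t => P t) t ?_ tmul add
  have h := tmul 0 0
  rwa [gzero_tmul] at h

/-- `⋀C ⊗̂ ⋀W` is generated as an algebra by `C` and `W`. -/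
@[elab_as_elim]
theorem superTensor_induction {P : SuperTensor C W → Prop} (t : SuperTensor C W)
    (algebraMap : ∀ z : ℂ, P (algebraMap ℂ _ z))
    (inl_ι : ∀ c, P (inl W (ExteriorAlgebra.ι ℂ c)))
    (inr_ι : ∀ w, P (inr C (ExteriorAlgebra.ι ℂ w)))
    (add : ∀ s t, P s → P t → P (s + t)) (mul : ∀ s t, P s → P t → P (s * t)) : P t := by
  refine tmul_induction t (fun a b => ?_) add
  rw [← inl_mul_inr]
  refine mul _ _ ?_ ?_
  · induction a using ExteriorAlgebra.induction with
    | algebraMap r => rw [AlgHom.commutes]; exact algebraMap r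
    | ι x => exact inl_ι x
    | mul a b ha hb => rw [_root_.map_mul]; exact mul _ _ ha hb
    | add a b ha hb => rw [_root_.map_add]; exact add _ _ ha hb
  · induction b using ExteriorAlgebra.induction with
    | algebraMap r => rw [AlgHom.commutes]; exact algebraMap r
    | ι x => exact inr_ι x
    | mul a b ha hb => rw [_root_.map_mul]; exact mul _ _ ha hb
    | add a b ha hb => rw [_root_.map_add]; exact add _ _ ha hb

@[simp] theorem eps_ι (w : W) : eps (ExteriorAlgebra.ι ℂ w) = -ExteriorAlgebra.ι ℂ w :=
  CliffordAlgebra.involute_ι w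

@[simp] theorem eps_one : eps (1 : ExteriorAlgebra ℂ W) = 1 :=
  map_one CliffordAlgebra.involute

@[simp] theorem eps_mul (a b : ExteriorAlgebra ℂ W) : eps (a * b) = eps a * eps b :=
  map_mul CliffordAlgebra.involute a b

@[simp] theorem eps_eps (a : ExteriorAlgebra ℂ W) : eps (eps a) = a :=
  CliffordAlgebra.involute_involute a

@[simp] theorem eps_mul_eps_eq_one : (eps : Module.End ℂ (ExteriorAlgebra ℂ W)) * eps = 1 :=
  LinearMap.ext eps_eps

theorem map_neg_id (a : ExteriorAlgebra ℂ W) :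
    ExteriorAlgebra.map (-LinearMap.id) a = eps a := by
  have h : ExteriorAlgebra.map (-LinearMap.id : W →ₗ[ℂ] W) =
      CliffordAlgebra.involute (Q := (0 : QuadraticForm ℂ W)) := by
    apply ExteriorAlgebra.hom_ext
    ext w
    simp only [LinearMap.comp_apply, AlgHom.toLinearMap_apply, ExteriorAlgebra.map_apply_ι]
    rw [LinearMap.neg_apply, LinearMap.id_apply, map_neg]
    exact (CliffordAlgebra.involute_ι w).symm
  exact DFunLike.congr_fun h a

theorem eps_of_mem {i : ℕ} {a : ExteriorAlgebra ℂ W} (ha : a ∈ ⋀[ℂ]^i W) :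
    eps a = (-1 : ℂ) ^ i • a := by
  induction ha using Submodule.pow_induction_on_left' with
  | algebraMap r =>
    rw [pow_zero, one_smul]
    exact CliffordAlgebra.involute.commutes r
  | add x y i _ _ hx hy => rw [map_add, hx, hy, smul_add]
  | mem_mul m hm i x _ hx =>
    obtain ⟨w, rfl⟩ := hm
    rw [eps_mul, hx, eps_ι, mul_smul_comm, neg_mul, smul_neg, pow_succ, mul_neg_one, neg_smul]

theorem parity_tmul (a : ExteriorAlgebra ℂ C) (b : ExteriorAlgebra ℂ W) :
    SuperTensor.parity (a ᵍ⊗ₜ[ℂ] b) = (eps a) ᵍ⊗ₜ[ℂ] (eps b) := by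
  rw [SuperTensor.parity, SuperTensor.map_tmul, map_neg_id, map_neg_id]

@[simp] theorem parity_inl (a : ExteriorAlgebra ℂ C) :
    SuperTensor.parity (inl W a) = inl W (eps a) := by
  rw [inl_apply, parity_tmul, eps_one, inl_apply]

@[simp] theorem parity_inr (b : ExteriorAlgebra ℂ W) :
    SuperTensor.parity (inr C b) = inr C (eps b) := by
  rw [inr_apply, parity_tmul, eps_one, inr_apply]

@[simp] theorem parity_parity (s : SuperTensor C W) :
    SuperTensor.parity (SuperTensor.parity s) = s := by
  induction s using tmul_induction with
  | tmul a b => rw [parity_tmul, parity_tmul, eps_eps, eps_eps]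
  | add s t hs ht => rw [map_add, map_add, hs, ht]

theorem tmul_mul_tmul_of_mem {i j : ℕ} (a : ExteriorAlgebra ℂ C) {b : ExteriorAlgebra ℂ W}
    (hb : b ∈ ⋀[ℂ]^j W) {a' : ExteriorAlgebra ℂ C} (ha' : a' ∈ ⋀[ℂ]^i C)
    (b' : ExteriorAlgebra ℂ W) :
    (a ᵍ⊗ₜ[ℂ] b : SuperTensor C W) * (a' ᵍ⊗ₜ[ℂ] b') =
      (-1 : ℂ) ^ (j * i) • ((a * a') ᵍ⊗ₜ[ℂ] (b * b')) := by
  have h := GradedTensorProduct.tmul_coe_mul_coe_tmul (R := ℂ)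
    (fun i : ℕ => ⋀[ℂ]^i C) (fun i : ℕ => ⋀[ℂ]^i W) a ⟨b, hb⟩ ⟨a', ha'⟩ b'
  refine h.trans ?_
  rcases Nat.even_or_odd (j * i) with e | e
  · rw [e.neg_one_pow]
    erw [e.neg_one_pow]
    rw [one_smul, one_smul]
  · rw [e.neg_one_pow]
    erw [e.neg_one_pow]
    rw [neg_smul, one_smul, Units.neg_smul, one_smul]

theorem mul_inl_ι (s : SuperTensor C W) (c : C) :
    s * inl W (ExteriorAlgebra.ι ℂ c) =
      inl W (ExteriorAlgebra.ι ℂ c) * SuperTensor.parity s := by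
  induction s using superTensor_induction with
  | algebraMap z => rw [AlgHom.commutes, Algebra.commutes]
  | inl_ι c' =>
    rw [parity_inl, eps_ι, ← map_mul (inl W), ← map_mul (inl W), mul_neg]
    congr 1
    rw [eq_neg_iff_add_eq_zero]
    exact ExteriorAlgebra.ι_add_mul_swap c' c
  | inr_ι w =>
    have h : (1 ᵍ⊗ₜ[ℂ] ExteriorAlgebra.ι ℂ w : SuperTensor C W) *
        (ExteriorAlgebra.ι ℂ c ᵍ⊗ₜ[ℂ] 1) = _ :=
      tmul_mul_tmul_of_mem (i := 1) (j := 1) 1 (ι_mem_exteriorPower_one w)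
        (ι_mem_exteriorPower_one c) 1
    rw [inr_apply, inl_apply, h, ← inr_apply, ← inl_apply, parity_inr, eps_ι, map_neg, mul_neg,
      inl_mul_inr]
    rw [mul_one, mul_one, one_mul, pow_one, neg_smul, one_smul]
  | add s t hs ht => rw [add_mul, hs, ht, map_add, mul_add]
  | mul s t hs ht => rw [mul_assoc, ht, ← mul_assoc, hs, mul_assoc, map_mul]

/-- The sign rule: moving a form of degree `i` to the left past `s` applies the parity
involution `i` times to `s`. -/
theorem mul_inl_of_mem (s : SuperTensor C W) {i : ℕ} {a : ExteriorAlgebra ℂ C}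
    (ha : a ∈ ⋀[ℂ]^i C) :
    s * inl W a = inl W a * (SuperTensor.parity^[i] s) := by
  induction ha using Submodule.pow_induction_on_left' generalizing s with
  | algebraMap r =>
    rw [AlgHom.commutes, Function.iterate_zero, id, Algebra.commutes]
  | add x y i _ _ hx hy => rw [map_add, mul_add, hx, hy, add_mul]
  | mem_mul m hm i x _ hx =>
    obtain ⟨w, rfl⟩ := hm
    rw [map_mul, ← mul_assoc, mul_inl_ι, mul_assoc, hx, mul_assoc, Function.iterate_succ_apply]

/-- Supercommutation with a form `a = a₀ + a₁` split into its even and odd parts: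
`s a = a₀ s + a₁ p(s)`. -/
theorem mul_inl (s : SuperTensor C W) (a : ExteriorAlgebra ℂ C) :
    s * inl W a = inl W ((1 / 2 : ℂ) • (a + eps a)) * s +
      inl W ((1 / 2 : ℂ) • (a - eps a)) * SuperTensor.parity s := by
  induction a using DirectSum.Decomposition.inductionOn fun i : ℕ => ⋀[ℂ]^i C with
  | zero =>
    rw [map_zero, map_zero, mul_zero, add_zero, sub_zero, smul_zero, map_zero, zero_mul, zero_mul,
      add_zero]
  | add a b ha hb =>
    rw [map_add, mul_add, ha, hb, map_add]
    simp only [smul_add, smul_sub, map_add, map_sub, add_mul, sub_mul]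
    abel
  | @homogeneous i a =>
    rw [mul_inl_of_mem s a.2, eps_of_mem a.2]
    rcases Nat.even_or_odd i with e | e
    · rw [e.neg_one_pow, one_smul, sub_self, smul_zero, map_zero, zero_mul, add_zero,
        Function.Involutive.iterate_even parity_parity e, id, ← two_smul ℂ, smul_smul]
      norm_num
    · rw [e.neg_one_pow, neg_smul, one_smul, add_neg_cancel, smul_zero, map_zero, zero_mul,
        zero_add, Function.Involutive.iterate_odd parity_parity e, sub_neg_eq_add, ← two_smul ℂ,
        smul_smul]
      norm_num

theorem mul_inl_of_even (s : SuperTensor C W) {a : ExteriorAlgebra ℂ C} (ha : eps a = a) :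
    s * inl W a = inl W a * s := by
  rw [mul_inl, ha, sub_self, smul_zero, map_zero, zero_mul, add_zero, ← two_smul ℂ, smul_smul]
  norm_num

theorem mul_inl_of_odd (s : SuperTensor C W) {a : ExteriorAlgebra ℂ C} (ha : eps a = -a) :
    s * inl W a = inl W a * SuperTensor.parity s := by
  rw [mul_inl, ha, add_neg_cancel, smul_zero, map_zero, zero_mul, zero_add, sub_neg_eq_add,
    ← two_smul ℂ, smul_smul]
  norm_num

/-! ### Contraction is an odd superderivation -/

theorem contraction_tmul (t : Module.Dual ℂ W) (a : ExteriorAlgebra ℂ C)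
    (b : ExteriorAlgebra ℂ W) : contraction t (a ᵍ⊗ₜ[ℂ] b : SuperTensor C W) =
      (eps a) ᵍ⊗ₜ[ℂ] (CliffordAlgebra.contractLeft (Q := (0 : QuadraticForm ℂ W)) t b) :=
  rfl

theorem contraction_inl (t : Module.Dual ℂ W) (a : ExteriorAlgebra ℂ C) :
    contraction t (inl W a) = 0 := by
  rw [inl_apply, contraction_tmul]
  have h : CliffordAlgebra.contractLeft (Q := (0 : QuadraticForm ℂ W)) t
      (1 : ExteriorAlgebra ℂ W) = 0 := CliffordAlgebra.contractLeft_one _ _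
  rw [h, gtmul_zero]

theorem contraction_inl_mul (t : Module.Dual ℂ W) (a : ExteriorAlgebra ℂ C)
    (s : SuperTensor C W) :
    contraction t (inl W a * s) = inl W (eps a) * contraction t s := by
  induction s using tmul_induction with
  | tmul a' b => rw [inl_mul_tmul, contraction_tmul, contraction_tmul, inl_mul_tmul, eps_mul]
  | add s s' hs hs' => rw [mul_add, map_add, hs, hs', map_add, mul_add]

theorem contraction_inr_ι_mul (t : Module.Dual ℂ W) (w : W) (s : SuperTensor C W) :
    contraction t (inr C (ExteriorAlgebra.ι ℂ w) * s) =
      t w • s - inr C (ExteriorAlgebra.ι ℂ w) * contraction t s := by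
  induction s using tmul_induction with
  | tmul a b =>
    have hι := ι_mem_exteriorPower_one w
    induction a using DirectSum.Decomposition.inductionOn fun i : ℕ => ⋀[ℂ]^i C with
    | zero => rw [gzero_tmul, mul_zero, map_zero, smul_zero, mul_zero, sub_zero]
    | add a a' ha ha' =>
      rw [gadd_tmul, mul_add, map_add, ha, ha', map_add, mul_add, smul_add]
      abel
    | @homogeneous i a =>
      have he : eps (a : ExteriorAlgebra ℂ C) ∈ ⋀[ℂ]^i C := by
        rw [eps_of_mem a.2]; exact Submodule.smul_mem _ _ a.2
      have hc : CliffordAlgebra.contractLeft (Q := (0 : QuadraticForm ℂ W)) t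
          (ExteriorAlgebra.ι ℂ w * b) = t w • b -
          ExteriorAlgebra.ι ℂ w * CliffordAlgebra.contractLeft (Q := (0 : QuadraticForm ℂ W)) t b :=
        CliffordAlgebra.contractLeft_ι_mul t w b
      rw [inr_apply, tmul_mul_tmul_of_mem 1 hι a.2, map_smul, contraction_tmul, contraction_tmul,
        tmul_mul_tmul_of_mem 1 hι he, hc, one_mul, one_mul, gtmul_sub,
        gtmul_smul, smul_sub, one_mul]
      congr 1
      rw [eps_of_mem a.2, gsmul_tmul, smul_smul, smul_smul, mul_right_comm, ← mul_pow]
      norm_num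
  | add s s' hs hs' =>
    rw [mul_add, map_add, hs, hs', map_add, mul_add, smul_add]
    abel

theorem contraction_mul (t : Module.Dual ℂ W) (s s' : SuperTensor C W) :
    contraction t (s * s') = contraction t s * s' + SuperTensor.parity s * contraction t s' := by
  induction s using superTensor_induction generalizing s' with
  | algebraMap z =>
    have h : contraction t (algebraMap ℂ (SuperTensor C W) z) = 0 := by
      rw [← AlgHom.commutes (inl W), contraction_inl]
    rw [h, zero_mul, zero_add, AlgHom.commutes, ← Algebra.smul_def, map_smul, Algebra.smul_def]
  | inl_ι c => rw [contraction_inl_mul, contraction_inl, zero_mul, zero_add, parity_inl]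
  | inr_ι w =>
    have h := contraction_inr_ι_mul (C := C) t w 1
    have h1 : contraction t (1 : SuperTensor C W) = 0 := by
      rw [← map_one (inl W), contraction_inl]
    rw [mul_one, h1, mul_zero, sub_zero] at h
    rw [contraction_inr_ι_mul, h, parity_inr, eps_ι, map_neg, smul_mul_assoc, one_mul, neg_mul,
      sub_eq_add_neg]
  | add s u hs hu =>
    rw [add_mul, map_add, hs, hu, map_add, map_add]
    simp only [add_mul]
    abel
  | mul s u hs hu =>
    rw [mul_assoc, hs, hu, hs, map_mul]
    simp only [add_mul, mul_add, mul_assoc]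
    abel

theorem eps_contractLeft (t : Module.Dual ℂ W) (b : ExteriorAlgebra ℂ W) :
    CliffordAlgebra.contractLeft (Q := (0 : QuadraticForm ℂ W)) t (eps b) =
      -eps (CliffordAlgebra.contractLeft (Q := (0 : QuadraticForm ℂ W)) t b) := by
  induction b using CliffordAlgebra.left_induction with
  | algebraMap r =>
    have : eps (algebraMap ℂ (ExteriorAlgebra ℂ W) r) = algebraMap ℂ _ r :=
      CliffordAlgebra.involute.commutes r
    erw [this, CliffordAlgebra.contractLeft_algebraMap, map_zero, neg_zero]
  | add x y hx hy => rw [map_add, map_add, hx, hy, map_add, map_add, neg_add]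
  | ι_mul x w hx =>
    have e : eps (CliffordAlgebra.ι (0 : QuadraticForm ℂ W) w * x) =
      -(CliffordAlgebra.ι (0 : QuadraticForm ℂ W) w * eps x) := by
      rw [← neg_mul]
      exact (eps_mul _ _).trans (congrArg (· * eps x) (eps_ι w))
    rw [e, map_neg, CliffordAlgebra.contractLeft_ι_mul, hx, CliffordAlgebra.contractLeft_ι_mul,
      map_sub, map_smul]
    have e' : ∀ y, eps (CliffordAlgebra.ι (0 : QuadraticForm ℂ W) w * y) =
      -(CliffordAlgebra.ι (0 : QuadraticForm ℂ W) w * eps y) := fun y => by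
      rw [← neg_mul]
      exact (eps_mul _ _).trans (congrArg (· * eps y) (eps_ι w))
    rw [e', mul_neg]

theorem contraction_parity (t : Module.Dual ℂ W) (s : SuperTensor C W) :
    contraction t (SuperTensor.parity s) = -SuperTensor.parity (contraction t s) := by
  induction s using tmul_induction with
  | tmul a b =>
    rw [parity_tmul, contraction_tmul, contraction_tmul, parity_tmul, eps_contractLeft, gtmul_neg]
  | add s s' hs hs' => rw [map_add, map_add, hs, hs', map_add, map_add, neg_add]

end SuperAlgebra

/-! ### Endomorphism-valued forms as right-linear operators -/

section Action

variable {C : Type*} [AddCommGroup C] [Module ℂ C]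
variable {W : Type*} [AddCommGroup W] [Module ℂ W]

/-- The map `a ⊗ b ↦ κ(b) a` from `⋀C ⊗̂ ⋀W` to `⋀C` defined by a linear form `κ` on `⋀W`. -/
def slice (κ : Module.Dual ℂ (ExteriorAlgebra ℂ W)) : SuperTensor C W →ₗ[ℂ] ExteriorAlgebra ℂ C :=
  ((TensorProduct.rid ℂ (ExteriorAlgebra ℂ C)).toLinearMap ∘ₗ LinearMap.lTensor _ κ) ∘ₗ
    (GradedTensorProduct.of ℂ (fun i : ℕ => ⋀[ℂ]^i C)
      (fun i : ℕ => ⋀[ℂ]^i W)).symm.toLinearMap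

@[simp] theorem slice_tmul (κ : Module.Dual ℂ (ExteriorAlgebra ℂ W)) (a : ExteriorAlgebra ℂ C)
    (b : ExteriorAlgebra ℂ W) : slice κ (a ᵍ⊗ₜ[ℂ] b : SuperTensor C W) = κ b • a :=
  TensorProduct.rid_tmul a (κ b)

theorem slice_inl_mul (κ : Module.Dual ℂ (ExteriorAlgebra ℂ W)) (a : ExteriorAlgebra ℂ C)
    (s : SuperTensor C W) : slice κ (inl W a * s) = a * slice κ s := by
  induction s using tmul_induction with
  | tmul a' b => rw [inl_mul_tmul, slice_tmul, slice_tmul, mul_smul_comm]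
  | add s t hs ht => rw [mul_add, map_add, hs, ht, map_add, mul_add]

theorem slice_algebraMapInv_inl (a : ExteriorAlgebra ℂ C) :
    slice (ExteriorAlgebra.algebraMapInv (R := ℂ) (M := W)).toLinearMap (inl W a) = a := by
  rw [inl_apply, slice_tmul, AlgHom.toLinearMap_apply, map_one, one_smul]

theorem inl_injective : Function.Injective (inl W : ExteriorAlgebra ℂ C →ₐ[ℂ] _) :=
  Function.LeftInverse.injective slice_algebraMapInv_inl

/-- Graded commutativity of `⋀C`, inherited from the sign rule of `⋀C ⊗̂ ⋀C`. -/
theorem mul_eq_of_mem {i : ℕ} (a : ExteriorAlgebra ℂ C) {a' : ExteriorAlgebra ℂ C}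
    (ha' : a' ∈ ⋀[ℂ]^i C) : a * a' = a' * eps^[i] a := by
  have h := mul_inl_of_mem (inl C a) ha'
  have h' : SuperTensor.parity^[i] (inl C a) = inl C (eps^[i] a) := by
    generalize a = x
    induction i generalizing x with
    | zero => rfl
    | succ i ih => exact (congrArg _ (parity_inl x)).trans (by
        simpa using (Function.Semiconj.iterate_right
          (f := inl C) (ga := eps) (gb := SuperTensor.parity) (fun y => (parity_inl y).symm) i
            (eps x)).symm)
  rw [h', ← map_mul, ← map_mul] at h
  exact inl_injective h

theorem mul_comm_of_mem {i j : ℕ} {a a' : ExteriorAlgebra ℂ C} (ha : a ∈ ⋀[ℂ]^j C)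
    (ha' : a' ∈ ⋀[ℂ]^i C) : a * a' = ((-1 : ℂ) ^ (j * i)) • (a' * a) := by
  have h : eps^[i] a = ((-1 : ℂ) ^ (j * i)) • a := by
    clear ha'
    induction i with
    | zero => simp
    | succ i ih =>
      rw [Function.iterate_succ_apply', ih, map_smul, eps_of_mem ha, smul_smul, ← pow_add,
        Nat.mul_succ]
  rw [mul_eq_of_mem a ha', h, mul_smul_comm]

theorem tmul_mul_inl_of_mem (x : ExteriorAlgebra ℂ C) (y : ExteriorAlgebra ℂ W) {i : ℕ}
    {a : ExteriorAlgebra ℂ C} (ha : a ∈ ⋀[ℂ]^i C) :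
    (x ᵍ⊗ₜ[ℂ] y) * inl W a = (x * a) ᵍ⊗ₜ[ℂ] (eps^[i] y) := by
  rw [← inl_mul_inr, mul_assoc, mul_inl_of_mem _ ha, ← mul_assoc, ← map_mul, ← inl_mul_inr]
  congr 1
  exact ((Function.Semiconj.iterate_right
    (f := inr C) (ga := eps) (gb := SuperTensor.parity) (fun y => (parity_inr y).symm) i) y).symm

theorem act_tmul (θ a : ExteriorAlgebra ℂ C) (φ : Module.End ℂ (ExteriorAlgebra ℂ W))
    (b : ExteriorAlgebra ℂ W) : act (θ ⊗ₜ[ℂ] φ) (a ᵍ⊗ₜ[ℂ] b : SuperTensor C W) =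
      (θ * a) ᵍ⊗ₜ[ℂ] (evenPart φ b) + (θ * eps a) ᵍ⊗ₜ[ℂ] (oddPart φ b) :=
  rfl

theorem evenPart_apply (φ : Module.End ℂ (ExteriorAlgebra ℂ W)) (b : ExteriorAlgebra ℂ W) :
    evenPart φ b = (1 / 2 : ℂ) • (φ b + eps (φ (eps b))) := rfl

theorem oddPart_apply (φ : Module.End ℂ (ExteriorAlgebra ℂ W)) (b : ExteriorAlgebra ℂ W) :
    oddPart φ b = (1 / 2 : ℂ) • (φ b - eps (φ (eps b))) := rfl

theorem evenPart_eps (φ : Module.End ℂ (ExteriorAlgebra ℂ W)) (b : ExteriorAlgebra ℂ W) :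
    evenPart φ (eps b) = eps (evenPart φ b) := by
  rw [evenPart_apply, evenPart_apply, map_smul, map_add, eps_eps, eps_eps, add_comm]

theorem oddPart_eps (φ : Module.End ℂ (ExteriorAlgebra ℂ W)) (b : ExteriorAlgebra ℂ W) :
    oddPart φ (eps b) = -eps (oddPart φ b) := by
  rw [oddPart_apply, oddPart_apply, map_smul, map_sub, eps_eps, eps_eps, ← smul_neg, neg_sub]

theorem evenPart_add_oddPart (φ : Module.End ℂ (ExteriorAlgebra ℂ W))
    (b : ExteriorAlgebra ℂ W) : evenPart φ b + oddPart φ b = φ b := by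
  rw [evenPart_apply, oddPart_apply, ← smul_add, add_add_sub_cancel, ← two_smul ℂ, smul_smul]
  norm_num

/-- The operators `act ψ` are linear over right multiplication by `⋀C`; in this form the sign rule
disappears. -/
theorem act_mul_inl (ψ : ExteriorAlgebra ℂ C ⊗[ℂ] Module.End ℂ (ExteriorAlgebra ℂ W))
    (s : SuperTensor C W) (a : ExteriorAlgebra ℂ C) :
    act ψ (s * inl W a) = act ψ s * inl W a := by
  induction ψ with
  | zero => rw [map_zero, LinearMap.zero_apply, LinearMap.zero_apply, zero_mul]
  | add ψ ψ' h h' =>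
    rw [map_add, LinearMap.add_apply, LinearMap.add_apply, h, h', add_mul]
  | tmul θ φ =>
    induction s using tmul_induction with
    | add s t hs ht => rw [add_mul, map_add, hs, ht, map_add, add_mul]
    | tmul c b =>
      induction a using DirectSum.Decomposition.inductionOn fun i : ℕ => ⋀[ℂ]^i C with
      | zero => rw [map_zero, mul_zero, map_zero, mul_zero]
      | add a b ha hb => rw [map_add, mul_add, map_add, ha, hb, mul_add]
      | @homogeneous i a =>
        rw [tmul_mul_inl_of_mem _ _ a.2, act_tmul, act_tmul, add_mul,
          tmul_mul_inl_of_mem _ _ a.2, tmul_mul_inl_of_mem _ _ a.2, eps_mul, eps_of_mem a.2,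
          mul_assoc, mul_assoc]
        congr 1
        · rcases Nat.even_or_odd i with e | e
          · rw [Function.Involutive.iterate_even eps_eps e, id, id]
          · rw [Function.Involutive.iterate_odd eps_eps e, evenPart_eps]
        · rcases Nat.even_or_odd i with e | e
          · rw [Function.Involutive.iterate_even eps_eps e, id, id, e.neg_one_pow, one_smul]
          · rw [Function.Involutive.iterate_odd eps_eps e, e.neg_one_pow, oddPart_eps, gtmul_neg,
              neg_one_smul, mul_neg, mul_neg, ← neg_one_smul ℂ (θ * _), gsmul_tmul, neg_one_smul,
              neg_neg]

/-- A linear operator which is right-linear over `⋀C` is determined by its values on `⋀W`. -/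
theorem ext_of_right_linear {Φ Φ' : Module.End ℂ (SuperTensor C W)}
    (h : ∀ s a, Φ (s * inl W a) = Φ s * inl W a) (h' : ∀ s a, Φ' (s * inl W a) = Φ' s * inl W a)
    (hr : ∀ b, Φ (inr C b) = Φ' (inr C b)) : Φ = Φ' := by
  refine LinearMap.ext fun s => ?_
  induction s using tmul_induction with
  | add s t hs ht => rw [map_add, map_add, hs, ht]
  | tmul a b =>
    induction a using DirectSum.Decomposition.inductionOn fun i : ℕ => ⋀[ℂ]^i C with
    | zero => rw [gzero_tmul, map_zero, map_zero]
    | add a b ha hb => rw [gadd_tmul, map_add, map_add, ha, hb]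
    | @homogeneous i a =>
      have e : (a : ExteriorAlgebra ℂ C) ᵍ⊗ₜ[ℂ] b = inr C (eps^[i] b) * inl W a := by
        rw [inr_apply, tmul_mul_inl_of_mem _ _ a.2, one_mul, ← Function.iterate_add_apply,
          Function.Involutive.iterate_even eps_eps ⟨i, rfl⟩, id]
      rw [e, h, h', hr]

theorem act_inr (θ : ExteriorAlgebra ℂ C) (φ : Module.End ℂ (ExteriorAlgebra ℂ W))
    (b : ExteriorAlgebra ℂ W) : act (θ ⊗ₜ[ℂ] φ) (inr C b) = θ ᵍ⊗ₜ[ℂ] (φ b) := by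
  rw [inr_apply, act_tmul, eps_one, mul_one, ← gtmul_add, evenPart_add_oddPart]

theorem finite_exteriorAlgebra [Module.Finite ℂ W] : Module.Finite ℂ (ExteriorAlgebra ℂ W) :=
  Module.Finite.of_basis (Module.finBasis ℂ W).ExteriorAlgebra

/-- On `⋀W` the operator `act ψ` is the map `⋀W → ⋀C ⊗ ⋀W` which corresponds to `ψ` under
`⋀C ⊗ Hom(⋀W, ⋀W) ≃ Hom(⋀W, ⋀C ⊗ ⋀W)`. This is an isomorphism because `⋀W` is finite
dimensional. -/
theorem act_inr_eq [Module.Finite ℂ W]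
    (ψ : ExteriorAlgebra ℂ C ⊗[ℂ] Module.End ℂ (ExteriorAlgebra ℂ W))
    (b : ExteriorAlgebra ℂ W) :
    haveI := finite_exteriorAlgebra (W := W)
    act ψ (inr C b) = GradedTensorProduct.of ℂ (fun i : ℕ => ⋀[ℂ]^i C) (fun i : ℕ => ⋀[ℂ]^i W)
      (lTensorHomEquivHomLTensor ℂ (ExteriorAlgebra ℂ W) (ExteriorAlgebra ℂ C)
        (ExteriorAlgebra ℂ W) ψ b) := by
  have := finite_exteriorAlgebra (W := W)
  induction ψ with
  | zero => simp only [map_zero, LinearMap.zero_apply]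
  | add ψ ψ' h h' =>
    rw [map_add, LinearMap.add_apply, h, h', map_add, LinearMap.add_apply, map_add]
  | tmul θ φ =>
    rw [act_inr, lTensorHomEquivHomLTensor_apply, TensorProduct.lTensorHomToHomLTensor_apply]

theorem act_injective [Module.Finite ℂ W] : Function.Injective
    (act : ExteriorAlgebra ℂ C ⊗[ℂ] Module.End ℂ (ExteriorAlgebra ℂ W) →ₗ[ℂ] _) := by
  have := finite_exteriorAlgebra (W := W)
  intro ψ ψ' h
  apply (lTensorHomEquivHomLTensor ℂ (ExteriorAlgebra ℂ W) (ExteriorAlgebra ℂ C)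
        (ExteriorAlgebra ℂ W)).injective
  refine LinearMap.ext fun b => ?_
  apply (GradedTensorProduct.of ℂ (fun i : ℕ => ⋀[ℂ]^i C) (fun i : ℕ => ⋀[ℂ]^i W)).injective
  rw [← act_inr_eq, ← act_inr_eq, h]

/-- Every right-linear operator on `⋀C ⊗̂ ⋀W` is the action of an element of `⋀C ⊗̂ End(⋀W)`. -/
theorem exists_act_eq [Module.Finite ℂ W] (Φ : Module.End ℂ (SuperTensor C W))
    (h : ∀ s a, Φ (s * inl W a) = Φ s * inl W a) : ∃ ψ, act ψ = Φ := by
  have := finite_exteriorAlgebra (W := W)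
  let g : ExteriorAlgebra ℂ W →ₗ[ℂ] ExteriorAlgebra ℂ C ⊗[ℂ] ExteriorAlgebra ℂ W :=
    (GradedTensorProduct.of ℂ (fun i : ℕ => ⋀[ℂ]^i C)
      (fun i : ℕ => ⋀[ℂ]^i W)).symm.toLinearMap ∘ₗ Φ ∘ₗ (inr C).toLinearMap
  refine ⟨(lTensorHomEquivHomLTensor ℂ _ _ _).symm g, ext_of_right_linear (act_mul_inl _) h
    fun b => ?_⟩
  rw [act_inr_eq, LinearEquiv.apply_symm_apply]
  rfl

/-- Conjugation of `⋀C ⊗̂ End(⋀W)` by the parity involutions. -/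
def conjParity : ExteriorAlgebra ℂ C ⊗[ℂ] Module.End ℂ (ExteriorAlgebra ℂ W) →ₗ[ℂ]
    ExteriorAlgebra ℂ C ⊗[ℂ] Module.End ℂ (ExteriorAlgebra ℂ W) :=
  TensorProduct.map eps (LinearMap.mulLeft ℂ eps ∘ₗ LinearMap.mulRight ℂ eps)

theorem act_conjParity (ψ : ExteriorAlgebra ℂ C ⊗[ℂ] Module.End ℂ (ExteriorAlgebra ℂ W))
    (s : SuperTensor C W) :
    act (conjParity ψ) s = SuperTensor.parity (act ψ (SuperTensor.parity s)) := by
  induction ψ with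
  | zero => simp only [map_zero, LinearMap.zero_apply]
  | add ψ ψ' h h' => simp only [map_add, LinearMap.add_apply, h, h']
  | tmul θ φ =>
    induction s using tmul_induction with
    | add s t hs ht => simp only [map_add, hs, ht]
    | tmul a b =>
      rw [parity_tmul, act_tmul, map_add, parity_tmul, parity_tmul, eps_mul, eps_mul,
        eps_eps, conjParity, TensorProduct.map_tmul, act_tmul]
      congr 2
      · rw [evenPart_apply, evenPart_apply]
        simp
      · rw [oddPart_apply, oddPart_apply]
        simp

end Action

/-! ### The generalized supertrace in a basis -/

section Supertrace

variable {C : Type*} [AddCommGroup C] [Module ℂ C]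
variable {W : Type*} [AddCommGroup W] [Module ℂ W]
variable {I : Type*} [LinearOrder I] (b : Module.Basis I ℂ W)

theorem basis_mem_exteriorPower (s : Finset I) : b.ExteriorAlgebra s ∈ ⋀[ℂ]^s.card W := by
  rw [ExteriorAlgebra.basis_apply]
  exact ExteriorAlgebra.ιMulti_range ℂ s.card ⟨_, rfl⟩

variable [Fintype I]

theorem supertrace_eq_sum (φ : Module.End ℂ (ExteriorAlgebra ℂ W)) :
    supertrace φ = ∑ s : Finset I, (-1 : ℂ) ^ s.card *
      b.ExteriorAlgebra.coord s (φ (b.ExteriorAlgebra s)) := by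
  rw [supertrace, LinearMap.comp_apply, LinearMap.mulLeft_apply, LinearMap.trace_mul_comm,
    LinearMap.trace_eq_matrix_trace ℂ b.ExteriorAlgebra, Matrix.trace]
  refine Finset.sum_congr rfl fun s _ => ?_
  rw [Matrix.diag_apply, LinearMap.toMatrix_apply, Module.End.mul_apply,
    eps_of_mem (basis_mem_exteriorPower b s), map_smul, map_smul]
  rfl

theorem supertrace_of_odd {φ : Module.End ℂ (ExteriorAlgebra ℂ W)} (h : eps * φ * eps = -φ) :
    supertrace φ = 0 := by
  have h1 : supertrace φ = LinearMap.trace ℂ _ (eps * φ) := rfl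
  have h2 : LinearMap.trace ℂ _ (eps * φ) = -LinearMap.trace ℂ _ (eps * φ) := by
    conv_lhs => rw [← neg_neg φ, ← h, mul_neg, map_neg, ← mul_assoc, ← mul_assoc,
      eps_mul_eps_eq_one, one_mul, LinearMap.trace_mul_comm]
  rw [h1]
  exact self_eq_neg.mp h2

/-- The case of an even `θ ⊗ g` of `act_genSupertrace`, on `a ⊗ β`. The left-hand side is
`θ a` with the sign rule of `act`, the right-hand side is `a θ` with the sign rule of the product;
both are multiplied by `Str (l_β ∘ g)`, which vanishes unless `β` and `θ` have the same parity, and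
in that case the signs agree. -/
theorem act_genSupertrace_tmul {k n : ℕ} {θ : ExteriorAlgebra ℂ C} (hθ : θ ∈ ⋀[ℂ]^k C)
    {g : Module.End ℂ (ExteriorAlgebra ℂ W)} (hg : eps * g * eps = (-1 : ℂ) ^ k • g)
    (a : ExteriorAlgebra ℂ C) {β : ExteriorAlgebra ℂ W} (hβ : β ∈ ⋀[ℂ]^n W) :
    act (dualInclExt (genSupertraceExt (θ ⊗ₜ[ℂ] g))) (a ᵍ⊗ₜ[ℂ] β : SuperTensor C W) =
      inl W (∑ s : Finset I, (-1 : ℂ) ^ s.card • slice (b.ExteriorAlgebra.coord s)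
        ((a ᵍ⊗ₜ[ℂ] β) * act (θ ⊗ₜ[ℂ] g) (inr C (b.ExteriorAlgebra s)))) := by
  set t := supertrace (LinearMap.mul ℂ (ExteriorAlgebra ℂ W) β * g) with ht
  have hR : ∑ s : Finset I, (-1 : ℂ) ^ s.card • slice (b.ExteriorAlgebra.coord s)
        ((a ᵍ⊗ₜ[ℂ] β : SuperTensor C W) * act (θ ⊗ₜ[ℂ] g) (inr C (b.ExteriorAlgebra s))) =
      ((-1 : ℂ) ^ (n * k) * t) • (a * θ) := by
    rw [ht, supertrace_eq_sum b, Finset.mul_sum, Finset.sum_smul]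
    refine Finset.sum_congr rfl fun s _ => ?_
    rw [act_inr, tmul_mul_tmul_of_mem _ hβ hθ, map_smul, slice_tmul, smul_smul, smul_smul]
    congr 1
    rw [Module.End.mul_apply, LinearMap.mul_apply']
    ring
  have hα : ∀ c : ℂ, genSupertrace g (c • β) = c * ((-1) ^ n * t) := fun c => by
    rw [map_smul, smul_eq_mul]
    congr 1
    change supertrace (LinearMap.mul ℂ (ExteriorAlgebra ℂ W) (eps β) * g) = _
    rw [eps_of_mem hβ, map_smul, smul_mul_assoc, map_smul, smul_eq_mul]
  have hα1 := hα 1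
  rw [one_smul, one_mul] at hα1
  have ht0 : (-1 : ℂ) ^ (n + k) = -1 → t = 0 := fun h => by
    refine supertrace_of_odd ?_
    have h1 : eps * LinearMap.mul ℂ (ExteriorAlgebra ℂ W) β =
        (-1 : ℂ) ^ n • (LinearMap.mul ℂ (ExteriorAlgebra ℂ W) β * eps) := by
      ext x
      simp [eps_of_mem hβ]
    rw [← mul_assoc, h1, smul_mul_assoc, smul_mul_assoc, mul_assoc, mul_assoc, ← mul_assoc eps, hg,
      mul_smul_comm, smul_smul, ← pow_add, h, neg_one_smul]
  have hD : ∀ x : ExteriorAlgebra ℂ W, dualIncl (genSupertrace g) x =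
    genSupertrace g x • (1 : ExteriorAlgebra ℂ W) := fun x => rfl
  have hL : act (dualInclExt (genSupertraceExt (θ ⊗ₜ[ℂ] g))) (a ᵍ⊗ₜ[ℂ] β : SuperTensor C W) =
      inl W (((1 / 2 : ℂ) * (1 + (-1) ^ n) * ((-1) ^ n * t)) • (θ * a) +
        ((1 / 2 : ℂ) * (1 - (-1) ^ n) * ((-1) ^ n * t)) • (θ * eps a)) := by
    change act (θ ⊗ₜ[ℂ] dualIncl (genSupertrace g)) _ = _
    rw [act_tmul, evenPart_apply, oddPart_apply, hD, hD, eps_of_mem hβ, hα, hα1, map_smul,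
      eps_one, ← add_smul, ← sub_smul, smul_smul, smul_smul, gtmul_smul, gtmul_smul, map_add,
      map_smul, map_smul, inl_apply, inl_apply]
    congr 2 <;> ring
  rw [hL, hR]
  congr 1
  rcases Nat.even_or_odd n with en | en <;> rcases Nat.even_or_odd k with ek | ek
  · rw [mul_eq_of_mem a hθ, Function.Involutive.iterate_even eps_eps ek, en.neg_one_pow,
      (en.mul_right k).neg_one_pow, id]
    norm_num
  · rw [ht0 (en.add_odd ek).neg_one_pow]
    simp
  · rw [ht0 (en.add_even ek).neg_one_pow]
    simp
  · rw [mul_eq_of_mem a hθ, Function.Involutive.iterate_odd eps_eps ek, en.neg_one_pow,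
      (en.mul ek).neg_one_pow]
    norm_num

/-- For an even `ψ`, the generalized supertrace acts by `s ↦ str(l_s ∘ ψ)`, the supertrace being
computed from the coefficients with respect to a basis of `⋀W`. -/
theorem act_genSupertrace {ψ : ExteriorAlgebra ℂ C ⊗[ℂ] Module.End ℂ (ExteriorAlgebra ℂ W)}
    (hψ : ∀ s, act ψ (SuperTensor.parity s) = SuperTensor.parity (act ψ s))
    (s : SuperTensor C W) :
    act (dualInclExt (genSupertraceExt ψ)) s =
      inl W (∑ J : Finset I, (-1 : ℂ) ^ J.card • slice (b.ExteriorAlgebra.coord J)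
        (s * act ψ (inr C (b.ExteriorAlgebra J)))) := by
  have hfin : Module.Finite ℂ W := Module.Finite.of_basis b
  -- Any even `ψ` is a sum `ψ' + conjParity ψ'`; for `ψ' = θ ⊗ f` this is `θ ⊗ g` with `g` of the
  -- same parity as `θ`.
  have key : ∀ ψ : ExteriorAlgebra ℂ C ⊗[ℂ] Module.End ℂ (ExteriorAlgebra ℂ W),
      act (dualInclExt (genSupertraceExt (ψ + conjParity ψ))) s =
      inl W (∑ J : Finset I, (-1 : ℂ) ^ J.card • slice (b.ExteriorAlgebra.coord J)
        (s * act (ψ + conjParity ψ) (inr C (b.ExteriorAlgebra J)))) := by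
    intro ψ
    induction ψ with
    | zero => simp
    | add ψ ψ' h h' =>
      rw [map_add conjParity, add_add_add_comm]
      simp only [map_add, LinearMap.add_apply, mul_add, smul_add, Finset.sum_add_distrib] at h h' ⊢
      rw [h, h']
    | tmul θ f =>
      induction θ using DirectSum.Decomposition.inductionOn fun i : ℕ => ⋀[ℂ]^i C with
      | zero => simp
      | add θ θ' h h' =>
        rw [TensorProduct.add_tmul, map_add conjParity, add_add_add_comm]
        simp only [map_add, LinearMap.add_apply, mul_add, smul_add,
          Finset.sum_add_distrib] at h h' ⊢
        rw [h, h']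
      | @homogeneous k θ =>
        have hc : (θ : ExteriorAlgebra ℂ C) ⊗ₜ[ℂ] f + conjParity ((θ : ExteriorAlgebra ℂ C) ⊗ₜ f) =
            (θ : ExteriorAlgebra ℂ C) ⊗ₜ[ℂ] (f + (-1 : ℂ) ^ k • (eps * f * eps)) := by
          rw [conjParity, TensorProduct.map_tmul, eps_of_mem θ.2, TensorProduct.smul_tmul,
            ← TensorProduct.tmul_add]
          rfl
        have hg : eps * (f + (-1 : ℂ) ^ k • (eps * f * eps)) * eps =
            (-1 : ℂ) ^ k • (f + (-1 : ℂ) ^ k • (eps * f * eps)) := by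
          have h2 : eps * (eps * f * eps) * eps = f := by
            rw [← mul_assoc, ← mul_assoc, eps_mul_eps_eq_one, one_mul, mul_assoc,
              eps_mul_eps_eq_one, mul_one]
          rw [mul_add, add_mul, mul_smul_comm, smul_mul_assoc, h2, smul_add, smul_smul, ← mul_pow,
            add_comm]
          norm_num
        rw [hc]
        induction s using tmul_induction with
        | add s t hs ht =>
          simp only [map_add, add_mul, smul_add, Finset.sum_add_distrib] at hs ht ⊢
          rw [hs, ht]
        | tmul a β =>
          induction β using DirectSum.Decomposition.inductionOn fun i : ℕ => ⋀[ℂ]^i W with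
          | zero => rw [gtmul_zero]; simp
          | add β β' h h' =>
            rw [gtmul_add]
            simp only [map_add, add_mul, smul_add, Finset.sum_add_distrib] at h h' ⊢
            rw [h, h']
          | homogeneous β => exact act_genSupertrace_tmul b θ.2 hg a β.2
  have hψ' : (1 / 2 : ℂ) • ψ + conjParity ((1 / 2 : ℂ) • ψ) = ψ := by
    have : conjParity ψ = ψ := by
      apply act_injective
      refine LinearMap.ext fun s => ?_
      rw [act_conjParity, hψ, parity_parity]
    rw [map_smul, this, ← two_smul ℂ, smul_smul]
    norm_num
  have := key ((1 / 2 : ℂ) • ψ)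
  rwa [hψ'] at this

end Supertrace

/-! ### The grading by form type and total degree -/

section Weights

variable {C : Type*} [AddCommGroup C] [Module ℂ C]
variable {C' : Type*} [AddCommGroup C'] [Module ℂ C']

/-- The forms of type `(p, q)` defined by a space `P` of covectors of type `(1, 0)` and a space `Q`
of covectors of type `(0, 1)`. -/
def bitype (P Q : Submodule ℂ C) (p q : ℕ) : Submodule ℂ (ExteriorAlgebra ℂ C) :=
  P.map (ExteriorAlgebra.ι ℂ) ^ p * Q.map (ExteriorAlgebra.ι ℂ) ^ q

theorem map_ι_pow_le (P : Submodule ℂ C) (p : ℕ) :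
    P.map (ExteriorAlgebra.ι ℂ) ^ p ≤ ⋀[ℂ]^p C :=
  pow_le_pow_left' LinearMap.map_le_range p

theorem bitype_mul_le (P Q : Submodule ℂ C) (p q p' q' : ℕ) :
    bitype P Q p q * bitype P Q p' q' ≤ bitype P Q (p + p') (q + q') := by
  have h : Q.map (ExteriorAlgebra.ι ℂ) ^ q * P.map (ExteriorAlgebra.ι ℂ) ^ p' ≤
      P.map (ExteriorAlgebra.ι ℂ) ^ p' * Q.map (ExteriorAlgebra.ι ℂ) ^ q := by
    refine Submodule.mul_le.mpr fun x hx y hy => ?_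
    rw [mul_comm_of_mem (map_ι_pow_le _ _ hx) (map_ι_pow_le _ _ hy)]
    exact Submodule.smul_mem _ _ (Submodule.mul_mem_mul hy hx)
  unfold bitype
  calc _ = P.map (ExteriorAlgebra.ι ℂ) ^ p * (Q.map (ExteriorAlgebra.ι ℂ) ^ q *
        P.map (ExteriorAlgebra.ι ℂ) ^ p') * Q.map (ExteriorAlgebra.ι ℂ) ^ q' := by
        simp only [mul_assoc]
    _ ≤ P.map (ExteriorAlgebra.ι ℂ) ^ p * (P.map (ExteriorAlgebra.ι ℂ) ^ p' *
        Q.map (ExteriorAlgebra.ι ℂ) ^ q) * Q.map (ExteriorAlgebra.ι ℂ) ^ q' := by gcongr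
    _ = _ := by rw [pow_add, pow_add]; simp only [mul_assoc]

theorem map_bitype_le {P Q : Submodule ℂ C} {P' Q' : Submodule ℂ C'} {f : C →ₗ[ℂ] C'}
    (hP : P ≤ P'.comap f) (hQ : Q ≤ Q'.comap f) (p q : ℕ) :
    bitype P Q p q ≤ (bitype P' Q' p q).comap (ExteriorAlgebra.map f).toLinearMap := by
  have key : ∀ {R : Submodule ℂ C} {R' : Submodule ℂ C'}, R ≤ R'.comap f →
      (R.map (ExteriorAlgebra.ι ℂ)).map (ExteriorAlgebra.map f).toLinearMap ≤
        R'.map (ExteriorAlgebra.ι ℂ) := by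
    rintro R R' h _ ⟨_, ⟨c, hc, rfl⟩, rfl⟩
    exact ⟨f c, h hc, by simp⟩
  rw [← Submodule.map_le_iff_le_comap, bitype, Submodule.map_mul, Submodule.map_pow,
    Submodule.map_pow]
  exact mul_le_mul' (pow_le_pow_left' (key hP) p) (pow_le_pow_left' (key hQ) q)

variable (W : Type*) [AddCommGroup W] [Module ℂ W]
variable {W' : Type*} [AddCommGroup W'] [Module ℂ W']

/-- The part `⨁_{q - m = i} A^{p,q} ⊗ ⋀ᵐW` of `⋀C ⊗̂ ⋀W`. -/
def weight (P Q : Submodule ℂ C) (p : ℕ) (i : ℤ) : Submodule ℂ (SuperTensor C W) :=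
  ⨆ (q : ℕ) (m : ℕ) (_ : (q : ℤ) - m = i),
    Submodule.span ℂ {t | ∃ a ∈ bitype P Q p q, ∃ b ∈ ⋀[ℂ]^m W, t = a ᵍ⊗ₜ[ℂ] b}

variable {W}

theorem tmul_mem_weight {P Q : Submodule ℂ C} {p q m : ℕ} {i : ℤ} (hi : (q : ℤ) - m = i)
    {a : ExteriorAlgebra ℂ C} (ha : a ∈ bitype P Q p q) {b : ExteriorAlgebra ℂ W}
    (hb : b ∈ ⋀[ℂ]^m W) : a ᵍ⊗ₜ[ℂ] b ∈ weight W P Q p i := by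
  have h : Submodule.span ℂ {t | ∃ a ∈ bitype P Q p q, ∃ b ∈ ⋀[ℂ]^m W, t = a ᵍ⊗ₜ[ℂ] b} ≤
      weight W P Q p i :=
    le_iSup_of_le q (le_iSup_of_le m (le_iSup_of_le hi le_rfl))
  exact h (Submodule.subset_span ⟨a, ha, b, hb, rfl⟩)

theorem weight_le_iff {P Q : Submodule ℂ C} {p : ℕ} {i : ℤ} {N : Submodule ℂ (SuperTensor C W)} :
    weight W P Q p i ≤ N ↔ ∀ (q m : ℕ), (q : ℤ) - m = i → ∀ a ∈ bitype P Q p q,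
      ∀ b ∈ ⋀[ℂ]^m W, a ᵍ⊗ₜ[ℂ] b ∈ N := by
  simp only [weight, iSup_le_iff, Submodule.span_le, Set.subset_def]
  refine forall₃_congr fun q m _ => ⟨fun h a ha b hb => h _ ⟨a, ha, b, hb, rfl⟩, ?_⟩
  rintro h _ ⟨a, ha, b, hb, rfl⟩
  exact h a ha b hb

theorem mul_mem_weight {P Q : Submodule ℂ C} {p p' : ℕ} {i i' : ℤ} {s t : SuperTensor C W}
    (hs : s ∈ weight W P Q p i) (ht : t ∈ weight W P Q p' i') :
    s * t ∈ weight W P Q (p + p') (i + i') := by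
  have h1 : weight W P Q p i ≤ (weight W P Q (p + p') (i + i')).comap
      (LinearMap.mulRight ℂ t) := by
    refine weight_le_iff.mpr fun q m hqm a ha b hb => ?_
    have h2 : weight W P Q p' i' ≤ (weight W P Q (p + p') (i + i')).comap
        (LinearMap.mulLeft ℂ (a ᵍ⊗ₜ[ℂ] b)) := by
      refine weight_le_iff.mpr fun q' m' hqm' a' ha' b' hb' => ?_
      have ha'' : a' ∈ ⋀[ℂ]^(p' + q') C := by
        have := mul_le_mul' (map_ι_pow_le P p') (map_ι_pow_le Q q') ha'
        rwa [ExteriorAlgebra.exteriorPower, ExteriorAlgebra.exteriorPower, ← pow_add] at this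
      rw [Submodule.mem_comap, LinearMap.mulLeft_apply, tmul_mul_tmul_of_mem a hb ha'' b']
      refine Submodule.smul_mem _ _ (tmul_mem_weight (q := q + q') (m := m + m')
        (by push_cast; linarith) (bitype_mul_le _ _ _ _ _ _ (Submodule.mul_mem_mul ha ha')) ?_)
      rw [ExteriorAlgebra.exteriorPower, pow_add]
      exact Submodule.mul_mem_mul hb hb'
    exact h2 ht
  exact h1 hs

theorem map_mem_weight {P Q : Submodule ℂ C} {P' Q' : Submodule ℂ C'} {f : C →ₗ[ℂ] C'}
    (hP : P ≤ P'.comap f) (hQ : Q ≤ Q'.comap f) (g : W →ₗ[ℂ] W') {p : ℕ} {i : ℤ}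
    {s : SuperTensor C W} (hs : s ∈ weight W P Q p i) :
    SuperTensor.map f g s ∈ weight W' P' Q' p i := by
  have h : weight W P Q p i ≤ (weight W' P' Q' p i).comap (SuperTensor.map f g).toLinearMap := by
    refine weight_le_iff.mpr fun q m hqm a ha b hb => ?_
    rw [Submodule.mem_comap, AlgHom.toLinearMap_apply, SuperTensor.map_tmul]
    exact tmul_mem_weight hqm (map_bitype_le hP hQ p q ha) (map_mem_exteriorPower g m hb)
  exact h hs

theorem parity_mem_weight {P Q : Submodule ℂ C} {p : ℕ} {i : ℤ} {s : SuperTensor C W}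
    (hs : s ∈ weight W P Q p i) : SuperTensor.parity s ∈ weight W P Q p i :=
  map_mem_weight (fun _ h => Submodule.neg_mem _ h) (fun _ h => Submodule.neg_mem _ h) _ hs

theorem one_mem_weight (P Q : Submodule ℂ C) : (1 : SuperTensor C W) ∈ weight W P Q 0 0 := by
  refine tmul_mem_weight (q := 0) (m := 0) (by simp) ?_ ?_
  · rw [bitype, pow_zero, pow_zero, one_mul]
    exact Submodule.one_le.mp le_rfl
  · rw [ExteriorAlgebra.exteriorPower, pow_zero]
    exact Submodule.one_le.mp le_rfl

theorem inl_mem_weight {P Q : Submodule ℂ C} {p q : ℕ} {a : ExteriorAlgebra ℂ C}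
    (ha : a ∈ bitype P Q p q) : inl W a ∈ weight W P Q p q := by
  refine tmul_mem_weight (q := q) (m := 0) (by simp) ha ?_
  rw [ExteriorAlgebra.exteriorPower, pow_zero]
  exact Submodule.one_le.mp le_rfl

theorem inr_mem_weight (P Q : Submodule ℂ C) {m : ℕ} {b : ExteriorAlgebra ℂ W}
    (hb : b ∈ ⋀[ℂ]^m W) : inr C b ∈ weight W P Q 0 (-m) := by
  refine tmul_mem_weight (q := 0) (m := m) (by simp) ?_ hb
  rw [bitype, pow_zero, pow_zero, one_mul]
  exact Submodule.one_le.mp le_rfl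

theorem ι_mem_bitype_left {P : Submodule ℂ C} (Q : Submodule ℂ C) {c : C} (hc : c ∈ P) :
    ExteriorAlgebra.ι ℂ c ∈ bitype P Q 1 0 := by
  rw [bitype, pow_one, pow_zero, mul_one]
  exact ⟨c, hc, rfl⟩

theorem ι_mem_bitype_right (P : Submodule ℂ C) {Q : Submodule ℂ C} {c : C} (hc : c ∈ Q) :
    ExteriorAlgebra.ι ℂ c ∈ bitype P Q 0 1 := by
  rw [bitype, pow_one, pow_zero, one_mul]
  exact ⟨c, hc, rfl⟩

/-- A multiplicative family of subspaces which contains the generators in their degrees contains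
all the graded pieces. -/
theorem weight_le_of_generators {P Q : Submodule ℂ C} (K : ℕ → ℤ → Submodule ℂ (SuperTensor C W))
    (h1 : 1 ∈ K 0 0) (hmul : ∀ p i p' i', ∀ s ∈ K p i, ∀ t ∈ K p' i', s * t ∈ K (p + p') (i + i'))
    (hP : ∀ c ∈ P, inl W (ExteriorAlgebra.ι ℂ c) ∈ K 1 0)
    (hQ : ∀ c ∈ Q, inl W (ExteriorAlgebra.ι ℂ c) ∈ K 0 1)
    (hW : ∀ w, inr C (ExteriorAlgebra.ι ℂ w) ∈ K 0 (-1)) (p : ℕ) (i : ℤ) :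
    weight W P Q p i ≤ K p i := by
  have kP : ∀ p : ℕ, P.map (ExteriorAlgebra.ι ℂ) ^ p ≤ (K p 0).comap (inl W).toLinearMap := by
    intro p
    induction p with
    | zero =>
      rw [pow_zero, Submodule.one_le]
      simpa using h1
    | succ p ih =>
      rw [pow_succ, Submodule.mul_le]
      rintro a ha _ ⟨c, hc, rfl⟩
      have := hmul _ _ _ _ _ (ih ha) _ (hP c hc)
      simpa using this
  have kQ : ∀ q : ℕ, Q.map (ExteriorAlgebra.ι ℂ) ^ q ≤ (K 0 q).comap (inl W).toLinearMap := by
    intro q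
    induction q with
    | zero =>
      rw [pow_zero, Submodule.one_le]
      simpa using h1
    | succ q ih =>
      rw [pow_succ, Submodule.mul_le]
      rintro a ha _ ⟨c, hc, rfl⟩
      have := hmul _ _ _ _ _ (ih ha) _ (hQ c hc)
      simpa using this
  have kW : ∀ m : ℕ, ⋀[ℂ]^m W ≤ (K 0 (-m)).comap (inr C).toLinearMap := by
    intro m
    induction m with
    | zero =>
      rw [ExteriorAlgebra.exteriorPower, pow_zero, Submodule.one_le]
      simpa using h1
    | succ m ih =>
      rw [ExteriorAlgebra.exteriorPower, pow_succ, Submodule.mul_le]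
      rintro a ha _ ⟨w, rfl⟩
      have := hmul _ _ _ _ _ (ih ha) _ (hW w)
      rw [Submodule.mem_comap, AlgHom.toLinearMap_apply, map_mul]
      have e : -((m + 1 : ℕ) : ℤ) = -m + -1 := by push_cast; ring
      rw [e]
      simpa using this
  refine weight_le_iff.mpr fun q m hqm a ha b hb => ?_
  have hpq : bitype P Q p q ≤ (K p q).comap (inl W).toLinearMap := by
    refine Submodule.mul_le.mpr fun x hx y hy => ?_
    have := hmul _ _ _ _ _ (kP p hx) _ (kQ q hy)
    simpa using this
  have := hmul _ _ _ _ _ (hpq ha) _ (kW m hb)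
  rw [AlgHom.toLinearMap_apply, AlgHom.toLinearMap_apply, inl_mul_inr] at this
  rwa [← hqm, sub_eq_add_neg]

theorem exteriorAlgebra_coord_eq_zero {I : Type*} [LinearOrder I] (b : Module.Basis I ℂ W)
    (J : Finset I) {m : ℕ} (hm : m ≠ J.card) {β : ExteriorAlgebra ℂ W} (hβ : β ∈ ⋀[ℂ]^m W) :
    b.ExteriorAlgebra.coord J β = 0 := by
  have h : b.ExteriorAlgebra.coord J ∘ₗ (⋀[ℂ]^m W).subtype = 0 := by
    refine (b.exteriorPower m).ext fun s => ?_
    rw [LinearMap.comp_apply, Submodule.subtype_apply, ← ExteriorAlgebra.basis_eq_coe_basis,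
      Module.Basis.coord_apply, Module.Basis.repr_self, Finsupp.single_apply, if_neg]
    · rfl
    · rintro rfl
      exact hm s.2.symm
  exact LinearMap.congr_fun h ⟨β, hβ⟩

theorem slice_mem_of_mem_weight {I : Type*} [LinearOrder I] (b : Module.Basis I ℂ W)
    {P Q : Submodule ℂ C} {p : ℕ} {i : ℤ} (J : Finset I) {s : SuperTensor C W}
    (hs : s ∈ weight W P Q p i) : slice (b.ExteriorAlgebra.coord J) s ∈
      ⨆ (q : ℕ) (_ : (q : ℤ) = i + J.card), bitype P Q p q := by
  have h : weight W P Q p i ≤ (⨆ (q : ℕ) (_ : (q : ℤ) = i + J.card), bitype P Q p q).comap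
      (slice (b.ExteriorAlgebra.coord J)) := by
    refine weight_le_iff.mpr fun q m hqm a ha β hβ => ?_
    rw [Submodule.mem_comap, slice_tmul]
    by_cases hm : m = J.card
    · have hq : (q : ℤ) = i + J.card := by rw [← hm, ← hqm]; ring
      exact Submodule.smul_mem _ _ (Submodule.mem_iSup_of_mem q (Submodule.mem_iSup_of_mem hq ha))
    · rw [exteriorAlgebra_coord_eq_zero b J hm hβ, zero_smul]
      exact Submodule.zero_mem _
  exact h hs

end Weights

/-! ### The operators `∂` and `∂̄` on a vector space -/

section ModelCalculus

variable {V : Type*} [NormedAddCommGroup V] [NormedSpace ℂ V]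

variable (V) in
/-- The `ℂ`-linear covectors of the model space. -/
def model10 : Submodule ℂ (V →ₗ[ℝ] ℂ) where
  carrier := {α | ∀ v, α (Complex.I • v) = Complex.I * α v}
  add_mem' := fun {α β} (hα : ∀ v, _) (hβ : ∀ v, _) v => by simp [hα v, hβ v, mul_add]
  zero_mem' := fun v => by simp
  smul_mem' := fun c α (hα : ∀ v, _) v => by simp [hα v, mul_left_comm]

variable (V) in
/-- The `ℂ`-antilinear covectors of the model space. -/
def model01 : Submodule ℂ (V →ₗ[ℝ] ℂ) where
  carrier := {α | ∀ v, α (Complex.I • v) = -(Complex.I * α v)}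
  add_mem' := fun {α β} (hα : ∀ v, _) (hβ : ∀ v, _) v => by simp [hα v, hβ v, mul_add, add_comm]
  zero_mem' := fun v => by simp
  smul_mem' := fun c α (hα : ∀ v, _) v => by simp [hα v, mul_left_comm]

/-- For `σ = -1` and `σ = 1`, the components of type `(1,0)` and `(0,1)` of a covector:
`v ↦ ½ (α(v) + σ i α(iv))`. -/
def typePart {N : Type*} [AddCommGroup N] [Module ℂ N] (σ : ℂ) (α : N →ₗ[ℝ] ℂ) : N →ₗ[ℝ] ℂ where
  toFun v := 1 / 2 * (α v + σ * Complex.I * α (Complex.I • v))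
  map_add' v w := by rw [smul_add, map_add, map_add]; ring
  map_smul' c v := by
    rw [smul_comm, map_smul, map_smul, RingHom.id_apply, Complex.real_smul, Complex.real_smul,
      Complex.real_smul]
    ring

theorem typePart_apply {N : Type*} [AddCommGroup N] [Module ℂ N] (σ : ℂ) (α : N →ₗ[ℝ] ℂ) (v : N) :
    typePart σ α v = 1 / 2 * (α v + σ * Complex.I * α (Complex.I • v)) := rfl

theorem typePart_I_smul {N : Type*} [AddCommGroup N] [Module ℂ N] {σ : ℂ} (hσ : σ ^ 2 = 1)
    (α : N →ₗ[ℝ] ℂ) (v : N) :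
    typePart σ α (Complex.I • v) = -σ * Complex.I * typePart σ α v := by
  rw [typePart_apply, typePart_apply, smul_smul, Complex.I_mul_I, neg_one_smul, map_neg]
  linear_combination (-1 / 2 * α (Complex.I • v)) * hσ + (-σ ^ 2 * (1 / 2) * α (Complex.I • v)) *
    (-Complex.I_sq)

theorem typePart_mem_model10 (α : V →ₗ[ℝ] ℂ) : typePart (-1) α ∈ model10 V := fun v => by
  rw [typePart_I_smul (by norm_num)]
  ring

theorem typePart_mem_model01 (α : V →ₗ[ℝ] ℂ) : typePart 1 α ∈ model01 V := fun v => by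
  rw [typePart_I_smul (by norm_num)]
  ring

theorem typePart_of_mem_model10 {α : V →ₗ[ℝ] ℂ} (hα : α ∈ model10 V) :
    typePart (-1) α = α ∧ typePart 1 α = 0 := by
  constructor <;> ext v <;> rw [typePart_apply, hα v]
  · linear_combination (-1 / 2 * α v) * Complex.I_sq
  · rw [LinearMap.zero_apply]
    linear_combination (1 / 2 * α v) * Complex.I_sq

theorem typePart_of_mem_model01 {α : V →ₗ[ℝ] ℂ} (hα : α ∈ model01 V) :
    typePart 1 α = α ∧ typePart (-1) α = 0 := by
  constructor <;> ext v <;> rw [typePart_apply, hα v]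
  · linear_combination (-1 / 2 * α v) * Complex.I_sq
  · rw [LinearMap.zero_apply]
    linear_combination (1 / 2 * α v) * Complex.I_sq

theorem typePart_add (α : V →ₗ[ℝ] ℂ) : typePart (-1) α + typePart 1 α = α := by
  ext v
  rw [LinearMap.add_apply, typePart_apply, typePart_apply]
  ring

theorem map_smul_of_mem_model10 {α : V →ₗ[ℝ] ℂ} (hα : α ∈ model10 V) (z : ℂ) (v : V) :
    α (z • v) = z * α v := by
  have h : z • v = z.re • v + z.im • (Complex.I • v) := by
    conv_lhs => rw [← Complex.re_add_im z, add_smul, mul_smul, Complex.coe_smul, Complex.coe_smul]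
  rw [h, map_add, map_smul, map_smul, hα v, Complex.real_smul, Complex.real_smul]
  conv_rhs => rw [← Complex.re_add_im z]
  ring

theorem map_smul_of_mem_model01 {α : V →ₗ[ℝ] ℂ} (hα : α ∈ model01 V) (z : ℂ) (v : V) :
    α (z • v) = (starRingEnd ℂ) z * α v := by
  have h : z • v = z.re • v + z.im • (Complex.I • v) := by
    conv_lhs => rw [← Complex.re_add_im z, add_smul, mul_smul, Complex.coe_smul, Complex.coe_smul]
  rw [h, map_add, map_smul, map_smul, hα v, Complex.real_smul, Complex.real_smul]
  conv_rhs => rw [← Complex.re_add_im z, map_add, map_mul, Complex.conj_I, Complex.conj_ofReal,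
    Complex.conj_ofReal]
  ring

variable [FiniteDimensional ℂ V]

variable (V) in
/-- The covectors `ε k` are the coordinate covectors for the sign `σ`: the component `typePart σ α`
of any covector `α` is the combination of the `ε k` with its values on the basis vectors as
coefficients. This is satisfied by the `dz_k` for `σ = -1`, and by the `dz̄_k` for `σ = 1`. -/
def IsFrame (σ : ℂ) (ε : Fin (Module.finrank ℂ V) → V →ₗ[ℝ] ℂ) : Prop :=
  ∀ α : V →ₗ[ℝ] ℂ, ∑ k, typePart σ α (Module.finBasis ℂ V k) • ε k = typePart σ α

theorem isFrame_dz : IsFrame V (-1) (dz V) := by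
  intro α
  ext v
  have h := map_smul_of_mem_model10 (typePart_mem_model10 α)
  conv_rhs => rw [← (Module.finBasis ℂ V).sum_repr v, map_sum]
  rw [LinearMap.sum_apply]
  refine Finset.sum_congr rfl fun k _ => ?_
  rw [h, LinearMap.smul_apply, smul_eq_mul, mul_comm]
  rfl

theorem isFrame_dzbar : IsFrame V 1 (dzbar V) := by
  intro α
  ext v
  have h := map_smul_of_mem_model01 (typePart_mem_model01 α)
  conv_rhs => rw [← (Module.finBasis ℂ V).sum_repr v, map_sum]
  rw [LinearMap.sum_apply]
  refine Finset.sum_congr rfl fun k _ => ?_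
  rw [h, LinearMap.smul_apply, smul_eq_mul, mul_comm]
  rfl

/-- The common form of `modelDel` (for `σ = -1` and `ε = dz`) and `modelDelbar` (for `σ = 1` and
`ε = dz̄`). -/
def modelD (σ : ℂ) (ε : Fin (Module.finrank ℂ V) → V →ₗ[ℝ] ℂ)
    (g : V → ExteriorAlgebra ℂ (V →ₗ[ℝ] ℂ)) (y : V) : ExteriorAlgebra ℂ (V →ₗ[ℝ] ℂ) :=
  ∑ k, ExteriorAlgebra.ι ℂ (ε k) *
    ((1 / 2 : ℂ) • (dirDeriv g y (Module.finBasis ℂ V k) +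
      (σ * Complex.I) • dirDeriv g y (Complex.I • Module.finBasis ℂ V k)))

theorem modelDel_eq (g : V → ExteriorAlgebra ℂ (V →ₗ[ℝ] ℂ)) :
    modelDel g = modelD (-1) (dz V) g := by
  ext y
  simp only [modelDel, modelD, neg_one_mul, neg_smul, sub_eq_add_neg]

theorem modelDelbar_eq (g : V → ExteriorAlgebra ℂ (V →ₗ[ℝ] ℂ)) :
    modelDelbar g = modelD 1 (dzbar V) g := by
  ext y
  simp only [modelDelbar, modelD, one_mul]

theorem dirDeriv_sum_smul {κ : Type*} (s : Finset κ) {u : κ → V → ℂ} {y : V}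
    (hu : ∀ k ∈ s, DifferentiableAt ℝ (u k) y)
    (t : κ → ExteriorAlgebra ℂ (V →ₗ[ℝ] ℂ)) (v : V) :
    dirDeriv (fun z => ∑ k ∈ s, u k z • t k) y v = ∑ k ∈ s, fderiv ℝ (u k) y v • t k := by
  set B := (Module.finBasis ℂ (V →ₗ[ℝ] ℂ)).ExteriorAlgebra with hB
  have h : ∀ I, fderiv ℝ (fun z => B.coord I (∑ k ∈ s, u k z • t k)) y v =
      ∑ k ∈ s, fderiv ℝ (u k) y v * B.coord I (t k) := by
    intro I
    have h1 : HasFDerivAt (fun z => B.coord I (∑ k ∈ s, u k z • t k))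
        (∑ k ∈ s, (B.coord I (t k)) • fderiv ℝ (u k) y) y := by
      simp only [map_sum, map_smul, smul_eq_mul]
      refine HasFDerivAt.fun_sum fun k hk => ?_
      exact (hu k hk).hasFDerivAt.mul_const' (B.coord I (t k)) |>.congr_fderiv (by
        ext; simp [mul_comm])
    rw [h1.fderiv]
    simp [mul_comm]
  rw [dirDeriv]
  simp only [← hB, h, Finset.sum_smul, mul_smul]
  rw [Finset.sum_comm]
  refine Finset.sum_congr rfl fun k _ => ?_
  rw [← Finset.smul_sum]
  congr 1
  exact B.sum_repr (t k)

theorem modelD_sum_smul {σ : ℂ} (ε : Fin (Module.finrank ℂ V) → V →ₗ[ℝ] ℂ) {κ : Type*}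
    (s : Finset κ) {u : κ → V → ℂ} {y : V} (hu : ∀ k ∈ s, DifferentiableAt ℝ (u k) y)
    (t : κ → ExteriorAlgebra ℂ (V →ₗ[ℝ] ℂ)) :
    modelD σ ε (fun z => ∑ k ∈ s, u k z • t k) y =
      ∑ l, ∑ k ∈ s, typePart σ (fderiv ℝ (u k) y : V →ₗ[ℝ] ℂ) (Module.finBasis ℂ V l) •
        (ExteriorAlgebra.ι ℂ (ε l) * t k) := by
  refine Finset.sum_congr rfl fun l _ => ?_
  rw [dirDeriv_sum_smul s hu, dirDeriv_sum_smul s hu, Finset.smul_sum, ← Finset.sum_add_distrib,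
    Finset.smul_sum, Finset.mul_sum]
  refine Finset.sum_congr rfl fun k _ => ?_
  rw [← mul_smul_comm, smul_smul, ← add_smul, smul_smul]
  rfl

/-- On functions, `∂g` and `∂̄g` are the components of type `(1,0)` and `(0,1)` of `dg`. -/
theorem modelD_algebraMap {σ : ℂ} {ε : Fin (Module.finrank ℂ V) → V →ₗ[ℝ] ℂ}
    (hε : IsFrame V σ ε) {g : V → ℂ} {y : V} (hg : DifferentiableAt ℝ g y) :
    modelD σ ε (fun z => algebraMap ℂ _ (g z)) y =
      ExteriorAlgebra.ι ℂ (typePart σ (fderiv ℝ g y : V →ₗ[ℝ] ℂ)) := by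
  have h := modelD_sum_smul (σ := σ) ε (Finset.univ : Finset Unit) (u := fun _ => g) (y := y)
    (fun _ _ => hg) (fun _ => 1)
  simp only [Finset.univ_unique, Finset.sum_singleton, ← Algebra.algebraMap_eq_smul_one,
    mul_one] at h
  rw [h]
  conv_rhs => rw [← hε, map_sum]
  simp only [map_smul]

/-- The relations `∂² = 0`, `∂̄² = 0` and `∂∂̄ + ∂̄∂ = 0` on functions: they express the symmetry
of the second derivative. -/
theorem modelD_modelD {σ σ' : ℂ} {ε ε' : Fin (Module.finrank ℂ V) → V →ₗ[ℝ] ℂ}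
    (hε : IsFrame V σ ε) (hε' : IsFrame V σ' ε') {g : V → ℂ} {y : V} (hg : AnalyticAt ℝ g y) :
    modelD σ' ε' (fun z => ExteriorAlgebra.ι ℂ (typePart σ (fderiv ℝ g z : V →ₗ[ℝ] ℂ))) y +
      modelD σ ε (fun z => ExteriorAlgebra.ι ℂ (typePart σ' (fderiv ℝ g z : V →ₗ[ℝ] ℂ))) y = 0 := by
  have hsymm : IsSymmSndFDerivAt ℝ g y := (hg.contDiffAt (n := ω)).isSymmSndFDerivAt (by simp)
  have hd : DifferentiableAt ℝ (fderiv ℝ g) y := hg.fderiv.differentiableAt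
  have hD : ∀ (σ : ℂ) (v : V), HasFDerivAt
      (fun z => typePart σ (fderiv ℝ g z : V →ₗ[ℝ] ℂ) v)
      ((1 / 2 : ℂ) • ((fderiv ℝ (fderiv ℝ g) y).flip v + (σ * Complex.I) •
        (fderiv ℝ (fderiv ℝ g) y).flip (Complex.I • v))) y := by
    intro σ v
    have h1 : ∀ v, HasFDerivAt (fun z => fderiv ℝ g z v) ((fderiv ℝ (fderiv ℝ g) y).flip v) y :=
      fun v => by
        have := hd.hasFDerivAt.clm_apply (hasFDerivAt_const v y)
        simpa using this
    exact ((h1 v).add ((h1 (Complex.I • v)).const_smul (σ * Complex.I))).const_smul (1 / 2 : ℂ)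
  have hexp : ∀ {σ : ℂ} {ε : Fin (Module.finrank ℂ V) → V →ₗ[ℝ] ℂ}, IsFrame V σ ε →
      (fun z => ExteriorAlgebra.ι ℂ (typePart σ (fderiv ℝ g z : V →ₗ[ℝ] ℂ))) =
      fun z => ∑ k, typePart σ (fderiv ℝ g z : V →ₗ[ℝ] ℂ) (Module.finBasis ℂ V k) •
        ExteriorAlgebra.ι ℂ (ε k) := by
    intro σ ε hε
    funext z
    conv_lhs => rw [← hε, map_sum]
    simp only [map_smul]
  rw [hexp hε, hexp hε', modelD_sum_smul _ _ (fun k _ => (hD σ _).differentiableAt),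
    modelD_sum_smul _ _ (fun k _ => (hD σ' _).differentiableAt)]
  conv_lhs => enter [2]; rw [Finset.sum_comm]
  rw [← Finset.sum_add_distrib]
  refine Finset.sum_eq_zero fun l _ => ?_
  rw [← Finset.sum_add_distrib]
  refine Finset.sum_eq_zero fun k _ => ?_
  have hc : typePart σ' (fderiv ℝ (fun z => typePart σ (fderiv ℝ g z : V →ₗ[ℝ] ℂ)
        (Module.finBasis ℂ V k)) y : V →ₗ[ℝ] ℂ) (Module.finBasis ℂ V l) =
      typePart σ (fderiv ℝ (fun z => typePart σ' (fderiv ℝ g z : V →ₗ[ℝ] ℂ)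
        (Module.finBasis ℂ V l)) y : V →ₗ[ℝ] ℂ) (Module.finBasis ℂ V k) := by
    rw [(hD σ _).fderiv, (hD σ' _).fderiv, typePart_apply, typePart_apply]
    simp only [ContinuousLinearMap.coe_coe, smul_apply, add_apply,
      ContinuousLinearMap.flip_apply, smul_eq_mul]
    generalize Module.finBasis ℂ V k = v
    generalize Module.finBasis ℂ V l = w
    rw [hsymm.eq w v, hsymm.eq w (Complex.I • v), hsymm.eq (Complex.I • w) v,
      hsymm.eq (Complex.I • w) (Complex.I • v)]
    ring
  rw [hc, ← smul_add, ExteriorAlgebra.ι_add_mul_swap, smul_zero]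

end ModelCalculus

/-! ### Real-analytic families with values in a complex vector space -/

section AnalyticCoord

variable {V : Type*} [NormedAddCommGroup V] [NormedSpace ℂ V]
variable {N : Type*} [AddCommGroup N] [Module ℂ N]

/-- Real-analyticity at `y` of a map to a complex vector space, tested against linear forms. -/
def AnalyticCoord (S : V → N) (y : V) : Prop :=
  ∀ l : N →ₗ[ℂ] ℂ, AnalyticAt ℝ (fun z => l (S z)) y

variable {S T : V → N} {y : V}

theorem AnalyticCoord.congr (hS : AnalyticCoord S y) (h : S =ᶠ[nhds y] T) : AnalyticCoord T y :=
  fun l => (hS l).congr (h.mono fun z hz => by simp only [hz])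

theorem AnalyticCoord.map {N' : Type*} [AddCommGroup N'] [Module ℂ N'] (hS : AnalyticCoord S y)
    (L : N →ₗ[ℂ] N') : AnalyticCoord (fun z => L (S z)) y :=
  fun l => hS (l ∘ₗ L)

theorem analyticCoord_const (t : N) : AnalyticCoord (fun _ : V => t) y :=
  fun _ => analyticAt_const

theorem AnalyticCoord.add (hS : AnalyticCoord S y) (hT : AnalyticCoord T y) :
    AnalyticCoord (fun z => S z + T z) y :=
  fun l => by simpa only [map_add] using (hS l).fun_add (hT l)

theorem AnalyticCoord.comp {φ : V → V} (hS : AnalyticCoord S (φ y)) (hφ : AnalyticAt ℝ φ y) :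
    AnalyticCoord (fun z => S (φ z)) y :=
  fun l => (hS l).comp hφ

/-- A real-analytic family of linear maps sends a real-analytic family of vectors to a real-analytic
family of vectors. -/
theorem AnalyticCoord.apply {N' : Type*} [AddCommGroup N'] [Module ℂ N'] [Module.Finite ℂ N]
    {L : V → N →ₗ[ℂ] N'} (hL : ∀ t, AnalyticCoord (fun z => L z t) y) (hS : AnalyticCoord S y) :
    AnalyticCoord (fun z => L z (S z)) y := by
  intro l
  let b := Module.finBasis ℂ N
  have h : (fun z => l (L z (S z))) = fun z => ∑ i, b.coord i (S z) * l (L z (b i)) := by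
    funext z
    conv_lhs => rw [← b.sum_repr (S z)]
    simp only [map_sum, map_smul, smul_eq_mul, Module.Basis.coord_apply]
  rw [h]
  exact Finset.analyticAt_fun_sum _ fun i _ => (hS _).fun_mul (hL _ l)

theorem AnalyticCoord.superTensor_map {C W C' W' : Type*} [AddCommGroup C] [Module ℂ C]
    [AddCommGroup W] [Module ℂ W] [AddCommGroup C'] [Module ℂ C'] [Module.Finite ℂ C']
    [AddCommGroup W'] [Module ℂ W'] [Module.Finite ℂ W'] [FiniteDimensional ℂ V]
    {f : V → C →ₗ[ℂ] C'} {g : V → W →ₗ[ℂ] W'} (hf : ∀ c, AnalyticCoord (fun z => f z c) y)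
    (hg : ∀ w, AnalyticCoord (fun z => g z w) y) (t : SuperTensor C W) :
    AnalyticCoord (fun z => SuperTensor.map (f z) (g z) t) y := by
  induction t using superTensor_induction with
  | algebraMap z => simpa only [AlgHom.commutes] using analyticCoord_const _
  | inl_ι c =>
    have h : (fun z => SuperTensor.map (f z) (g z) (inl W (ExteriorAlgebra.ι ℂ c))) =
        fun z => (inl W').toLinearMap (ExteriorAlgebra.ι ℂ (f z c)) := by
      funext z
      rw [inl_apply, SuperTensor.map_tmul, ExteriorAlgebra.map_apply_ι, map_one]
      rfl
    rw [h]
    exact ((hf c).map (ExteriorAlgebra.ι ℂ)).map _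
  | inr_ι w =>
    have h : (fun z => SuperTensor.map (f z) (g z) (inr C (ExteriorAlgebra.ι ℂ w))) =
        fun z => (inr C').toLinearMap (ExteriorAlgebra.ι ℂ (g z w)) := by
      funext z
      rw [inr_apply, SuperTensor.map_tmul, ExteriorAlgebra.map_apply_ι, map_one]
      rfl
    rw [h]
    exact ((hg w).map (ExteriorAlgebra.ι ℂ)).map _
  | add s t hs ht => simpa only [map_add] using hs.add ht
  | mul s t hs ht =>
    intro l
    simpa only [map_mul] using analyticAt_mul hs ht l

end AnalyticCoord

/-! ### Local coordinates of sections -/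

section LocalCoordinates

set_option linter.unusedSectionVars false

variable {V : Type*} [NormedAddCommGroup V] [NormedSpace ℂ V] [FiniteDimensional ℂ V]
variable {X : Type*} [TopologicalSpace X] [ChartedSpace V X] [IsManifold 𝓘(ℂ, V) ω X]

theorem cotangentToModel_modelToCotangent {x₀ x : X} (hx : x ∈ (chartAt V x₀).source)
    (α : V →ₗ[ℝ] ℂ) : cotangentToModel V x₀ x (modelToCotangent V x₀ x α) = α := by
  ext v
  have h := (trivializationAt V (TangentSpace 𝓘(ℂ, V)) x₀).continuousLinearMapAt_symmL
    (R := ℂ) (b := x) hx v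
  exact congrArg α h

theorem modelToCotangent_cotangentToModel {x₀ x : X} (hx : x ∈ (chartAt V x₀).source)
    (α : Cotangent V x) : modelToCotangent V x₀ x (cotangentToModel V x₀ x α) = α := by
  ext v
  have h := (trivializationAt V (TangentSpace 𝓘(ℂ, V)) x₀).symmL_continuousLinearMapAt
    (R := ℂ) (b := x) hx v
  exact congrArg α h

theorem eventually_symm_mem {x₁ x : X} (hx : x ∈ (chartAt V x₁).source) {U : Opens X}
    (hU : x ∈ U) : ∀ᶠ y in nhds (chartAt V x₁ x), (chartAt V x₁).symm y ∈ U := by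
  have h := (chartAt V x₁).continuousAt_symm ((chartAt V x₁).map_source hx)
  rw [ContinuousAt, (chartAt V x₁).left_inv hx] at h
  exact h.eventually (U.isOpen.mem_nhds hU)

theorem analyticAt_chart_comp_symm {x₀ x₁ x : X} (h₀ : x ∈ (chartAt V x₀).source)
    (h₁ : x ∈ (chartAt V x₁).source) :
    AnalyticAt ℂ (chartAt V x₀ ∘ (chartAt V x₁).symm) (chartAt V x₁ x) := by
  have h := contDiffWithinAt_ext_coord_change (I := 𝓘(ℂ, V)) (n := ω) x₀ x₁
    (y := chartAt V x₁ x) (by simp [h₀, h₁])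
  rw [modelWithCornersSelf_coe, Set.range_id, contDiffWithinAt_univ] at h
  simpa using h.analyticAt

variable (F : Type*) [NormedAddCommGroup F] [NormedSpace ℂ F] [FiniteDimensional ℂ F]
variable (E : X → Type*) [∀ x, AddCommGroup (E x)] [∀ x, Module ℂ (E x)]
variable [∀ x, TopologicalSpace (E x)] [TopologicalSpace (TotalSpace F E)]
variable [FiberBundle F E] [VectorBundle ℂ F E]

/-- The domain on which both the chart and the trivialization centred at `x₀` are defined. -/
def coordDomain (x₀ : X) : Opens X :=
  ⟨(chartAt V x₀).source ∩ (trivializationAt F E x₀).baseSet,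
    (chartAt V x₀).open_source.inter (trivializationAt F E x₀).open_baseSet⟩

theorem mem_coordDomain (x₀ : X) : x₀ ∈ coordDomain (V := V) F E x₀ :=
  ⟨mem_chart_source V x₀, FiberBundle.mem_baseSet_trivializationAt' x₀⟩

/-- The inverse of `fibreCoord`. -/
def fibreInv (x₀ x : X) : SuperTensor (V →ₗ[ℝ] ℂ) F →ₐ[ℂ] Fibre V E x :=
  SuperTensor.map (modelToCotangent V x₀ x)
    ((trivializationAt F E x₀).symmL ℂ x).toLinearMap

theorem superTensor_map_id {C W : Type*} [AddCommGroup C] [Module ℂ C] [AddCommGroup W]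
    [Module ℂ W] (t : SuperTensor C W) :
    SuperTensor.map LinearMap.id LinearMap.id t = t := by
  induction t using tmul_induction with
  | tmul a b => rw [SuperTensor.map_tmul, ExteriorAlgebra.map_id, ExteriorAlgebra.map_id]; rfl
  | add s t hs ht => rw [map_add, hs, ht]

theorem fibreCoord_fibreInv {x₀ x : X} (hx : x ∈ coordDomain (V := V) F E x₀)
    (t : SuperTensor (V →ₗ[ℝ] ℂ) F) : fibreCoord F E x₀ x (fibreInv F E x₀ x t) = t := by
  rw [fibreCoord, fibreInv, SuperTensor.map_map]
  conv_rhs => rw [← superTensor_map_id t]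
  congr 2
  · ext1 α
    exact cotangentToModel_modelToCotangent hx.1 α
  · ext1 w
    exact (trivializationAt F E x₀).continuousLinearMapAt_symmL hx.2 w

theorem fibreInv_fibreCoord {x₀ x : X} (hx : x ∈ coordDomain (V := V) F E x₀)
    (t : Fibre V E x) : fibreInv F E x₀ x (fibreCoord F E x₀ x t) = t := by
  rw [fibreCoord, fibreInv, SuperTensor.map_map]
  conv_rhs => rw [← superTensor_map_id t]
  congr 2
  · ext1 α
    exact modelToCotangent_cotangentToModel hx.1 α
  · ext1 w
    exact (trivializationAt F E x₀).symmL_continuousLinearMapAt hx.2 w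

variable {F E}

theorem sectionCoord_chart {U : Opens X} (s : ∀ x : U, Fibre V E (x : X)) {x₀ : X} (x : U)
    (hx : (x : X) ∈ (chartAt V x₀).source) :
    sectionCoord F s x₀ (chartAt V x₀ x) = fibreCoord F E x₀ x (s x) := by
  have h : (chartAt V x₀).symm (chartAt V x₀ (x : X)) = x := (chartAt V x₀).left_inv hx
  have h' : (chartAt V x₀).symm (chartAt V x₀ (x : X)) ∈ U := by rw [h]; exact x.2
  have key : ∀ (z : X) (_ : z = x) (hz : z ∈ U),
      fibreCoord F E x₀ z (s ⟨z, hz⟩) = fibreCoord F E x₀ x (s x) := by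
    rintro _ rfl _
    rfl
  rw [sectionCoord, dif_pos h', key _ h h']

variable [ContMDiffVectorBundle ω F E 𝓘(ℂ, V)]

theorem analyticAt_coordChange {E' : X → Type*} {F' : Type*} [NormedAddCommGroup F']
    [NormedSpace ℂ F'] [∀ x, AddCommGroup (E' x)] [∀ x, Module ℂ (E' x)]
    [∀ x, TopologicalSpace (E' x)] [TopologicalSpace (TotalSpace F' E')]
    [FiberBundle F' E'] [VectorBundle ℂ F' E'] [ContMDiffVectorBundle ω F' E' 𝓘(ℂ, V)]
    (e e' : Trivialization F' (TotalSpace.proj : TotalSpace F' E' → X))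
    [MemTrivializationAtlas e] [MemTrivializationAtlas e'] {x₁ x : X}
    (hx : x ∈ (chartAt V x₁).source) (he : x ∈ e.baseSet) (he' : x ∈ e'.baseSet) :
    AnalyticAt ℝ (fun y => e'.continuousLinearMapAt ℂ ((chartAt V x₁).symm y) ∘L
      e.symmL ℂ ((chartAt V x₁).symm y)) (chartAt V x₁ x) := by
  have h1 : ContMDiffAt 𝓘(ℂ, V) 𝓘(ℂ, F' →L[ℂ] F') ω
      (fun b => (e.coordChangeL ℂ e' b : F' →L[ℂ] F')) ((chartAt V x₁).symm (chartAt V x₁ x)) := by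
    rw [(chartAt V x₁).left_inv hx]
    exact contMDiffAt_coordChangeL he he'
  have h2 : ContMDiffAt 𝓘(ℂ, V) 𝓘(ℂ, V) ω (chartAt V x₁).symm (chartAt V x₁ x) :=
    (contMDiffOn_chart_symm (I := 𝓘(ℂ, V)) (n := ω) (x := x₁)).contMDiffAt
      ((chartAt V x₁).open_target.mem_nhds ((chartAt V x₁).map_source hx))
  have h3 := (contMDiffAt_iff_contDiffAt.mp (h1.comp _ h2)).analyticAt.restrictScalars (𝕜 := ℝ)
  refine h3.congr ?_
  have h4 := eventually_symm_mem hx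
    (U := ⟨e.baseSet ∩ e'.baseSet, e.open_baseSet.inter e'.open_baseSet⟩) ⟨he, he'⟩
  filter_upwards [h4] with y hy
  ext w
  simp only [Function.comp_apply, ContinuousLinearEquiv.coe_coe, ContinuousLinearMap.comp_apply]
  rw [Trivialization.coordChangeL_apply _ _ hy, Trivialization.continuousLinearMapAt_apply,
    Trivialization.linearMapAt_apply, if_pos hy.2, Trivialization.symmL_apply _ hy.1]

/-- Real-analyticity of a section does not depend on the chart and the trivialization. -/
theorem analyticCoord_change {U : Opens X} (s : ∀ x : U, Fibre V E (x : X)) {x₀ x₁ x : X}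
    (hU : x ∈ U) (h₀ : x ∈ coordDomain (V := V) F E x₀) (h₁ : x ∈ coordDomain (V := V) F E x₁)
    (hs : AnalyticCoord (sectionCoord F s x₀) (chartAt V x₀ x)) :
    AnalyticCoord (sectionCoord F s x₁) (chartAt V x₁ x) := by
  set φ := chartAt V x₀ ∘ (chartAt V x₁).symm with hφ
  have hφx : φ (chartAt V x₁ x) = chartAt V x₀ x := by
    rw [hφ, Function.comp_apply, (chartAt V x₁).left_inv h₁.1]
  have hφa : AnalyticAt ℝ φ (chartAt V x₁ x) :=
    (analyticAt_chart_comp_symm h₀.1 h₁.1).restrictScalars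
  rw [← hφx] at hs
  -- The coordinates centred at `x₁` are obtained from those centred at `x₀` by the change of charts
  -- `φ` and the transition map of `⋀T*X ⊗̂ ⋀E`, which depends analytically on the point.
  have hT : ∀ t, AnalyticCoord (fun y => SuperTensor.map
      (cotangentToModel V x₁ ((chartAt V x₁).symm y) ∘ₗ
        modelToCotangent V x₀ ((chartAt V x₁).symm y))
      (((trivializationAt F E x₁).continuousLinearMapAt ℂ ((chartAt V x₁).symm y)).toLinearMap ∘ₗ
        ((trivializationAt F E x₀).symmL ℂ ((chartAt V x₁).symm y)).toLinearMap) t)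
      (chartAt V x₁ x) := by
    refine AnalyticCoord.superTensor_map (fun c l => ?_) (fun w l => ?_)
    · have h := analyticAt_coordChange (E' := (TangentSpace 𝓘(ℂ, V) : X → Type _))
        (trivializationAt V (TangentSpace 𝓘(ℂ, V)) x₁)
        (trivializationAt V (TangentSpace 𝓘(ℂ, V)) x₀) h₁.1 h₁.1 h₀.1
      let L : (V →L[ℂ] V) →ₗ[ℝ] ℂ :=
        { toFun := fun A => l (c ∘ₗ (A.toLinearMap.restrictScalars ℝ))
          map_add' := fun A B => by
            rw [← map_add]
            congr 1
            ext v
            exact map_add c _ _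
          map_smul' := fun r A => by
            rw [RingHom.id_apply, Complex.real_smul, ← smul_eq_mul, ← map_smul]
            congr 1
            ext v
            exact (map_smul c r _).trans (Complex.real_smul) }
      exact (L.toContinuousLinearMap.analyticAt _).comp h
    · have h := analyticAt_coordChange (trivializationAt F E x₀) (trivializationAt F E x₁)
        h₁.1 h₀.2 h₁.2
      let L : (F →L[ℂ] F) →L[ℂ] ℂ := l.toContinuousLinearMap ∘L (ContinuousLinearMap.apply ℂ F w)
      exact ((L.restrictScalars ℝ).analyticAt _).comp h
  refine (AnalyticCoord.apply (L := fun y => (SuperTensor.map _ _).toLinearMap) hT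
    (hs.comp hφa)).congr ?_
  filter_upwards [eventually_symm_mem h₁.1 hU, eventually_symm_mem h₁.1 h₀] with y hyU hy
  rw [hφ, Function.comp_apply, sectionCoord_chart s ⟨_, hyU⟩ hy.1, sectionCoord, dif_pos hyU]
  rw [AlgHom.toLinearMap_apply, ← SuperTensor.map_map]
  exact congrArg _ (fibreInv_fibreCoord F E hy _)

end LocalCoordinates

/-! ### Local frames and local expansions -/

section LocalFrames

set_option linter.unusedSectionVars false

variable {V : Type*} [NormedAddCommGroup V] [NormedSpace ℂ V] [FiniteDimensional ℂ V]
variable {X : Type*} [TopologicalSpace X] [ChartedSpace V X] [IsManifold 𝓘(ℂ, V) ω X]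
variable {F : Type*} [NormedAddCommGroup F] [NormedSpace ℂ F] [FiniteDimensional ℂ F]
variable {E : X → Type*} [∀ x, AddCommGroup (E x)] [∀ x, Module ℂ (E x)]
variable [∀ x, TopologicalSpace (E x)] [TopologicalSpace (TotalSpace F E)]
variable [FiberBundle F E] [VectorBundle ℂ F E] [ContMDiffVectorBundle ω F E 𝓘(ℂ, V)]

/-- Over a coordinate domain, a section is real-analytic if and only if its coordinates are. -/
theorem isAnalyticSection_iff {U : Opens X} {x₀ : X} (hU : U ≤ coordDomain (V := V) F E x₀)
    (s : ∀ x : U, Fibre V E (x : X)) : IsAnalyticSection F s ↔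
      ∀ x : U, AnalyticCoord (sectionCoord F s x₀) (chartAt V x₀ (x : X)) :=
  ⟨fun h x => analyticCoord_change s x.2 (mem_coordDomain F E _) (hU x.2) (h x),
    fun h x => analyticCoord_change s x.2 (hU x.2) (mem_coordDomain F E _) (h x)⟩

section OfCoord

variable {U : Opens X} {x₀ : X} (hU : U ≤ coordDomain (V := V) F E x₀)

/-- The section over `U` with given real-analytic coordinates. -/
def ofCoord (S : V → SuperTensor (V →ₗ[ℝ] ℂ) F)
    (hS : ∀ x : U, AnalyticCoord S (chartAt V x₀ (x : X))) : analyticSections V F E U :=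
  ⟨fun x => fibreInv F E x₀ x (S (chartAt V x₀ (x : X))), by
    refine (isAnalyticSection_iff hU _).mpr fun x => (hS x).congr ?_
    filter_upwards [eventually_symm_mem (hU x.2).1 x.2, (chartAt V x₀).open_target.mem_nhds
      ((chartAt V x₀).map_source (hU x.2).1)] with y hy hy'
    rw [sectionCoord, dif_pos hy, fibreCoord_fibreInv F E (hU hy), (chartAt V x₀).right_inv hy']⟩

theorem ofCoord_apply (S : V → SuperTensor (V →ₗ[ℝ] ℂ) F)
    (hS : ∀ x : U, AnalyticCoord S (chartAt V x₀ (x : X))) (x : U) :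
    (ofCoord hU S hS).1 x = fibreInv F E x₀ x (S (chartAt V x₀ (x : X))) := rfl

/-- The sections over `U` with constant coordinates. -/
def constSec : SuperTensor (V →ₗ[ℝ] ℂ) F →ₐ[ℂ] analyticSections V F E U where
  toFun t := ofCoord hU (fun _ => t) fun _ => analyticCoord_const t
  map_one' := Subtype.ext (funext fun x => map_one (fibreInv F E x₀ x))
  map_mul' s t := Subtype.ext (funext fun x => map_mul (fibreInv F E x₀ x) s t)
  map_zero' := Subtype.ext (funext fun x => map_zero (fibreInv F E x₀ x))
  map_add' s t := Subtype.ext (funext fun x => map_add (fibreInv F E x₀ x) s t)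
  commutes' z := Subtype.ext (funext fun x => AlgHom.commutes (fibreInv F E x₀ x) z)

theorem constSec_apply (t : SuperTensor (V →ₗ[ℝ] ℂ) F) (x : U) :
    (constSec hU t).1 x = fibreInv F E x₀ x t := rfl

/-- The operator on sections over `U` which is given in coordinates by a constant linear map. -/
def constOp (L : Module.End ℂ (SuperTensor (V →ₗ[ℝ] ℂ) F)) :
    Module.End ℂ (analyticSections V F E U) where
  toFun s := ofCoord hU (fun y => L (sectionCoord F s.1 x₀ y)) fun x =>
    ((isAnalyticSection_iff hU s.1).mp s.2 x).map L
  map_add' s t := by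
    ext x
    simp [ofCoord_apply, sectionCoord_chart _ x (hU x.2).1]
  map_smul' c s := by
    ext x
    simp [ofCoord_apply, sectionCoord_chart _ x (hU x.2).1]

theorem constOp_apply (L : Module.End ℂ (SuperTensor (V →ₗ[ℝ] ℂ) F))
    (s : analyticSections V F E U) (x : U) :
    (constOp hU L s).1 x = fibreInv F E x₀ x (L (fibreCoord F E x₀ x (s.1 x))) := by
  rw [← sectionCoord_chart s.1 x (hU x.2).1]
  rfl

theorem constOp_one (s : analyticSections V F E U) : constOp hU 1 s = s := by
  ext x
  rw [constOp_apply, Module.End.one_apply, fibreInv_fibreCoord F E (hU x.2)]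

/-- The function on `U` obtained by applying a linear form to the coordinates of a section, as a
section of degree `0`. -/
def coeff (l : SuperTensor (V →ₗ[ℝ] ℂ) F →ₗ[ℂ] ℂ) (s : analyticSections V F E U) :
    analyticSections V F E U :=
  constOp hU (Algebra.linearMap ℂ _ ∘ₗ l) s

theorem coeff_apply (l : SuperTensor (V →ₗ[ℝ] ℂ) F →ₗ[ℂ] ℂ) (s : analyticSections V F E U)
    (x : U) : (coeff hU l s).1 x = algebraMap ℂ _ (l (fibreCoord F E x₀ x (s.1 x))) := by
  rw [coeff, constOp_apply, LinearMap.comp_apply, Algebra.linearMap_apply, AlgHom.commutes]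

/-- Expansion of a section in a frame with constant coordinates. -/
theorem constOp_eq_sum {κ : Type*} [Fintype κ]
    (b : Module.Basis κ ℂ (SuperTensor (V →ₗ[ℝ] ℂ) F))
    (L : Module.End ℂ (SuperTensor (V →ₗ[ℝ] ℂ) F)) (s : analyticSections V F E U) :
    constOp hU L s = ∑ k, coeff hU (b.coord k) s * constSec hU (L (b k)) := by
  ext x
  have h : (∑ k, coeff hU (b.coord k) s * constSec hU (L (b k)) :
      analyticSections V F E U).1 x =
      ∑ k, (coeff hU (b.coord k) s).1 x * (constSec hU (L (b k))).1 x := by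
    simp [Finset.sum_apply]
  rw [h, constOp_apply]
  conv_lhs => rw [← b.sum_repr (fibreCoord F E x₀ x (s.1 x))]
  rw [map_sum, map_sum]
  refine Finset.sum_congr rfl fun k _ => ?_
  rw [coeff_apply, constSec_apply, ← Algebra.smul_def, map_smul, map_smul]
  rfl

theorem eq_sum_coeff {κ : Type*} [Fintype κ]
    (b : Module.Basis κ ℂ (SuperTensor (V →ₗ[ℝ] ℂ) F)) (s : analyticSections V F E U) :
    s = ∑ k, coeff hU (b.coord k) s * constSec hU (b k) := by
  conv_lhs => rw [← constOp_one hU s, constOp_eq_sum hU b]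
  rfl

end OfCoord

/-! ### Types and degrees in coordinates -/

theorem modelToCotangent_mem_cotangent10 {x₀ x : X} {α : V →ₗ[ℝ] ℂ} (hα : α ∈ model10 V) :
    modelToCotangent V x₀ x α ∈ cotangent10 V x := by
  intro v
  refine Eq.trans ?_ (hα _)
  exact congrArg α
    (((trivializationAt V (TangentSpace 𝓘(ℂ, V)) x₀).continuousLinearMapAt ℂ x).map_smul
      Complex.I v)

theorem modelToCotangent_mem_cotangent01 {x₀ x : X} {α : V →ₗ[ℝ] ℂ} (hα : α ∈ model01 V) :
    modelToCotangent V x₀ x α ∈ cotangent01 V x := by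
  intro v
  refine Eq.trans ?_ (hα _)
  exact congrArg α
    (((trivializationAt V (TangentSpace 𝓘(ℂ, V)) x₀).continuousLinearMapAt ℂ x).map_smul
      Complex.I v)

theorem cotangentToModel_mem_model10 {x₀ x : X} {α : Cotangent V x} (hα : α ∈ cotangent10 V x) :
    cotangentToModel V x₀ x α ∈ model10 V := by
  intro v
  refine Eq.trans ?_ (hα _)
  exact congrArg α
    (((trivializationAt V (TangentSpace 𝓘(ℂ, V)) x₀).symmL ℂ x).map_smul Complex.I v)

theorem cotangentToModel_mem_model01 {x₀ x : X} {α : Cotangent V x} (hα : α ∈ cotangent01 V x) :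
    cotangentToModel V x₀ x α ∈ model01 V := by
  intro v
  refine Eq.trans ?_ (hα _)
  exact congrArg α
    (((trivializationAt V (TangentSpace 𝓘(ℂ, V)) x₀).symmL ℂ x).map_smul Complex.I v)

theorem fibreInv_mem_weight {x₀ x : X} {p : ℕ} {i : ℤ} {t : SuperTensor (V →ₗ[ℝ] ℂ) F}
    (ht : t ∈ weight F (model10 V) (model01 V) p i) :
    fibreInv F E x₀ x t ∈ weight (E x) (cotangent10 V x) (cotangent01 V x) p i :=
  map_mem_weight (f := modelToCotangent V x₀ x) (P := model10 V) (Q := model01 V)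
    (P' := cotangent10 V x) (Q' := cotangent01 V x)
    (fun _ h => modelToCotangent_mem_cotangent10 h)
    (fun _ h => modelToCotangent_mem_cotangent01 h) _ ht

theorem fibreCoord_mem_weight {x₀ x : X} {p : ℕ} {i : ℤ} {t : Fibre V E x}
    (ht : t ∈ weight (E x) (cotangent10 V x) (cotangent01 V x) p i) :
    fibreCoord F E x₀ x t ∈ weight F (model10 V) (model01 V) p i :=
  map_mem_weight (f := cotangentToModel V x₀ x) (P := cotangent10 V x) (Q := cotangent01 V x)
    (P' := model10 V) (Q' := model01 V)
    (fun _ h => cotangentToModel_mem_model10 h)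
    (fun _ h => cotangentToModel_mem_model01 h) _ ht

/-- The section `s` belongs to `⨁_{q - m = i} 𝒜^{p,q} ⊗ ⋀ᵐℰ`. -/
def HasWeight {U : Opens X} (s : analyticSections V F E U) (p : ℕ) (i : ℤ) : Prop :=
  ∀ x : U, s.1 x ∈ weight (E x) (cotangent10 V (x : X)) (cotangent01 V (x : X)) p i

theorem HasWeight.mul {U : Opens X} {s t : analyticSections V F E U} {p p' : ℕ} {i i' : ℤ}
    (hs : HasWeight s p i) (ht : HasWeight t p' i') : HasWeight (s * t) (p + p') (i + i') :=
  fun x => mul_mem_weight (hs x) (ht x)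

theorem HasWeight.add {U : Opens X} {s t : analyticSections V F E U} {p : ℕ} {i : ℤ}
    (hs : HasWeight s p i) (ht : HasWeight t p i) : HasWeight (s + t) p i :=
  fun x => Submodule.add_mem _ (hs x) (ht x)

theorem HasWeight.smul {U : Opens X} {s : analyticSections V F E U} {p : ℕ} {i : ℤ} (c : ℂ)
    (hs : HasWeight s p i) : HasWeight (c • s) p i :=
  fun x => Submodule.smul_mem _ c (hs x)

theorem hasWeight_zero {U : Opens X} (p : ℕ) (i : ℤ) :
    HasWeight (0 : analyticSections V F E U) p i :=
  fun _ => Submodule.zero_mem _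

theorem hasWeight_sum {U : Opens X} {κ : Type*} (K : Finset κ)
    {s : κ → analyticSections V F E U} {p : ℕ} {i : ℤ} (hs : ∀ k ∈ K, HasWeight (s k) p i) :
    HasWeight (∑ k ∈ K, s k) p i := by
  classical
  induction K using Finset.induction_on with
  | empty => exact hasWeight_zero p i
  | insert a K ha ih =>
    rw [Finset.sum_insert ha]
    exact (hs a (Finset.mem_insert_self a K)).add
      (ih fun k hk => hs k (Finset.mem_insert_of_mem hk))

theorem HasWeight.parity {U : Opens X} {s : analyticSections V F E U} {p : ℕ} {i : ℤ}
    (hs : HasWeight s p i) : HasWeight (parityOp V F E U s) p i :=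
  fun x => parity_mem_weight (hs x)

theorem HasType.hasWeight {U : Opens X} {s : analyticSections V F E U} {p q m : ℕ} {i : ℤ}
    (hs : HasType s p q m) (hi : (q : ℤ) - m = i) : HasWeight s p i := by
  intro x
  have h : fibrePart V E (x : X) p q m ≤
      weight (E x) (cotangent10 V (x : X)) (cotangent01 V (x : X)) p i :=
    le_iSup_of_le q (le_iSup_of_le m (le_iSup_of_le hi le_rfl))
  exact h (hs x)

theorem constSec_hasWeight {U : Opens X} {x₀ : X} (hU : U ≤ coordDomain (V := V) F E x₀)
    {p : ℕ} {i : ℤ} {t : SuperTensor (V →ₗ[ℝ] ℂ) F}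
    (ht : t ∈ weight F (model10 V) (model01 V) p i) :
    HasWeight (constSec hU t) p i :=
  fun _ => fibreInv_mem_weight ht

/-- A section of given degrees is a combination, with functions as coefficients, of constant
sections of the same degrees. -/
theorem HasWeight.exists_eq_sum {U : Opens X} {x₀ : X} (hU : U ≤ coordDomain (V := V) F E x₀)
    {s : analyticSections V F E U} {p : ℕ} {i : ℤ} (hs : HasWeight s p i)
    {κ : Type*} [Fintype κ] (b : Module.Basis κ ℂ (SuperTensor (V →ₗ[ℝ] ℂ) F)) :
    ∃ t : κ → SuperTensor (V →ₗ[ℝ] ℂ) F,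
      (∀ k, t k ∈ weight F (model10 V) (model01 V) p i) ∧
        s = ∑ k, coeff hU (b.coord k) s * constSec hU (t k) := by
  -- A projection onto the space of the given degrees, applied in coordinates, fixes `s`.
  obtain ⟨pr, hpr⟩ := (weight F (model10 V) (model01 V) p i).exists_isCompl
  have hs' : constOp hU ((weight F (model10 V) (model01 V) p i).subtype ∘ₗ
      (weight F (model10 V) (model01 V) p i).projectionOnto pr hpr) s = s := by
    ext x
    have h := Submodule.projectionOnto_apply_left hpr
      ⟨_, fibreCoord_mem_weight (F := F) (x₀ := x₀) (hs x)⟩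
    simp only at h
    rw [constOp_apply, LinearMap.comp_apply, h]
    exact fibreInv_fibreCoord F E (hU x.2) _
  refine ⟨fun k => _, fun k => ?_, by
    conv_lhs => rw [← hs', constOp_eq_sum hU b]⟩
  exact Subtype.property _

end LocalFrames

/-! ### The operators `∂` and `∂̄` on functions -/

section Functions

set_option linter.unusedSectionVars false

variable {V : Type*} [NormedAddCommGroup V] [NormedSpace ℂ V] [FiniteDimensional ℂ V]
variable {X : Type*} [TopologicalSpace X] [ChartedSpace V X] [IsManifold 𝓘(ℂ, V) ω X]

/-- The common form of `del` (for `σ = -1` and `ε = dz`) and `delbar` (for `σ = 1` and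
`ε = dz̄`). -/
def formD (σ : ℂ) (ε : Fin (Module.finrank ℂ V) → V →ₗ[ℝ] ℂ) {U : Opens X}
    (θ : ∀ x : U, FormFibre V (x : X)) : ∀ x : U, FormFibre V (x : X) :=
  fun x => ExteriorAlgebra.map (modelToCotangent V (x : X) (x : X))
    (modelD σ ε (formCoord θ x) (chartAt V (x : X) x))

theorem del_eq_formD {U : Opens X} (θ : ∀ x : U, FormFibre V (x : X)) :
    del θ = formD (-1) (dz V) θ := by
  funext x
  rw [del, formD, modelDel_eq]

theorem delbar_eq_formD {U : Opens X} (θ : ∀ x : U, FormFibre V (x : X)) :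
    delbar θ = formD 1 (dzbar V) θ := by
  funext x
  rw [delbar, formD, modelDelbar_eq]

theorem modelD_congr (σ : ℂ) (ε : Fin (Module.finrank ℂ V) → V →ₗ[ℝ] ℂ)
    {g g' : V → ExteriorAlgebra ℂ (V →ₗ[ℝ] ℂ)} {y : V} (h : g =ᶠ[nhds y] g') :
    modelD σ ε g y = modelD σ ε g' y := by
  have hd : dirDeriv g y = dirDeriv g' y := by
    funext v
    refine Finset.sum_congr rfl fun I _ => ?_
    have hI : (fun z => (Module.finBasis ℂ (V →ₗ[ℝ] ℂ)).ExteriorAlgebra.coord I (g z)) =ᶠ[nhds y]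
        fun z => (Module.finBasis ℂ (V →ₗ[ℝ] ℂ)).ExteriorAlgebra.coord I (g' z) :=
      h.mono fun z hz => by simp only [hz]
    rw [hI.fderiv_eq]
  simp only [modelD, hd]

open Classical in
/-- A function on `U`, read in the chart centred at `x₀`, and extended by `0`. -/
def fnCoord {U : Opens X} (f : U → ℂ) (x₀ : X) (y : V) : ℂ :=
  if h : (chartAt V x₀).symm y ∈ U then f ⟨_, h⟩ else 0

/-- A function, as a form of degree `0`. -/
def scalarForm {U : Opens X} (f : U → ℂ) : ∀ x : U, FormFibre V (x : X) :=
  fun x => algebraMap ℂ _ (f x)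

theorem formCoord_scalarForm {U : Opens X} (f : U → ℂ) (x₀ : X) :
    formCoord (V := V) (scalarForm f) x₀ = fun y => algebraMap ℂ _ (fnCoord f x₀ y) := by
  funext y
  unfold formCoord fnCoord
  split_ifs
  · exact AlgHom.commutes _ _
  · exact (map_zero _).symm

theorem fnCoord_chart {U : Opens X} (f : U → ℂ) {x₀ : X} (x : U)
    (hx : (x : X) ∈ (chartAt V x₀).source) : fnCoord f x₀ (chartAt V x₀ (x : X)) = f x := by
  have h : (chartAt V x₀).symm (chartAt V x₀ (x : X)) = x := (chartAt V x₀).left_inv hx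
  have h' : (chartAt V x₀).symm (chartAt V x₀ (x : X)) ∈ U := by rw [h]; exact x.2
  rw [fnCoord, dif_pos h']
  exact congrArg f (Subtype.ext h)

theorem fnCoord_comp {U : Opens X} (f : U → ℂ) {x₀ x₁ : X} (x : U)
    (h₀ : (x : X) ∈ (chartAt V x₀).source) (h₁ : (x : X) ∈ (chartAt V x₁).source) :
    fnCoord f x₁ =ᶠ[nhds (chartAt V x₁ (x : X))]
      fnCoord f x₀ ∘ (chartAt V x₀ ∘ (chartAt V x₁).symm) := by
  filter_upwards [eventually_symm_mem h₁ x.2, eventually_symm_mem h₁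
    (U := ⟨(chartAt V x₀).source, (chartAt V x₀).open_source⟩) h₀] with y hyU hy
  rw [Function.comp_apply, Function.comp_apply, fnCoord_chart f ⟨_, hyU⟩ hy, fnCoord, dif_pos hyU]

theorem modelToCotangent_apply {x₀ x : X} (hx : x ∈ (chartAt V x₀).source) (α : V →ₗ[ℝ] ℂ)
    (v : V) : modelToCotangent V x₀ x α v =
      α (fderiv ℂ (chartAt V x₀ ∘ (chartAt V x).symm) (chartAt V x x) v) := by
  have h : (trivializationAt V (TangentSpace 𝓘(ℂ, V)) x₀).continuousLinearMapAt ℂ x =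
      fderiv ℂ (chartAt V x₀ ∘ (chartAt V x).symm) (chartAt V x x) := by
    rw [TangentBundle.continuousLinearMapAt_trivializationAt_eq_core hx,
      tangentBundleCore_coordChange_achart, modelWithCornersSelf_coe, Set.range_id,
      fderivWithin_univ]
    simp
    rfl
  exact congrArg (fun A : V →L[ℂ] V => α (A v)) h

/-- The differential of a function does not depend on the chart. -/
theorem modelToCotangent_fderiv {U : Opens X} (f : U → ℂ) {x₀ : X} (x : U)
    (h₀ : (x : X) ∈ (chartAt V x₀).source)
    (hf : DifferentiableAt ℝ (fnCoord f x₀) (chartAt V x₀ (x : X))) (σ : ℂ) :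
    modelToCotangent V (x : X) x
        (typePart σ (fderiv ℝ (fnCoord f (x : X)) (chartAt V (x : X) x) : V →ₗ[ℝ] ℂ)) =
      modelToCotangent V x₀ x
        (typePart σ (fderiv ℝ (fnCoord f x₀) (chartAt V x₀ (x : X)) : V →ₗ[ℝ] ℂ)) := by
  have hx : (x : X) ∈ (chartAt V (x : X)).source := mem_chart_source V _
  have hφ := (analyticAt_chart_comp_symm h₀ hx).differentiableAt
  have hid : fderiv ℂ (chartAt V (x : X) ∘ (chartAt V (x : X)).symm) (chartAt V (x : X) x) =
      ContinuousLinearMap.id ℂ V := by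
    have h : chartAt V (x : X) ∘ (chartAt V (x : X)).symm =ᶠ[nhds (chartAt V (x : X) x)] id := by
      filter_upwards [(chartAt V (x : X)).open_target.mem_nhds
        ((chartAt V (x : X)).map_source hx)] with y hy
      exact (chartAt V (x : X)).right_inv hy
    rw [h.fderiv_eq, fderiv_id]
  have hφx : (chartAt V x₀ ∘ (chartAt V (x : X)).symm) (chartAt V (x : X) x) =
      chartAt V x₀ (x : X) := by
    rw [Function.comp_apply, (chartAt V (x : X)).left_inv hx]
  rw [← hφx] at hf
  ext v
  refine (modelToCotangent_apply hx _ v).trans (Eq.trans ?_ (modelToCotangent_apply h₀ _ v).symm)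
  rw [hid, (fnCoord_comp f x h₀ hx).fderiv_eq, fderiv_comp _ hf (hφ.restrictScalars ℝ), hφx,
    hφ.fderiv_restrictScalars ℝ]
  simp [typePart_apply]
  rfl

theorem formD_scalarForm {σ : ℂ} {ε : Fin (Module.finrank ℂ V) → V →ₗ[ℝ] ℂ}
    (hε : IsFrame V σ ε) {U : Opens X} (f : U → ℂ) {x₀ : X} (x : U)
    (h₀ : (x : X) ∈ (chartAt V x₀).source)
    (hf : AnalyticAt ℝ (fnCoord f x₀) (chartAt V x₀ (x : X))) :
    formD σ ε (scalarForm f) x = ExteriorAlgebra.ι ℂ (modelToCotangent V x₀ x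
      (typePart σ (fderiv ℝ (fnCoord f x₀) (chartAt V x₀ (x : X)) : V →ₗ[ℝ] ℂ))) := by
  have hx : (x : X) ∈ (chartAt V (x : X)).source := mem_chart_source V _
  have hφx : (chartAt V x₀ ∘ (chartAt V (x : X)).symm) (chartAt V (x : X) x) =
      chartAt V x₀ (x : X) := by
    rw [Function.comp_apply, (chartAt V (x : X)).left_inv hx]
  have hfx : DifferentiableAt ℝ (fnCoord f (x : X)) (chartAt V (x : X) x) := by
    rw [(fnCoord_comp f x h₀ hx).differentiableAt_iff]
    rw [← hφx] at hf
    exact (hf.comp (analyticAt_chart_comp_symm h₀ hx).restrictScalars).differentiableAt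
  rw [formD, formCoord_scalarForm, modelD_algebraMap hε hfx, ExteriorAlgebra.map_apply_ι,
    modelToCotangent_fderiv f x h₀ hf.differentiableAt]

/-- The relations `∂² = 0`, `∂̄² = 0` and `∂∂̄ + ∂̄∂ = 0` on functions on a complex manifold. -/
theorem formD_formD {σ σ' : ℂ} {ε ε' : Fin (Module.finrank ℂ V) → V →ₗ[ℝ] ℂ}
    (hε : IsFrame V σ ε) (hε' : IsFrame V σ' ε') {U : Opens X} {f : U → ℂ}
    (hf : ∀ x : U, AnalyticAt ℝ (fnCoord f (x : X)) (chartAt V (x : X) x)) (x : U) :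
    formD σ' ε' (formD σ ε (scalarForm f)) x + formD σ ε (formD σ' ε' (scalarForm f)) x = 0 := by
  have hx : (x : X) ∈ (chartAt V (x : X)).source := mem_chart_source V _
  have h : ∀ {σ : ℂ} {ε : Fin (Module.finrank ℂ V) → V →ₗ[ℝ] ℂ}, IsFrame V σ ε →
      formCoord (formD σ ε (scalarForm f)) (x : X) =ᶠ[nhds (chartAt V (x : X) x)]
        fun z => ExteriorAlgebra.ι ℂ (typePart σ (fderiv ℝ (fnCoord f (x : X)) z : V →ₗ[ℝ] ℂ)) := by
    intro σ ε hε
    filter_upwards [eventually_symm_mem hx x.2, (chartAt V (x : X)).open_target.mem_nhds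
      ((chartAt V (x : X)).map_source hx), (hf x).eventually_analyticAt] with y hyU hy hfy
    have hs := (chartAt V (x : X)).map_target hy
    have hr := (chartAt V (x : X)).right_inv hy
    rw [formCoord, dif_pos hyU, formD_scalarForm hε f ⟨_, hyU⟩ hs (by rw [hr]; exact hfy),
      ExteriorAlgebra.map_apply_ι, hr, cotangentToModel_modelToCotangent hs]
  rw [formD, formD, ← map_add, modelD_congr σ' ε' (h hε), modelD_congr σ ε (h hε'),
    modelD_modelD hε hε' (hf x), map_zero]

end Functions

/-! ### Odd superderivations of an algebra of sections -/

section AbstractDerivations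

-- The algebra `A` is a subalgebra of a product of algebras, as are the algebras `analyticSections`,
-- so that the identities below apply to these with syntactically equal ring structures.

variable {B : Type*} {M : B → Type*} [∀ i, Ring (M i)] [∀ i, Algebra ℂ (M i)]
variable {A : Subalgebra ℂ (∀ i, M i)}

/-- Odd superderivations of a superalgebra whose parity involution is `p`. -/
structure IsOddDer (p D : Module.End ℂ A) : Prop where
  odd : ∀ s, D (p s) = -p (D s)
  leibniz : ∀ s t, D (s * t) = D s * t + p s * D t

variable {p D D' : Module.End ℂ A}

/-- The supercommutator `D D' + D' D` of two odd superderivations is a derivation. -/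
theorem IsOddDer.comm_mul (hp : ∀ s, p (p s) = s) (hD : IsOddDer p D) (hD' : IsOddDer p D')
    (s t : A) :
    (D * D' + D' * D) (s * t) = (D * D' + D' * D) s * t + s * (D * D' + D' * D) t := by
  simp only [LinearMap.add_apply, Module.End.mul_apply]
  rw [hD.leibniz s t, hD'.leibniz s t, map_add, map_add, hD.leibniz, hD.leibniz, hD'.leibniz,
    hD'.leibniz, hD.odd, hD'.odd, hp]
  have hn : ∀ a b : A, -a * b = -(a * b) := fun a b => neg_mul a b
  simp only [add_mul, mul_add, hn]
  abel

theorem IsOddDer.comm_parity (hD : IsOddDer p D) (hD' : IsOddDer p D') (s : A) :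
    (D * D' + D' * D) (p s) = p ((D * D' + D' * D) s) := by
  simp only [LinearMap.add_apply, Module.End.mul_apply]
  rw [hD.odd, hD'.odd, map_neg, map_neg, hD.odd, hD'.odd, neg_neg, neg_neg, map_add]

theorem isOddDer_sum {κ : Type*} (K : Finset κ) {d : κ → Module.End ℂ A}
    (h : ∀ k ∈ K, IsOddDer p (d k)) : IsOddDer p (∑ k ∈ K, d k) where
  odd s := by
    rw [LinearMap.sum_apply, LinearMap.sum_apply, map_sum, ← Finset.sum_neg_distrib]
    exact Finset.sum_congr rfl fun k hk => (h k hk).odd s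
  leibniz s t := by
    rw [LinearMap.sum_apply, LinearMap.sum_apply, LinearMap.sum_apply, Finset.sum_mul,
      Finset.mul_sum, ← Finset.sum_add_distrib]
    exact Finset.sum_congr rfl fun k hk => (h k hk).leibniz s t

/-- The powers of a derivation commute with the multiplications by its constants. -/
theorem pow_apply_mul_left {R : Module.End ℂ A} (hR : ∀ s t, R (s * t) = R s * t + s * R t) {η : A}
    (hη : R η = 0) (n : ℕ) (s : A) : (R ^ n) (η * s) = η * (R ^ n) s := by
  induction n generalizing s with
  | zero => rfl
  | succ n ih =>
    rw [pow_succ, Module.End.mul_apply, Module.End.mul_apply, hR, hη, zero_mul, zero_add, ih]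

theorem pow_apply_mul_right {R : Module.End ℂ A} (hR : ∀ s t, R (s * t) = R s * t + s * R t) {η : A}
    (hη : R η = 0) (n : ℕ) (s : A) : (R ^ n) (s * η) = (R ^ n) s * η := by
  induction n generalizing s with
  | zero => rfl
  | succ n ih =>
    rw [pow_succ, Module.End.mul_apply, Module.End.mul_apply, hR, hη, mul_zero, add_zero, ih]

theorem smul_pow_apply_mul_left {R : Module.End ℂ A}
    (hR : ∀ s t, R (s * t) = R s * t + s * R t) {η : A} (hη : R η = 0) (z : ℂ) (n : ℕ) (s : A) :
    (z • R ^ n) (η * s) = η * (z • R ^ n) s := by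
  rw [LinearMap.smul_apply, LinearMap.smul_apply, pow_apply_mul_left hR hη, mul_smul_comm]

theorem smul_pow_apply_mul_right {R : Module.End ℂ A}
    (hR : ∀ s t, R (s * t) = R s * t + s * R t) {η : A} (hη : R η = 0) (z : ℂ) (n : ℕ) (s : A) :
    (z • R ^ n) (s * η) = (z • R ^ n) s * η := by
  rw [LinearMap.smul_apply, LinearMap.smul_apply, pow_apply_mul_right hR hη, smul_mul_assoc]

theorem smul_pow_apply_comm {R q : Module.End ℂ A} (h : ∀ s, R (q s) = q (R s)) (z : ℂ) (n : ℕ)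
    (s : A) : (z • R ^ n) (q s) = q ((z • R ^ n) s) := by
  have h1 : ∀ s, (R ^ n) (q s) = q ((R ^ n) s) := by
    induction n with
    | zero => exact fun _ => rfl
    | succ n ih =>
      intro s
      rw [pow_succ, Module.End.mul_apply, Module.End.mul_apply, h, ih]
  rw [LinearMap.smul_apply, LinearMap.smul_apply, h1, map_smul]

/-- A linear combination `∑ f k * g k` is sent to `∑ f k * Φ (g k)` by an operator which is linear
over the coefficients. -/
theorem map_sum_mul {Φ : Module.End ℂ A} {κ : Type*} [Fintype κ] {s : A} {f g : κ → A}
    (hΦ : ∀ k t, Φ (f k * t) = f k * Φ t) (hs : s = ∑ k, f k * g k) :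
    Φ s = ∑ k, f k * Φ (g k) := by
  rw [hs, map_sum]
  exact Finset.sum_congr rfl fun k _ => hΦ k _

theorem coe_sum_mul {κ : Type*} [Fintype κ] (f g : κ → A) (x : B) :
    (∑ k, f k * g k).1 x = ∑ k, (f k).1 x * (g k).1 x := by
  have h : (∑ k, f k * g k).1 = ∑ k, (f k * g k).1 := map_sum A.val _ _
  rw [h, Finset.sum_apply]
  rfl

theorem coe_sum_smul {κ : Type*} [Fintype κ] (z : κ → ℂ) (g : κ → A) (x : B) :
    (∑ k, z k • g k).1 x = ∑ k, z k • (g k).1 x := by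
  have h : (∑ k, z k • g k).1 = ∑ k, (z k • g k).1 := map_sum A.val _ _
  rw [h, Finset.sum_apply]
  rfl

/-- A derivation which vanishes on the coefficients and on the frame of an expansion vanishes. -/
theorem derivation_eq_zero {R : Module.End ℂ A} (hR : ∀ s t, R (s * t) = R s * t + s * R t)
    {κ : Type*} [Fintype κ] {s : A} {f g : κ → A} (hf : ∀ k, R (f k) = 0) (hg : ∀ k, R (g k) = 0)
    (hs : s = ∑ k, f k * g k) : R s = 0 := by
  rw [hs, map_sum]
  refine Finset.sum_eq_zero fun k _ => ?_
  rw [hR, hf, hg, zero_mul, mul_zero, add_zero]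

/-- A derivation of an algebra which vanishes on the images of the generators of `⋀C ⊗̂ ⋀W` vanishes
on the image of `⋀C ⊗̂ ⋀W`. -/
theorem derivation_comp_eq_zero {R : Module.End ℂ A}
    (hR : ∀ s t, R (s * t) = R s * t + s * R t) {C W : Type*} [AddCommGroup C] [Module ℂ C]
    [AddCommGroup W] [Module ℂ W] (f : SuperTensor C W →ₐ[ℂ] A) (h1 : R 1 = 0)
    (hl : ∀ α, R (f (inl W (ExteriorAlgebra.ι ℂ α))) = 0)
    (hr : ∀ w, R (f (inr C (ExteriorAlgebra.ι ℂ w))) = 0) (t : SuperTensor C W) : R (f t) = 0 := by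
  induction t using superTensor_induction with
  | algebraMap z => rw [AlgHom.commutes, Algebra.algebraMap_eq_smul_one, map_smul, h1, smul_zero]
  | inl_ι α => exact hl α
  | inr_ι w => exact hr w
  | add s t hs ht => rw [map_add, map_add, hs, ht, add_zero]
  | mul s t hs ht => rw [map_mul, hR, hs, ht, zero_mul, mul_zero, add_zero]

theorem derivation_comp_inl_eq_zero {R : Module.End ℂ A}
    (hR : ∀ s t, R (s * t) = R s * t + s * R t) {C W : Type*} [AddCommGroup C] [Module ℂ C]
    [AddCommGroup W] [Module ℂ W] (f : SuperTensor C W →ₐ[ℂ] A) (h1 : R 1 = 0)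
    (hl : ∀ α, R (f (inl W (ExteriorAlgebra.ι ℂ α))) = 0) (a : ExteriorAlgebra ℂ C) :
    R (f (inl W a)) = 0 := by
  induction a using ExteriorAlgebra.induction with
  | algebraMap z =>
    rw [AlgHom.commutes, AlgHom.commutes, Algebra.algebraMap_eq_smul_one, map_smul, h1, smul_zero]
  | ι α => exact hl α
  | add s t hs ht => rw [map_add, map_add, map_add, hs, ht, add_zero]
  | mul s t hs ht => rw [map_mul, map_mul, hR, hs, ht, zero_mul, mul_zero, add_zero]

theorem comm_apply_eq_zero {s : A} (h : D s = 0) (h' : D' s = 0) : (D * D' + D' * D) s = 0 := by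
  rw [LinearMap.add_apply, Module.End.mul_apply, Module.End.mul_apply, h, h', map_zero, map_zero,
    add_zero]

theorem comm_self_apply_eq_zero {s : A} (h : D (D s) = 0) : (D * D + D * D) s = 0 := by
  rw [LinearMap.add_apply, Module.End.mul_apply, h, add_zero]

theorem mul_self_eq_zero_of_comm_self (h : D * D + D * D = 0) : D * D = 0 := by
  rw [← two_smul ℂ] at h
  exact (smul_eq_zero.mp h).resolve_left two_ne_zero

theorem add_mul_add_of_sq_eq_zero (h : D * D = 0) (h' : D' * D' = 0) :
    (D + D') * (D + D') = D * D' + D' * D := by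
  rw [mul_add, add_mul, add_mul, h, h', zero_add, add_zero, add_comm]

/-- If `D' ^ 2 = 0`, then `D'` commutes with `D D' + D' D`. -/
theorem comm_mul_of_sq_eq_zero (h' : D' * D' = 0) :
    (D * D' + D' * D) * D' = D' * (D * D' + D' * D) := by
  rw [add_mul, mul_add, mul_assoc, mul_assoc, ← mul_assoc D' D', h', mul_zero, zero_mul, zero_add,
    add_zero]

/-- For `α` and `β` of type `(1,0)` and `(0,1)`, the covector `α + β` is closed for `D` and `D'`
if the supercommutators of `D` and `D'` vanish on the functions with differentials `α` and `β`,
which is what the hypotheses express. -/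
theorem closed_of_comm {C W : Type*} [AddCommGroup C] [Module ℂ C] [AddCommGroup W] [Module ℂ W]
    (f : SuperTensor C W →ₐ[ℂ] A) {α β : C}
    (h1 : D (f (inl W (ExteriorAlgebra.ι ℂ α))) + D (f (inl W (ExteriorAlgebra.ι ℂ α))) = 0)
    (h2 : D' (f (inl W (ExteriorAlgebra.ι ℂ β))) + D' (f (inl W (ExteriorAlgebra.ι ℂ β))) = 0)
    (h3 : D (f (inl W (ExteriorAlgebra.ι ℂ 0))) + D' (f (inl W (ExteriorAlgebra.ι ℂ α))) = 0)
    (h4 : D (f (inl W (ExteriorAlgebra.ι ℂ β))) + D' (f (inl W (ExteriorAlgebra.ι ℂ 0))) = 0) :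
    D (f (inl W (ExteriorAlgebra.ι ℂ (α + β)))) = 0 ∧
      D' (f (inl W (ExteriorAlgebra.ι ℂ (α + β)))) = 0 := by
  have two : ∀ a : A, a + a = 0 → a = 0 := fun a ha => by
    rw [← two_smul ℂ] at ha
    exact (smul_eq_zero.mp ha).resolve_left two_ne_zero
  simp only [map_zero, zero_add, add_zero] at h3 h4
  simp only [map_add]
  rw [two _ h1, two _ h2, h3, h4, add_zero]
  exact ⟨rfl, rfl⟩

/-- The expansion, along a frame `e` with coefficients in the forms, of a superalgebra whose forms
supercommute with everything: the data needed to write a supertrace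
`s ↦ ∑ k, ε k • c k (s * Φ (e k))`. The frame is homogeneous, the sign of `e k` being `ε k`. -/
structure IsSuperFrame (p : Module.End ℂ A) (forms : Set A) {K : Type*} [Fintype K]
    (ε : K → ℂ) (e : K → A) (c : K → Module.End ℂ A) : Prop where
  parity_parity : ∀ s, p (p s) = s
  parity_mul : ∀ s t, p (s * t) = p s * p t
  sign : ∀ k, ε k = 1 ∨ ε k = -1
  expand : ∀ s, s = ∑ k, c k s * e k
  coeff_mem : ∀ k s, c k s ∈ forms
  coeff_mul : ∀ k, ∀ η ∈ forms, ∀ s, c k (η * s) = η * c k s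
  coeff_self : ∀ k, ∀ η ∈ forms, c k (η * e k) = η
  coeff_of_ne : ∀ j k, j ≠ k → ∀ η ∈ forms, c j (η * e k) = 0
  parity_frame : ∀ k, p (e k) = ε k • e k
  coeff_parity : ∀ k s, c k (p s) = ε k • p (c k s)
  comm_even : ∀ η ∈ forms, p η = η → ∀ s, s * η = η * s
  comm_odd : ∀ η ∈ forms, p η = -η → ∀ s, s * η = η * p s

variable {forms : Set A} {K : Type*} [Fintype K] {ε : K → ℂ} {e : K → A}
  {c : K → Module.End ℂ A}

/-- An odd superderivation `D` which preserves the forms acts on coefficients through `D` itself and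
its connection matrix `η j k = c j (D (e k))`. -/
theorem IsSuperFrame.coeff_derivation (h : IsSuperFrame p forms ε e c) (hD : IsOddDer p D)
    (hforms : ∀ η ∈ forms, D η ∈ forms) (hp : ∀ η ∈ forms, p η ∈ forms) (j : K) (s : A) :
    c j (D s) = D (c j s) + ∑ k, p (c k s) * c j (D (e k)) := by
  conv_lhs => rw [h.expand s]
  rw [map_sum, map_sum]
  have h1 : ∀ k, c j (D (c k s * e k)) =
      c j (D (c k s) * e k) + p (c k s) * c j (D (e k)) := fun k => by
    rw [hD.leibniz, map_add, h.coeff_mul j _ (hp _ (h.coeff_mem k s))]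
  simp only [h1]
  rw [Finset.sum_add_distrib]
  congr 1
  rw [Finset.sum_eq_single j
    (fun k _ hk => h.coeff_of_ne j k hk.symm _ (hforms _ (h.coeff_mem k s)))
    (fun hj => absurd (Finset.mem_univ j) hj), h.coeff_self j _ (hforms _ (h.coeff_mem j s))]

/-- The supertrace `s ↦ Str (l_s ∘ Φ)` of an even endomorphism `Φ` which is linear over the forms
and commutes with the odd superderivation `D` intertwines `D` with itself. For a `D` with `D e = 0`
on the frame this is the Leibniz rule; in general the connection matrix of `D` contributes the
supertrace of a supercommutator, whose terms cancel in pairs. -/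
theorem IsSuperFrame.supertrace_comm (h : IsSuperFrame p forms ε e c) (hD : IsOddDer p D)
    (hforms : ∀ η ∈ forms, D η ∈ forms) (hp : ∀ η ∈ forms, p η ∈ forms)
    {Φ : Module.End ℂ A} (hΦp : ∀ s, Φ (p s) = p (Φ s))
    (hΦ : ∀ η ∈ forms, ∀ s, Φ (η * s) = η * Φ s) (hΦD : ∀ s, Φ (D s) = D (Φ s)) (s : A) :
    ∑ j, ε j • c j (D s * Φ (e j)) = D (∑ j, ε j • c j (s * Φ (e j))) := by
  have hsq : ∀ k, ε k * ε k = 1 := fun k => by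
    rcases h.sign k with hk | hk <;> rw [hk] <;> norm_num
  have hparity : ∀ j k, p (c j (D (e k))) = -(ε j * ε k) • c j (D (e k)) := by
    intro j k
    have h1 := h.coeff_parity j (D (e k))
    have h2 : p (D (e k)) = -(ε k • D (e k)) := by
      rw [← neg_eq_iff_eq_neg, ← hD.odd, h.parity_frame, map_smul]
    rw [h2, map_neg, map_smul] at h1
    calc p (c j (D (e k))) = ε j • (ε j • p (c j (D (e k)))) := by rw [smul_smul, hsq, one_smul]
      _ = _ := by rw [← h1, smul_neg, smul_smul, neg_smul]
  -- The connection terms cancel after exchanging the two indices.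
  have key : ∀ j k, ε j • (p (c k (s * Φ (e j))) * c j (D (e k))) =
      ε k • c k (p s * (c j (D (e k)) * Φ (e j))) := by
    intro j k
    have hη := h.coeff_mem j (D (e k))
    have hpc : p (c k (s * Φ (e j))) = (ε k * ε j) • c k (p s * Φ (e j)) := by
      have h1 := h.coeff_parity k (s * Φ (e j))
      rw [h.parity_mul, ← hΦp, h.parity_frame, map_smul, mul_smul_comm, map_smul] at h1
      rw [← smul_smul, h1, smul_smul, hsq, one_smul]
    by_cases hjk : ε j = ε k
    · have hodd : p (c j (D (e k))) = -c j (D (e k)) := by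
        rw [hparity, hjk, hsq, neg_smul, one_smul]
      rw [← mul_assoc, h.comm_odd _ hη hodd (p s), h.parity_parity, mul_assoc,
        h.coeff_mul k _ hη, h.comm_odd _ hη hodd (p _), h.parity_parity, hjk]
    · have heven : p (c j (D (e k))) = c j (D (e k)) := by
        rw [hparity]
        have : -(ε j * ε k) = 1 := by
          rcases h.sign j with h1 | h1 <;> rcases h.sign k with h2 | h2 <;> simp_all
        rw [this, one_smul]
      rw [hpc, ← mul_assoc, h.comm_even _ hη heven (p s), mul_assoc, h.coeff_mul k _ hη,
        smul_mul_assoc, smul_smul, h.comm_even _ hη heven, mul_comm (ε k), ← mul_assoc, hsq,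
        one_mul]
  have hleib : ∀ j, c j (D s * Φ (e j)) = D (c j (s * Φ (e j))) +
      ∑ k, p (c k (s * Φ (e j))) * c j (D (e k)) -
        ∑ k, c j (p s * (c k (D (e j)) * Φ (e k))) := by
    intro j
    have h1 : Φ (D (e j)) = ∑ k, c k (D (e j)) * Φ (e k) := by
      conv_lhs => rw [h.expand (D (e j))]
      rw [map_sum]
      exact Finset.sum_congr rfl fun k _ => hΦ _ (h.coeff_mem k _) _
    have h2 := congrArg (c j) (hD.leibniz s (Φ (e j)))
    rw [← hΦD, h1, Finset.mul_sum, map_add, map_sum, h.coeff_derivation hD hforms hp] at h2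
    rw [h2, add_sub_cancel_right]
  simp only [hleib, smul_sub, smul_add, Finset.smul_sum, Finset.sum_sub_distrib,
    Finset.sum_add_distrib, map_sum, map_smul]
  rw [Finset.sum_comm (f := fun j k => ε j • c j (p s * (c k (D (e j)) * Φ (e k))))]
  simp only [key]
  rw [add_sub_cancel_right]

end AbstractDerivations

/-! ### Odd superderivations which restrict to `∂` or `∂̄` on forms -/

section Operators

set_option linter.unusedSectionVars false

variable {V : Type*} [NormedAddCommGroup V] [NormedSpace ℂ V] [FiniteDimensional ℂ V]
variable {X : Type*} [TopologicalSpace X] [ChartedSpace V X] [IsManifold 𝓘(ℂ, V) ω X]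
variable {F : Type*} [NormedAddCommGroup F] [NormedSpace ℂ F] [FiniteDimensional ℂ F]
variable {E : X → Type*} [∀ x, AddCommGroup (E x)] [∀ x, Module ℂ (E x)]
variable [∀ x, TopologicalSpace (E x)] [TopologicalSpace (TotalSpace F E)]
variable [FiberBundle F E] [VectorBundle ℂ F E] [ContMDiffVectorBundle ω F E 𝓘(ℂ, V)]

theorem parityOp_apply {U : Opens X} (s : analyticSections V F E U) (x : U) :
    (parityOp V F E U s).1 x = SuperTensor.parity (s.1 x) := rfl

theorem parityOp_parityOp {U : Opens X} (s : analyticSections V F E U) :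
    parityOp V F E U (parityOp V F E U s) = s :=
  Subtype.ext (funext fun x => parity_parity (s.1 x))

theorem parityOp_mul {U : Opens X} (s t : analyticSections V F E U) :
    parityOp V F E U (s * t) = parityOp V F E U s * parityOp V F E U t :=
  Subtype.ext (funext fun x => map_mul SuperTensor.parity (s.1 x) (t.1 x))

/-- The section `s` is a function. -/
def IsScalar {U : Opens X} (s : analyticSections V F E U) : Prop :=
  ∃ f : U → ℂ, s.1 = formSection E (scalarForm f)

theorem isScalar_one {U : Opens X} : IsScalar (1 : analyticSections V F E U) :=
  ⟨fun _ => 1, funext fun x => (map_one (algebraMap ℂ (Fibre V E (x : X)))).symm⟩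

theorem isScalar_coeff {U : Opens X} {x₀ : X} (hU : U ≤ coordDomain (V := V) F E x₀)
    (l : SuperTensor (V →ₗ[ℝ] ℂ) F →ₗ[ℂ] ℂ) (s : analyticSections V F E U) :
    IsScalar (coeff hU l s) :=
  ⟨fun x => l (fibreCoord F E x₀ x (s.1 x)), funext fun x => coeff_apply hU l s x⟩

theorem analyticAt_fnCoord {U : Opens X} {f : U → ℂ} {s : analyticSections V F E U}
    (hs : s.1 = formSection E (scalarForm f)) (x : U) :
    AnalyticAt ℝ (fnCoord f (x : X)) (chartAt V (x : X) x) := by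
  have h := s.2 x ((ExteriorAlgebra.algebraMapInv (R := ℂ) (M := V →ₗ[ℝ] ℂ)).toLinearMap ∘ₗ
    slice (ExteriorAlgebra.algebraMapInv (R := ℂ) (M := F)).toLinearMap)
  refine h.congr (Filter.Eventually.of_forall fun y => ?_)
  simp only [hs]
  unfold sectionCoord fnCoord
  split_ifs with hy
  · rw [formSection, scalarForm]
    have h1 : fibreCoord F E (x : X) ((chartAt V (x : X)).symm y)
        ((algebraMap ℂ (FormFibre V ((chartAt V (x : X)).symm y)) (f ⟨_, hy⟩)) ᵍ⊗ₜ[ℂ] 1) =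
        inl F (algebraMap ℂ _ (f ⟨_, hy⟩)) := by
      rw [fibreCoord, SuperTensor.map_tmul, map_one, AlgHom.commutes]
      rfl
    rw [h1, LinearMap.comp_apply, slice_algebraMapInv_inl]
    exact ExteriorAlgebra.algebraMap_leftInverse _ _
  · rw [map_zero]

/-- An odd superderivation of the algebra of sections over `U` which restricts to `∂` or `∂̄` on
forms. -/
structure IsFormDerivation (σ : ℂ) (ε : Fin (Module.finrank ℂ V) → V →ₗ[ℝ] ℂ) {U : Opens X}
    (D : Module.End ℂ (analyticSections V F E U)) : Prop where
  frame : IsFrame V σ ε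
  der : IsOddDer (parityOp V F E U) D
  forms : ∀ (θ : ∀ x : U, FormFibre V (x : X)) (s : analyticSections V F E U),
    s.1 = formSection E θ → (D s).1 = formSection E (formD σ ε θ)

section Pair

variable {U : Opens X} {σ σ' : ℂ} {ε ε' : Fin (Module.finrank ℂ V) → V →ₗ[ℝ] ℂ}
variable {D D' : Module.End ℂ (analyticSections V F E U)}

/-- The operators `∂`, `∂̄` supercommute with themselves and with each other on functions. -/
theorem IsFormDerivation.comm_scalar (hD : IsFormDerivation σ ε D)
    (hD' : IsFormDerivation σ' ε' D') {s : analyticSections V F E U} (hs : IsScalar s) :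
    (D * D' + D' * D) s = 0 := by
  obtain ⟨f, hf⟩ := hs
  refine Subtype.ext (funext fun x => ?_)
  change (D (D' s)).1 x + (D' (D s)).1 x = 0
  rw [hD.forms _ _ (hD'.forms _ _ hf), hD'.forms _ _ (hD.forms _ _ hf), formSection, formSection,
    ← gadd_tmul, formD_formD hD'.frame hD.frame (analyticAt_fnCoord hf), gzero_tmul]

theorem IsFormDerivation.scalar_apply (hD : IsFormDerivation σ ε D) {f : U → ℂ}
    {s : analyticSections V F E U} (hf : s.1 = formSection E (scalarForm f)) {x₀ : X} (x : U)
    (h₀ : (x : X) ∈ (chartAt V x₀).source)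
    (ha : AnalyticAt ℝ (fnCoord f x₀) (chartAt V x₀ (x : X))) :
    (D s).1 x = inl (E x) (ExteriorAlgebra.ι ℂ (modelToCotangent V x₀ x
      (typePart σ (fderiv ℝ (fnCoord f x₀) (chartAt V x₀ (x : X)) : V →ₗ[ℝ] ℂ)))) := by
  rw [hD.forms _ _ hf, formSection, formD_scalarForm hD.frame f x h₀ ha]
  rfl

variable {x₀ : X} (hU : U ≤ coordDomain (V := V) F E x₀)

/-- The real-linear functions of the coordinates. -/
def coordFn (α : V →ₗ[ℝ] ℂ) : analyticSections V F E U :=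
  ofCoord hU (fun y => algebraMap ℂ _ (α y)) fun _ l => by
    have h : (fun z => l (algebraMap ℂ (SuperTensor (V →ₗ[ℝ] ℂ) F) (α z))) =
        fun z => α z * l 1 := by
      funext z
      rw [Algebra.algebraMap_eq_smul_one, map_smul, smul_eq_mul]
    rw [h]
    exact (LinearMap.toContinuousLinearMap α).analyticAt _ |>.fun_mul analyticAt_const

theorem coordFn_eq (α : V →ₗ[ℝ] ℂ) : (coordFn hU α).1 =
    formSection E (scalarForm fun x : U => α (chartAt V x₀ (x : X))) :=
  funext fun x => AlgHom.commutes (fibreInv F E x₀ x) _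

theorem constSec_inl_ι (α : V →ₗ[ℝ] ℂ) (x : U) :
    (constSec hU (inl F (ExteriorAlgebra.ι ℂ α))).1 x =
      inl (E x) (ExteriorAlgebra.ι ℂ (modelToCotangent V x₀ x α)) := by
  rw [constSec_apply, fibreInv, inl_apply, SuperTensor.map_tmul, ExteriorAlgebra.map_apply_ι,
    map_one]
  rfl

theorem IsFormDerivation.coordFn (hD : IsFormDerivation σ ε D) (α : V →ₗ[ℝ] ℂ) :
    D (coordFn hU α) = constSec hU (inl F (ExteriorAlgebra.ι ℂ (typePart σ α))) := by
  refine Subtype.ext (funext fun x => ?_)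
  have h : fnCoord (fun x : U => α (chartAt V x₀ (x : X))) x₀ =ᶠ[nhds (chartAt V x₀ (x : X))]
      LinearMap.toContinuousLinearMap α := by
    filter_upwards [eventually_symm_mem (hU x.2).1 x.2, (chartAt V x₀).open_target.mem_nhds
      ((chartAt V x₀).map_source (hU x.2).1)] with y hy hy'
    rw [fnCoord, dif_pos hy, (chartAt V x₀).right_inv hy']
    rfl
  rw [hD.scalar_apply (coordFn_eq hU α) x (hU x.2).1
    (((LinearMap.toContinuousLinearMap α).analyticAt _).congr h.symm), h.fderiv_eq,
    ContinuousLinearMap.fderiv, constSec_inl_ι]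
  rfl

/-- The relation `D D' + D' D = 0` on the coordinate functions, as a relation between the values
of `D` and `D'` on the coordinate differentials. -/
theorem IsFormDerivation.comm_coordFn (hD : IsFormDerivation σ ε D)
    (hD' : IsFormDerivation σ' ε' D') (α : V →ₗ[ℝ] ℂ) :
    D (constSec hU (inl F (ExteriorAlgebra.ι ℂ (typePart σ' α)))) +
      D' (constSec hU (inl F (ExteriorAlgebra.ι ℂ (typePart σ α)))) = 0 := by
  rw [← hD'.coordFn, ← hD.coordFn]
  exact hD.comm_scalar hD' ⟨_, coordFn_eq hU α⟩

/-- The supercommutator `D D' + D' D` vanishes as soon as it vanishes on a frame of `E`, and on the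
coordinate differentials. -/
theorem IsFormDerivation.comm_eq_zero (hD : IsFormDerivation σ ε D)
    (hD' : IsFormDerivation σ' ε' D')
    (hl : ∀ α : V →ₗ[ℝ] ℂ, (D * D' + D' * D) (constSec hU (inl F (ExteriorAlgebra.ι ℂ α))) = 0)
    (hr : ∀ w : F, (D * D' + D' * D)
      (constSec hU (inr (V →ₗ[ℝ] ℂ) (ExteriorAlgebra.ι ℂ w))) = 0) :
    D * D' + D' * D = 0 := by
  have hR := hD.der.comm_mul parityOp_parityOp hD'.der
  ext1 s
  exact derivation_eq_zero hR (fun k => hD.comm_scalar hD' (isScalar_coeff hU _ s))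
    (fun k => derivation_comp_eq_zero hR (constSec hU) (hD.comm_scalar hD' isScalar_one) hl hr _)
    (eq_sum_coeff hU (Module.finBasis ℂ _) s)

end Pair

end Operators

/-! ### Expansion along a basis of the exterior algebra -/

section Slices

variable {C : Type*} [AddCommGroup C] [Module ℂ C]
variable {W : Type*} [AddCommGroup W] [Module ℂ W]
variable {W' : Type*} [AddCommGroup W'] [Module ℂ W']
variable {C' : Type*} [AddCommGroup C'] [Module ℂ C']
variable {I : Type*} [LinearOrder I]

theorem eq_sum_slice [Fintype I] (b : Module.Basis I ℂ W) (t : SuperTensor C W) :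
    t = ∑ J, inl W (slice (b.ExteriorAlgebra.coord J) t) * inr C (b.ExteriorAlgebra J) := by
  induction t using tmul_induction with
  | tmul a β =>
    conv_lhs => rw [← inl_mul_inr, ← b.ExteriorAlgebra.sum_repr β, map_sum, Finset.mul_sum]
    refine Finset.sum_congr rfl fun J _ => ?_
    rw [slice_tmul, map_smul, map_smul, mul_smul_comm, smul_mul_assoc]
    rfl
  | add s t hs ht =>
    conv_lhs => rw [hs, ht]
    rw [← Finset.sum_add_distrib]
    exact Finset.sum_congr rfl fun J _ => by rw [map_add, map_add, add_mul]

theorem slice_parity (b : Module.Basis I ℂ W) (J : Finset I) (t : SuperTensor C W) :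
    slice (b.ExteriorAlgebra.coord J) (SuperTensor.parity t) =
      (-1 : ℂ) ^ J.card • eps (slice (b.ExteriorAlgebra.coord J) t) := by
  have h : b.ExteriorAlgebra.coord J ∘ₗ eps = (-1 : ℂ) ^ J.card • b.ExteriorAlgebra.coord J := by
    refine b.ExteriorAlgebra.ext fun K => ?_
    rw [LinearMap.comp_apply, eps_of_mem (basis_mem_exteriorPower b K), map_smul,
      LinearMap.smul_apply, Module.Basis.coord_apply, Module.Basis.repr_self,
      Finsupp.single_apply]
    split_ifs with hK
    · rw [hK]
    · rw [smul_zero, smul_zero]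
  induction t using tmul_induction with
  | tmul a β =>
    rw [parity_tmul, slice_tmul, slice_tmul, map_smul, smul_smul]
    exact congrArg (· • eps a) (LinearMap.congr_fun h β)
  | add s t hs ht => rw [map_add, map_add, hs, ht, map_add, map_add, smul_add]

theorem parity_inr_basis (b : Module.Basis I ℂ W) (J : Finset I) :
    SuperTensor.parity (inr C (b.ExteriorAlgebra J)) =
      (-1 : ℂ) ^ J.card • inr C (b.ExteriorAlgebra J) := by
  rw [parity_inr, eps_of_mem (basis_mem_exteriorPower b J), map_smul]

theorem exteriorAlgebra_map_basis (b : Module.Basis I ℂ W) (b' : Module.Basis I ℂ W')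
    (g : W →ₗ[ℂ] W') (hg : ∀ i, g (b i) = b' i) (J : Finset I) :
    ExteriorAlgebra.map g (b.ExteriorAlgebra J) = b'.ExteriorAlgebra J := by
  rw [ExteriorAlgebra.basis_apply, ExteriorAlgebra.basis_apply,
    ExteriorAlgebra.map_apply_ιMulti]
  congr 1
  funext i
  exact hg _

theorem map_slice (b : Module.Basis I ℂ W) (b' : Module.Basis I ℂ W') (f : C →ₗ[ℂ] C')
    (g : W →ₗ[ℂ] W') (hg : ∀ i, g (b i) = b' i) (J : Finset I) (t : SuperTensor C W) :
    ExteriorAlgebra.map f (slice (b.ExteriorAlgebra.coord J) t) =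
      slice (b'.ExteriorAlgebra.coord J) (SuperTensor.map f g t) := by
  have h : b'.ExteriorAlgebra.coord J ∘ₗ (ExteriorAlgebra.map g).toLinearMap =
      b.ExteriorAlgebra.coord J := by
    refine b.ExteriorAlgebra.ext fun K => ?_
    rw [LinearMap.comp_apply, AlgHom.toLinearMap_apply, exteriorAlgebra_map_basis b b' g hg,
      Module.Basis.coord_apply, Module.Basis.coord_apply, Module.Basis.repr_self,
      Module.Basis.repr_self]
  induction t using tmul_induction with
  | tmul a β =>
    rw [slice_tmul, SuperTensor.map_tmul, slice_tmul, map_smul]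
    exact congrArg (· • ExteriorAlgebra.map f a) (LinearMap.congr_fun h β).symm
  | add s t hs ht => rw [map_add, map_add, hs, ht, map_add, map_add]

end Slices

/-! ### Restriction to smaller open sets -/

section Locality

set_option linter.unusedSectionVars false

variable {V : Type*} [NormedAddCommGroup V] [NormedSpace ℂ V] [FiniteDimensional ℂ V]
variable {X : Type*} [TopologicalSpace X] [ChartedSpace V X] [IsManifold 𝓘(ℂ, V) ω X]
variable {F : Type*} [NormedAddCommGroup F] [NormedSpace ℂ F] [FiniteDimensional ℂ F]
variable {E : X → Type*} [∀ x, AddCommGroup (E x)] [∀ x, Module ℂ (E x)]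
variable [∀ x, TopologicalSpace (E x)] [TopologicalSpace (TotalSpace F E)]
variable [FiberBundle F E] [VectorBundle ℂ F E] [ContMDiffVectorBundle ω F E 𝓘(ℂ, V)]

theorem sectionCoord_eventuallyEq {U W : Opens X} {s : ∀ x : U, Fibre V E (x : X)}
    {t : ∀ x : W, Fibre V E (x : X)}
    (h : ∀ (x : X) (hU : x ∈ U) (hW : x ∈ W), s ⟨x, hU⟩ = t ⟨x, hW⟩)
    {x : X} (hU : x ∈ U) (hW : x ∈ W) :
    sectionCoord F s x =ᶠ[nhds (chartAt V x x)] sectionCoord F t x := by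
  filter_upwards [eventually_symm_mem (mem_chart_source V x) hU,
    eventually_symm_mem (mem_chart_source V x) hW] with y hyU hyW
  rw [sectionCoord, dif_pos hyU, sectionCoord, dif_pos hyW, h]

/-- Real-analyticity is a local property. -/
theorem isAnalyticSection_of_local {U : Opens X} (s : ∀ x : U, Fibre V E (x : X))
    (h : ∀ x : U, ∃ (W : Opens X) (t : analyticSections V F E W), (x : X) ∈ W ∧
      ∀ (z : X) (hU : z ∈ U) (hW : z ∈ W), s ⟨z, hU⟩ = t.1 ⟨z, hW⟩) :
    IsAnalyticSection F s := by
  intro x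
  obtain ⟨W, t, hxW, ht⟩ := h x
  exact AnalyticCoord.congr (t.2 ⟨x, hxW⟩) (sectionCoord_eventuallyEq ht x.2 hxW).symm

/-- Restriction of sections. -/
def restrict {U W : Opens X} (h : W ≤ U) (s : analyticSections V F E U) :
    analyticSections V F E W :=
  ⟨fun x => s.1 ⟨x, h x.2⟩, isAnalyticSection_of_local _ fun x => ⟨U, s, h x.2, fun _ _ _ => rfl⟩⟩

/-- Compatibility with restriction of a family of operators on sections, in the form used by
`SheafEnd`. -/
def IsLocal (Φ : ∀ U : Opens X, Module.End ℂ (analyticSections V F E U)) : Prop :=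
  ∀ (U W : Opens X) (h : W ≤ U) (s : analyticSections V F E U) (t : analyticSections V F E W),
    (∀ x : W, t.1 x = s.1 ⟨x, h x.2⟩) → ∀ x : W, (Φ W t).1 x = (Φ U s).1 ⟨x, h x.2⟩

variable {Φ Ψ : ∀ U : Opens X, Module.End ℂ (analyticSections V F E U)}

theorem IsLocal.apply_eq (hΦ : IsLocal Φ) {U : Opens X} (s : analyticSections V F E U) (x : U)
    {W : Opens X} (hW : W ≤ U) (hx : (x : X) ∈ W) :
    (Φ U s).1 x = (Φ W (restrict hW s)).1 ⟨x, hx⟩ :=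
  (hΦ U W hW s (restrict hW s) (fun _ => rfl) ⟨x, hx⟩).symm

theorem IsLocal.add (hΦ : IsLocal Φ) (hΨ : IsLocal Ψ) : IsLocal fun U => Φ U + Ψ U :=
  fun U W h s t hst x => congrArg₂ (· + ·) (hΦ U W h s t hst x) (hΨ U W h s t hst x)

theorem IsLocal.mul (hΦ : IsLocal Φ) (hΨ : IsLocal Ψ) : IsLocal fun U => Φ U * Ψ U :=
  fun U W h s t hst => hΦ U W h (Ψ U s) (Ψ W t) (hΨ U W h s t hst)

theorem IsLocal.smul (c : ℂ) (hΦ : IsLocal Φ) : IsLocal fun U => c • Φ U :=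
  fun U W h s t hst x => congrArg (c • ·) (hΦ U W h s t hst x)

theorem IsLocal.pow (hΦ : IsLocal Φ) (n : ℕ) : IsLocal fun U => Φ U ^ n := by
  induction n with
  | zero => exact fun _ _ _ _ _ hst => hst
  | succ n ih =>
    simp only [pow_succ]
    exact ih.mul hΦ

theorem isLocal_sum {κ : Type*} (K : Finset κ)
    {φ : κ → ∀ U : Opens X, Module.End ℂ (analyticSections V F E U)} (h : ∀ k, IsLocal (φ k)) :
    IsLocal fun U => ∑ k ∈ K, φ k U := by
  classical
  induction K using Finset.induction_on with
  | empty => exact fun _ _ _ _ _ _ _ => rfl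
  | insert k K hk ih =>
    simp only [Finset.sum_insert hk]
    exact (h k).add ih

theorem SheafEnd.isLocal (D : SheafEnd V F E) : IsLocal D.toFun := D.compat

end Locality

/-! ### The connection and the twisting differential as superderivations -/

section Curvature

set_option linter.unusedSectionVars false

variable {V : Type*} [NormedAddCommGroup V] [NormedSpace ℂ V] [FiniteDimensional ℂ V]
variable {X : Type*} [TopologicalSpace X] [ChartedSpace V X] [IsManifold 𝓘(ℂ, V) ω X]
variable {F : Type*} [NormedAddCommGroup F] [NormedSpace ℂ F] [FiniteDimensional ℂ F]
variable {E : X → Type*} [∀ x, AddCommGroup (E x)] [∀ x, Module ℂ (E x)]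
variable [∀ x, TopologicalSpace (E x)] [TopologicalSpace (TotalSpace F E)]
variable [FiberBundle F E] [VectorBundle ℂ F E] [ContMDiffVectorBundle ω F E 𝓘(ℂ, V)]
variable {τ : ∀ x : X, Module.Dual ℂ (E x)}

theorem IsOddSuperderivation.isOddDer {D : SheafEnd V F E} (hD : IsOddSuperderivation D)
    (U : Opens X) : IsOddDer (parityOp V F E U) (D.toFun U) :=
  ⟨hD.odd U, hD.leibniz U⟩

theorem FlatConnection10.isFormDerivation (nabla : FlatConnection10 V F E) (U : Opens X) :
    IsFormDerivation (-1) (dz V) (nabla.op.toFun U) where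
  frame := isFrame_dz
  der := nabla.superderivation.isOddDer U
  forms θ s hs := by
    obtain ⟨s, hs'⟩ := s
    subst hs
    rw [nabla.restrict_forms U θ hs']
    exact congrArg _ (del_eq_formD θ)

theorem TwistingDifferential.isOddDer (δ : TwistingDifferential V F E τ) (k : ℕ) (U : Opens X) :
    IsOddDer (parityOp V F E U) ((δ.a k).toFun U) := by
  rcases Nat.eq_zero_or_pos k with rfl | hk
  · refine ⟨fun s => Subtype.ext (funext fun x => ?_), fun s t => Subtype.ext (funext fun x => ?_)⟩
    · change ((δ.a 0).toFun U (parityOp V F E U s)).1 x =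
        -SuperTensor.parity (((δ.a 0).toFun U s).1 x)
      rw [δ.contraction_zero, δ.contraction_zero]
      exact contraction_parity (τ x) (s.1 x)
    · change ((δ.a 0).toFun U (s * t)).1 x = ((δ.a 0).toFun U s).1 x * t.1 x +
        SuperTensor.parity (s.1 x) * ((δ.a 0).toFun U t).1 x
      rw [δ.contraction_zero, δ.contraction_zero, δ.contraction_zero]
      exact contraction_mul (τ x) (s.1 x) (t.1 x)
  · exact (δ.superderivation k hk).isOddDer U

theorem formSection_zero {U : Opens X} :
    formSection E (fun x : U => (0 : FormFibre V (x : X))) = 0 :=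
  funext fun _ => gzero_tmul _

theorem TwistingDifferential.forms (δ : TwistingDifferential V F E τ) {U : Opens X}
    {θ : ∀ x : U, FormFibre V (x : X)} {s : analyticSections V F E U}
    (hs : s.1 = formSection E θ) (k : ℕ) : ((δ.a k).toFun U s).1 =
      if k = 1 then formSection E (delbar θ) else 0 := by
  obtain ⟨s, hs'⟩ := s
  subst hs
  rcases lt_trichotomy k 1 with hk | rfl | hk
  · obtain rfl : k = 0 := by omega
    funext x
    rw [δ.contraction_zero, if_neg hk.ne]
    exact contraction_inl (τ x) (θ x)
  · rw [δ.restrict_forms_one U θ hs', if_pos rfl]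
  · rw [δ.restrict_forms k hk U θ hs', if_neg hk.ne', formSection_zero]

theorem TwistingDifferential.isFormDerivation (δ : TwistingDifferential V F E τ) (U : Opens X) :
    IsFormDerivation 1 (dzbar V) (δ.op U) where
  frame := isFrame_dzbar
  der := isOddDer_sum _ fun k _ => δ.isOddDer k U
  forms θ s hs := by
    have h1 : (δ.op U s).1 = ∑ k ∈ Finset.range (Module.finrank ℂ V + 1),
        ((δ.a k).toFun U s).1 := by
      rw [TwistingDifferential.op, LinearMap.sum_apply]
      exact map_sum (analyticSections V F E U).val _ _
    rw [h1, ← delbar_eq_formD, Finset.sum_congr rfl fun k _ => δ.forms hs k,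
      Finset.sum_ite_eq']
    split_ifs with h
    · rfl
    · -- In dimension `0` the sum `δ` has no term `a₁`, and `∂̄ = 0`.
      have hV : IsEmpty (Fin (Module.finrank ℂ V)) := by
        rw [Finset.mem_range] at h
        rw [show Module.finrank ℂ V = 0 by omega]
        exact Fin.isEmpty'
      have h2 : delbar θ = fun x : U => (0 : FormFibre V (x : X)) := by
        funext x
        rw [delbar, modelDelbar, Finset.univ_eq_empty, Finset.sum_empty, map_zero]
      rw [h2, formSection_zero]

theorem FlatConnection10.isLocal (nabla : FlatConnection10 V F E) : IsLocal nabla.op.toFun :=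
  nabla.op.isLocal

theorem TwistingDifferential.isLocal (δ : TwistingDifferential V F E τ) : IsLocal δ.op :=
  isLocal_sum _ fun k => (δ.a k).isLocal

theorem curvature_isLocal (nabla : FlatConnection10 V F E) (δ : TwistingDifferential V F E τ) :
    IsLocal (curvature nabla δ) :=
  (nabla.isLocal.add δ.isLocal).mul (nabla.isLocal.add δ.isLocal)

/-! ### The curvature is linear over the forms and commutes with the differential -/

section OnCoordDomain

variable {U : Opens X} {x₀ : X}

/-- The coordinate differentials are closed for operators restricting to `∂` and `∂̄`. -/
theorem IsFormDerivation.closed (hU : U ≤ coordDomain (V := V) F E x₀)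
    {ε ε' : Fin (Module.finrank ℂ V) → V →ₗ[ℝ] ℂ}
    {D D' : Module.End ℂ (analyticSections V F E U)} (hD : IsFormDerivation (-1) ε D)
    (hD' : IsFormDerivation 1 ε' D') (α : V →ₗ[ℝ] ℂ) :
    D (constSec hU (inl F (ExteriorAlgebra.ι ℂ α))) = 0 ∧
      D' (constSec hU (inl F (ExteriorAlgebra.ι ℂ α))) = 0 := by
  have hm := typePart_of_mem_model10 (typePart_mem_model10 α)
  have hp := typePart_of_mem_model01 (typePart_mem_model01 α)
  have h3 := hD.comm_coordFn hU hD' (typePart (-1) α)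
  have h4 := hD.comm_coordFn hU hD' (typePart 1 α)
  rw [hm.1, hm.2] at h3
  rw [hp.1, hp.2] at h4
  have h := closed_of_comm (constSec hU) (hD.comm_coordFn hU hD α) (hD'.comm_coordFn hU hD' α) h3 h4
  rwa [typePart_add] at h

theorem constSec_inr_ι_hasType (hU : U ≤ coordDomain (V := V) F E x₀)
    (w : F) :
    HasType (constSec hU (inr (V →ₗ[ℝ] ℂ) (ExteriorAlgebra.ι ℂ w))) 0 0 1 := by
  intro x
  refine Submodule.subset_span ⟨1, ?_, ExteriorAlgebra.ι ℂ ((trivializationAt F E x₀).symmL ℂ x w),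
    ι_mem_exteriorPower_one _, ?_⟩
  · rw [formType, pow_zero, pow_zero, one_mul]
    exact Submodule.one_le.mp le_rfl
  · rw [constSec_apply, fibreInv, inr_apply, SuperTensor.map_tmul, map_one,
      ExteriorAlgebra.map_apply_ι]
    rfl

/-- Flatness, given on `E`, holds on all `⋀E`-valued forms: `∇²` is a derivation which vanishes on
functions, on coordinate differentials and on frames of `E`. The operator `δ` only serves to show
that the coordinate differentials are `∇`-closed. -/
theorem FlatConnection10.sq_eq_zero (hU : U ≤ coordDomain (V := V) F E x₀)
    (nabla : FlatConnection10 V F E) (δ : TwistingDifferential V F E τ) :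
    nabla.op.toFun U * nabla.op.toFun U = 0 := by
  have hD := nabla.isFormDerivation U
  have hl := fun α => (hD.closed hU (δ.isFormDerivation U) α).1
  exact mul_self_eq_zero_of_comm_self (hD.comm_eq_zero hU hD
    (fun α => comm_apply_eq_zero (hl α) (hl α))
    (fun w => comm_self_apply_eq_zero (nabla.flat U _ (constSec_inr_ι_hasType hU w))))

/-- The relation `δ² = 0`, given on `T*`, holds on all `⋀E`-valued forms: `δ²` is a derivation which
vanishes on functions, on coordinate differentials and on frames of `E`. The connection only serves
to show that the coordinate differentials are `δ`-closed. -/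
theorem TwistingDifferential.sq_eq_zero (hU : U ≤ coordDomain (V := V) F E x₀)
    (nabla : FlatConnection10 V F E) (δ : TwistingDifferential V F E τ) :
    δ.op U * δ.op U = 0 := by
  have hD := δ.isFormDerivation U
  have hl := fun α => ((nabla.isFormDerivation U).closed hU hD α).2
  have hr : ∀ w, δ.op U (δ.op U
      (constSec hU (inr (V →ₗ[ℝ] ℂ) (ExteriorAlgebra.ι ℂ w)))) = 0 := fun w =>
    δ.sq_zero U (-1) _ ((constSec_inr_ι_hasType hU w).hasWeight (by norm_num))
  exact mul_self_eq_zero_of_comm_self (hD.comm_eq_zero hU hD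
    (fun α => comm_apply_eq_zero (hl α) (hl α)) (fun w => comm_self_apply_eq_zero (hr w)))

/-- As `∇² = 0` and `δ² = 0`, the curvature is the supercommutator of `∇` and `δ`; hence it is an
even derivation. -/
theorem curvature_eq (hU : U ≤ coordDomain (V := V) F E x₀)
    (nabla : FlatConnection10 V F E) (δ : TwistingDifferential V F E τ) :
    curvature nabla δ U = nabla.op.toFun U * δ.op U + δ.op U * nabla.op.toFun U :=
  add_mul_add_of_sq_eq_zero (FlatConnection10.sq_eq_zero hU nabla δ)
    (TwistingDifferential.sq_eq_zero hU nabla δ)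

theorem curvature_mul (hU : U ≤ coordDomain (V := V) F E x₀)
    (nabla : FlatConnection10 V F E) (δ : TwistingDifferential V F E τ)
    (s t : analyticSections V F E U) :
    curvature nabla δ U (s * t) = curvature nabla δ U s * t + s * curvature nabla δ U t := by
  rw [curvature_eq hU]
  exact (nabla.isFormDerivation U).der.comm_mul parityOp_parityOp (δ.isFormDerivation U).der s t

theorem curvature_parity (hU : U ≤ coordDomain (V := V) F E x₀)
    (nabla : FlatConnection10 V F E) (δ : TwistingDifferential V F E τ)
    (s : analyticSections V F E U) :
    curvature nabla δ U (parityOp V F E U s) = parityOp V F E U (curvature nabla δ U s) := by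
  rw [curvature_eq hU]
  exact (nabla.isFormDerivation U).der.comm_parity (δ.isFormDerivation U).der s

theorem curvature_comm (hU : U ≤ coordDomain (V := V) F E x₀)
    (nabla : FlatConnection10 V F E) (δ : TwistingDifferential V F E τ) :
    curvature nabla δ U * δ.op U = δ.op U * curvature nabla δ U := by
  rw [curvature_eq hU]
  exact comm_mul_of_sq_eq_zero (TwistingDifferential.sq_eq_zero hU nabla δ)

theorem curvature_scalar (hU : U ≤ coordDomain (V := V) F E x₀)
    (nabla : FlatConnection10 V F E) (δ : TwistingDifferential V F E τ)
    {s : analyticSections V F E U} (hs : IsScalar s) : curvature nabla δ U s = 0 := by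
  rw [curvature_eq hU]
  exact (nabla.isFormDerivation U).comm_scalar (δ.isFormDerivation U) hs

theorem curvature_constSec_inl (hU : U ≤ coordDomain (V := V) F E x₀)
    (nabla : FlatConnection10 V F E) (δ : TwistingDifferential V F E τ)
    (a : ExteriorAlgebra ℂ (V →ₗ[ℝ] ℂ)) :
    curvature nabla δ U (constSec hU (inl F a)) = 0 := by
  refine derivation_comp_inl_eq_zero (curvature_mul hU nabla δ) (constSec hU)
    (curvature_scalar hU nabla δ isScalar_one) (fun α => ?_) a
  have h := (nabla.isFormDerivation U).closed hU (δ.isFormDerivation U) α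
  rw [curvature_eq hU]
  exact comm_apply_eq_zero h.1 h.2

theorem fibreCoord_inl (x₀ x : X) (a : FormFibre V x) : fibreCoord F E x₀ x (inl (E x) a) =
    inl F (ExteriorAlgebra.map (cotangentToModel V x₀ x) a) := by
  rw [fibreCoord, inl_apply, SuperTensor.map_tmul, map_one]
  rfl

theorem fibreInv_inl (x₀ x : X) (a : ExteriorAlgebra ℂ (V →ₗ[ℝ] ℂ)) : fibreInv F E x₀ x (inl F a) =
    inl (E x) (ExteriorAlgebra.map (modelToCotangent V x₀ x) a) := by
  rw [fibreInv, inl_apply, SuperTensor.map_tmul, map_one]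
  rfl

/-- The curvature vanishes on the forms. -/
theorem curvature_form (hU : U ≤ coordDomain (V := V) F E x₀)
    (nabla : FlatConnection10 V F E) (δ : TwistingDifferential V F E τ)
    {θ : ∀ x : U, FormFibre V (x : X)} {s : analyticSections V F E U}
    (hs : s.1 = formSection E θ) : curvature nabla δ U s = 0 := by
  -- The projection of `⋀T* ⊗̂ ⋀E` onto the forms fixes `s`, which gives an expansion of `s` in the
  -- products of coordinate differentials.
  set L : Module.End ℂ (SuperTensor (V →ₗ[ℝ] ℂ) F) := (inl F).toLinearMap ∘ₗ
    slice (ExteriorAlgebra.algebraMapInv (R := ℂ) (M := F)).toLinearMap with hL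
  have h1 : constOp hU L s = s := by
    refine Subtype.ext (funext fun x => ?_)
    have h2 : s.1 x = inl (E x) (θ x) := congrFun hs x
    rw [constOp_apply, h2, fibreCoord_inl (F := F) (E := E), hL, LinearMap.comp_apply,
      slice_algebraMapInv_inl, AlgHom.toLinearMap_apply, ← fibreCoord_inl (F := F) (E := E),
      fibreInv_fibreCoord F E (hU x.2)]
  refine derivation_eq_zero (curvature_mul hU nabla δ)
    (fun k => curvature_scalar hU nabla δ (isScalar_coeff hU _ s)) (fun k => ?_)
    (h1.symm.trans (constOp_eq_sum hU (Module.finBasis ℂ _) L s))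
  exact curvature_constSec_inl hU nabla δ _

end OnCoordDomain

end Curvature

/-! ### Degrees of the operators -/

section Degrees

set_option linter.unusedSectionVars false

variable {V : Type*} [NormedAddCommGroup V] [NormedSpace ℂ V] [FiniteDimensional ℂ V]
variable {X : Type*} [TopologicalSpace X] [ChartedSpace V X] [IsManifold 𝓘(ℂ, V) ω X]
variable {F : Type*} [NormedAddCommGroup F] [NormedSpace ℂ F] [FiniteDimensional ℂ F]
variable {E : X → Type*} [∀ x, AddCommGroup (E x)] [∀ x, Module ℂ (E x)]
variable [∀ x, TopologicalSpace (E x)] [TopologicalSpace (TotalSpace F E)]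
variable [FiberBundle F E] [VectorBundle ℂ F E] [ContMDiffVectorBundle ω F E 𝓘(ℂ, V)]
variable {τ : ∀ x : X, Module.Dual ℂ (E x)}

/-- The constant sections of given degrees on which `D` shifts the degrees by `(a, c)`. -/
def degreeShift {U : Opens X} {x₀ : X} (hU : U ≤ coordDomain (V := V) F E x₀)
    (D : Module.End ℂ (analyticSections V F E U)) (a : ℕ) (c : ℤ) (p : ℕ) (i : ℤ) :
    Submodule ℂ (SuperTensor (V →ₗ[ℝ] ℂ) F) where
  carrier := {t | HasWeight (constSec hU t) p i ∧ HasWeight (D (constSec hU t)) (p + a) (i + c)}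
  add_mem' := fun {s t} hs ht => by
    constructor
    · rw [map_add]
      exact hs.1.add ht.1
    · rw [map_add, map_add]
      exact hs.2.add ht.2
  zero_mem' := by
    constructor
    · rw [map_zero]
      exact hasWeight_zero _ _
    · rw [map_zero, map_zero]
      exact hasWeight_zero _ _
  smul_mem' := fun z t ht => by
    constructor
    · rw [map_smul]
      exact ht.1.smul z
    · rw [map_smul, map_smul]
      exact ht.2.smul z

theorem HasWeight.of_eq {U : Opens X} {s s' : analyticSections V F E U} {p p' : ℕ} {i i' : ℤ}
    (hs : HasWeight s p i) (h : s' = s) (hp : p' = p) (hi : i' = i) : HasWeight s' p' i' := by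
  subst h hp hi
  exact hs

theorem IsOddDer.hasWeight_mul {U : Opens X} {D : Module.End ℂ (analyticSections V F E U)}
    (hD : IsOddDer (parityOp V F E U) D) {a : ℕ} {c : ℤ} {p p' : ℕ} {i i' : ℤ}
    {s t : analyticSections V F E U} (hs : HasWeight s p i) (hs' : HasWeight (D s) (p + a) (i + c))
    (ht : HasWeight t p' i') (ht' : HasWeight (D t) (p' + a) (i' + c)) :
    HasWeight (D (s * t)) (p + p' + a) (i + i' + c) := by
  have h1 := (hs'.mul ht).of_eq rfl (add_right_comm p p' a) (add_right_comm i i' c)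
  have h2 := (hs.parity.mul ht').of_eq rfl (add_assoc p p' a) (add_assoc i i' c)
  exact (h1.add h2).of_eq (hD.leibniz s t) rfl rfl

theorem IsOddDer.weight_le_degreeShift {U : Opens X} {x₀ : X}
    (hU : U ≤ coordDomain (V := V) F E x₀)
    {D : Module.End ℂ (analyticSections V F E U)} (hD : IsOddDer (parityOp V F E U) D)
    {a : ℕ} {c : ℤ} (hf : ∀ s, IsScalar s → HasWeight (D s) a c)
    (hl : ∀ α : V →ₗ[ℝ] ℂ, D (constSec hU (inl F (ExteriorAlgebra.ι ℂ α))) = 0)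
    (hr : ∀ w : F, HasWeight (D (constSec hU (inr (V →ₗ[ℝ] ℂ) (ExteriorAlgebra.ι ℂ w))))
      a (c - 1)) (p : ℕ) (i : ℤ) :
    weight F (model10 V) (model01 V) p i ≤ degreeShift hU D a c p i := by
  refine weight_le_of_generators (degreeShift hU D a c) ?_ ?_ ?_ ?_ ?_ p i
  · exact ⟨constSec_hasWeight hU (one_mem_weight _ _), (hf 1 isScalar_one).of_eq
      (congrArg D (_root_.map_one (constSec hU))) (zero_add a) (zero_add c)⟩
  · intro p i p' i' s hs t ht
    exact ⟨(hs.1.mul ht.1).of_eq (map_mul (constSec hU) s t) rfl rfl,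
      (hD.hasWeight_mul hs.1 hs.2 ht.1 ht.2).of_eq (congrArg D (map_mul (constSec hU) s t))
        rfl rfl⟩
  · exact fun α hα => ⟨constSec_hasWeight hU (inl_mem_weight (q := 0) (ι_mem_bitype_left _ hα)),
      (hasWeight_zero _ _).of_eq (hl α) rfl rfl⟩
  · exact fun α hα => ⟨constSec_hasWeight hU (inl_mem_weight (q := 1) (ι_mem_bitype_right _ hα)),
      (hasWeight_zero _ _).of_eq (hl α) rfl rfl⟩
  · exact fun w => ⟨constSec_hasWeight hU (inr_mem_weight (m := 1) _ _ (ι_mem_exteriorPower_one w)),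
      (hr w).of_eq rfl (zero_add a) (neg_add_eq_sub 1 c)⟩

theorem IsScalar.hasWeight {U : Opens X} {s : analyticSections V F E U} (hs : IsScalar s) :
    HasWeight s 0 0 := by
  obtain ⟨f, hf⟩ := hs
  intro x
  have h1 : s.1 x = f x • 1 := (congrFun hf x).trans (Algebra.algebraMap_eq_smul_one (f x))
  rw [h1]
  exact Submodule.smul_mem _ _ (one_mem_weight _ _)

/-- The degrees of an odd superderivation can be read off on functions and on frames. -/
theorem IsOddDer.hasWeight {U : Opens X} {x₀ : X} (hU : U ≤ coordDomain (V := V) F E x₀)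
    {D : Module.End ℂ (analyticSections V F E U)} (hD : IsOddDer (parityOp V F E U) D)
    {a : ℕ} {c : ℤ} (hf : ∀ s, IsScalar s → HasWeight (D s) a c)
    (hl : ∀ α : V →ₗ[ℝ] ℂ, D (constSec hU (inl F (ExteriorAlgebra.ι ℂ α))) = 0)
    (hr : ∀ w : F, HasWeight (D (constSec hU (inr (V →ₗ[ℝ] ℂ) (ExteriorAlgebra.ι ℂ w))))
      a (c - 1))
    {s : analyticSections V F E U} {p : ℕ} {i : ℤ} (hs : HasWeight s p i) :
    HasWeight (D s) (p + a) (i + c) := by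
  obtain ⟨t, ht, hst⟩ := hs.exists_eq_sum hU (Module.finBasis ℂ _)
  refine HasWeight.of_eq (hasWeight_sum Finset.univ fun k _ => ?_)
    ((congrArg D hst).trans (map_sum D _ _)) rfl rfl
  have hk := isScalar_coeff hU ((Module.finBasis ℂ (SuperTensor (V →ₗ[ℝ] ℂ) F)).coord k) s
  have hK := hD.weight_le_degreeShift hU hf hl hr p i (ht k)
  exact (hD.hasWeight_mul hk.hasWeight ((hf _ hk).of_eq rfl (zero_add a) (zero_add c)) hK.1
    hK.2).of_eq rfl (by rw [zero_add]) (by rw [zero_add])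

theorem IsFormDerivation.hasWeight_scalar_del {U : Opens X}
    {ε : Fin (Module.finrank ℂ V) → V →ₗ[ℝ] ℂ} {D : Module.End ℂ (analyticSections V F E U)}
    (hD : IsFormDerivation (-1) ε D) {s : analyticSections V F E U} (hs : IsScalar s) :
    HasWeight (D s) 1 0 := by
  obtain ⟨f, hf⟩ := hs
  intro x
  rw [hD.scalar_apply hf x (mem_chart_source V _) (analyticAt_fnCoord hf x)]
  exact inl_mem_weight (q := 0)
    (ι_mem_bitype_left _ (modelToCotangent_mem_cotangent10 (typePart_mem_model10 _)))

theorem IsFormDerivation.hasWeight_scalar_delbar {U : Opens X}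
    {ε : Fin (Module.finrank ℂ V) → V →ₗ[ℝ] ℂ} {D : Module.End ℂ (analyticSections V F E U)}
    (hD : IsFormDerivation 1 ε D) {s : analyticSections V F E U} (hs : IsScalar s) :
    HasWeight (D s) 0 1 := by
  obtain ⟨f, hf⟩ := hs
  intro x
  rw [hD.scalar_apply hf x (mem_chart_source V _) (analyticAt_fnCoord hf x)]
  exact inl_mem_weight (q := 1)
    (ι_mem_bitype_right _ (modelToCotangent_mem_cotangent01 (typePart_mem_model01 _)))

/-- The degrees of a local operator can be computed on coordinate domains. -/
theorem IsLocal.hasWeight {Φ : ∀ U : Opens X, Module.End ℂ (analyticSections V F E U)}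
    (hΦ : IsLocal Φ) {p p' : ℕ} {i i' : ℤ}
    (h : ∀ (W : Opens X) (x₀ : X), W ≤ coordDomain (V := V) F E x₀ →
      ∀ s : analyticSections V F E W, HasWeight s p i → HasWeight (Φ W s) p' i')
    {U : Opens X} {s : analyticSections V F E U} (hs : HasWeight s p i) :
    HasWeight (Φ U s) p' i' := by
  intro x
  have hW : U ⊓ coordDomain (V := V) F E (x : X) ≤ U := inf_le_left
  have hx : (x : X) ∈ U ⊓ coordDomain (V := V) F E (x : X) := ⟨x.2, mem_coordDomain F E _⟩
  have h0 : HasWeight (restrict hW s) p i := fun z => hs ⟨z, hW z.2⟩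
  have h1 := h _ (x : X) inf_le_right (restrict hW s) h0 ⟨x, hx⟩
  exact (congrArg (fun t : Fibre V E (x : X) =>
    t ∈ weight (E x) (cotangent10 V (x : X)) (cotangent01 V (x : X)) p' i')
      (hΦ.apply_eq s x hW hx)).mpr h1

theorem FlatConnection10.hasWeight (nabla : FlatConnection10 V F E)
    (δ : TwistingDifferential V F E τ) {U : Opens X} {s : analyticSections V F E U} {p : ℕ} {i : ℤ}
    (hs : HasWeight s p i) : HasWeight (nabla.op.toFun U s) (p + 1) i := by
  refine nabla.isLocal.hasWeight (fun W x₀ hW s hs => ?_) hs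
  have hD := nabla.isFormDerivation W
  have h := hD.der.hasWeight hW (fun s hs => hD.hasWeight_scalar_del hs)
    (fun α => (hD.closed hW (δ.isFormDerivation W) α).1)
    (fun w => (nabla.type_one_zero W _ (constSec_inr_ι_hasType hW w)).hasWeight (by norm_num)) hs
  rwa [add_zero] at h

theorem TwistingDifferential.hasWeight (nabla : FlatConnection10 V F E)
    (δ : TwistingDifferential V F E τ) {U : Opens X} {s : analyticSections V F E U} {p : ℕ} {i : ℤ}
    (hs : HasWeight s p i) : HasWeight (δ.op U s) p (i + 1) := by
  refine δ.isLocal.hasWeight (fun W x₀ hW s hs => ?_) hs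
  have hD := δ.isFormDerivation W
  refine hD.der.hasWeight hW (fun s hs => hD.hasWeight_scalar_delbar hs)
    (fun α => ((nabla.isFormDerivation W).closed hW hD α).2) (fun w => ?_) hs
  rw [TwistingDifferential.op, LinearMap.sum_apply, sub_self]
  refine hasWeight_sum _ fun k _ => ?_
  have h := δ.bidegree k 0 1 k (add_comm k 1) W _ (constSec_inr_ι_hasType hW w)
  exact h.hasWeight (by rw [zero_add, sub_self])

theorem curvature_hasWeight (nabla : FlatConnection10 V F E) (δ : TwistingDifferential V F E τ)
    {U : Opens X} {s : analyticSections V F E U} {p : ℕ} {i : ℤ} (hs : HasWeight s p i) :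
    HasWeight (curvature nabla δ U s) (p + 1) (i + 1) := by
  refine (curvature_isLocal nabla δ).hasWeight (fun W x₀ hW s hs => ?_) hs
  rw [curvature_eq hW]
  exact (nabla.hasWeight δ (δ.hasWeight nabla hs)).add (δ.hasWeight nabla (nabla.hasWeight δ hs))

theorem curvature_pow_hasWeight (nabla : FlatConnection10 V F E)
    (δ : TwistingDifferential V F E τ) (n : ℕ) {U : Opens X} {s : analyticSections V F E U} {p : ℕ}
    {i : ℤ} (hs : HasWeight s p i) :
    HasWeight ((curvature nabla δ U ^ n) s) (p + n) (i + n) := by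
  induction n with
  | zero => simpa using hs
  | succ n ih =>
    rw [pow_succ', Module.End.mul_apply]
    have h := curvature_hasWeight nabla δ ih
    rwa [add_assoc, add_assoc] at h

/-! ### Operators which are linear over the functions -/

section Tensorial

variable {U : Opens X} {x₀ : X}

/-- The value at `x` of an operator which is linear over the functions depends only on the value at
`x` of its argument. -/
theorem apply_eq_of_eq (hU : U ≤ coordDomain (V := V) F E x₀)
    {Φ : Module.End ℂ (analyticSections V F E U)}
    (hΦ : ∀ f, IsScalar f → ∀ s, Φ (f * s) = f * Φ s) {s t : analyticSections V F E U} {x : U}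
    (h : s.1 x = t.1 x) : (Φ s).1 x = (Φ t).1 x := by
  have key : ∀ s : analyticSections V F E U, (Φ s).1 x =
      ∑ k, algebraMap ℂ _ ((Module.finBasis ℂ (SuperTensor (V →ₗ[ℝ] ℂ) F)).coord k
        (fibreCoord F E x₀ x (s.1 x))) *
          (Φ (constSec hU (Module.finBasis ℂ (SuperTensor (V →ₗ[ℝ] ℂ) F) k))).1 x := fun s => by
    rw [map_sum_mul (fun k t => hΦ _ (isScalar_coeff hU _ s) t)
      (eq_sum_coeff hU (Module.finBasis ℂ _) s), coe_sum_mul]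
    exact Finset.sum_congr rfl fun k _ => by rw [coeff_apply]
  rw [key, key, h]

end Tensorial

/-! ### The supertrace in a local frame -/

section LocalTrace

variable {U : Opens X} {x₀ : X} (hU : U ≤ coordDomain (V := V) F E x₀)

/-- The coefficient of a section on an element of the frame of `⋀E`. -/
def frameCoeff (J : Finset (Fin (Module.finrank ℂ F))) :
    Module.End ℂ (analyticSections V F E U) :=
  constOp hU ((inl F).toLinearMap ∘ₗ slice ((Module.finBasis ℂ F).ExteriorAlgebra.coord J))

/-- The frame of `⋀E` induced by a trivialization of `E`. -/
def frame (J : Finset (Fin (Module.finrank ℂ F))) : analyticSections V F E U :=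
  constSec hU (inr (V →ₗ[ℝ] ℂ) ((Module.finBasis ℂ F).ExteriorAlgebra J))

theorem frameCoeff_apply (J : Finset (Fin (Module.finrank ℂ F))) (s : analyticSections V F E U)
    (x : U) : (frameCoeff hU J s).1 x = inl (E x) (ExteriorAlgebra.map (modelToCotangent V x₀ x)
      (slice ((Module.finBasis ℂ F).ExteriorAlgebra.coord J) (fibreCoord F E x₀ x (s.1 x)))) := by
  rw [frameCoeff, constOp_apply, LinearMap.comp_apply, AlgHom.toLinearMap_apply, fibreInv_inl]

/-- The sections which are differential forms. -/
def formSections (U : Opens X) : Set (analyticSections V F E U) :=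
  {s | ∃ θ : ∀ x : U, FormFibre V (x : X), s.1 = formSection E θ}

theorem parityOp_mem_formSections {s : analyticSections V F E U} (hs : s ∈ formSections U) :
    parityOp V F E U s ∈ formSections U := by
  obtain ⟨θ, hθ⟩ := hs
  refine ⟨fun x => eps (θ x), funext fun x => ?_⟩
  rw [parityOp_apply, hθ]
  exact parity_inl (θ x)

theorem fibreCoord_parity (x : X) (t : Fibre V E x) :
    fibreCoord F E x₀ x (SuperTensor.parity t) = SuperTensor.parity (fibreCoord F E x₀ x t) := by
  rw [fibreCoord, SuperTensor.parity, SuperTensor.parity, SuperTensor.map_map, SuperTensor.map_map]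
  congr 2
  all_goals
    ext1 v
    simp

theorem map_eps {C C' : Type*} [AddCommGroup C] [Module ℂ C] [AddCommGroup C'] [Module ℂ C']
    (f : C →ₗ[ℂ] C') (a : ExteriorAlgebra ℂ C) :
    ExteriorAlgebra.map f (eps a) = eps (ExteriorAlgebra.map f a) := by
  rw [← map_neg_id, ← map_neg_id, ← AlgHom.comp_apply, ← AlgHom.comp_apply,
    ExteriorAlgebra.map_comp_map, ExteriorAlgebra.map_comp_map]
  congr 2
  ext1 v
  simp

theorem frameCoeff_mul (J : Finset (Fin (Module.finrank ℂ F))) {η : analyticSections V F E U}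
    (hη : η ∈ formSections U) (s : analyticSections V F E U) :
    frameCoeff hU J (η * s) = η * frameCoeff hU J s := by
  obtain ⟨θ, hθ⟩ := hη
  refine Subtype.ext (funext fun x => ?_)
  change _ = η.1 x * (frameCoeff hU J s).1 x
  have h1 : η.1 x = inl (E x) (θ x) := congrFun hθ x
  have h2 : (η * s).1 x = inl (E x) (θ x) * s.1 x := congrArg (· * s.1 x) h1
  have h3 : inl (E x) (ExteriorAlgebra.map (modelToCotangent V x₀ x)
      (ExteriorAlgebra.map (cotangentToModel V x₀ x) (θ x))) = inl (E x) (θ x) := by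
    rw [← fibreInv_inl (F := F) (E := E), ← fibreCoord_inl (F := F) (E := E),
      fibreInv_fibreCoord F E (hU x.2)]
  rw [frameCoeff_apply, frameCoeff_apply, h2, h1, map_mul, fibreCoord_inl (F := F) (E := E),
    slice_inl_mul, map_mul, map_mul, h3]

theorem frameCoeff_frame (j k : Finset (Fin (Module.finrank ℂ F))) :
    frameCoeff hU j (frame hU k : analyticSections V F E U) = if j = k then 1 else 0 := by
  refine Subtype.ext (funext fun x => ?_)
  rw [frameCoeff_apply, frame, constSec_apply, fibreCoord_fibreInv F E (hU x.2), inr_apply,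
    slice_tmul, Module.Basis.coord_apply, Module.Basis.repr_self, Finsupp.single_apply]
  by_cases hjk : j = k
  · rw [if_pos hjk.symm, if_pos hjk, one_smul, map_one, map_one]
    rfl
  · rw [if_neg (Ne.symm hjk), if_neg hjk, zero_smul, map_zero, map_zero]
    rfl

theorem eq_sum_frame (s : analyticSections V F E U) :
    s = ∑ J, frameCoeff hU J s * frame hU J := by
  refine Subtype.ext (funext fun x => ?_)
  rw [coe_sum_mul]
  conv_lhs => rw [← fibreInv_fibreCoord F E (hU x.2) (s.1 x),
    eq_sum_slice (Module.finBasis ℂ F) (fibreCoord F E x₀ x (s.1 x)), map_sum]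
  refine Finset.sum_congr rfl fun J _ => ?_
  rw [map_mul, frameCoeff_apply, frame, constSec_apply, fibreInv_inl]

theorem parityOp_frame (J : Finset (Fin (Module.finrank ℂ F))) :
    parityOp V F E U (frame hU J) = (-1 : ℂ) ^ J.card • frame hU J := by
  refine Subtype.ext (funext fun x => ?_)
  have h := congrArg (fibreInv F E x₀ (x : X))
    (parity_inr_basis (C := V →ₗ[ℝ] ℂ) (Module.finBasis ℂ F) J)
  rw [map_smul] at h
  refine Eq.trans ?_ h
  rw [parityOp_apply, frame, constSec_apply]
  have h1 := fibreCoord_parity (F := F) (x₀ := x₀) (x : X) (fibreInv F E x₀ x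
    (inr (V →ₗ[ℝ] ℂ) ((Module.finBasis ℂ F).ExteriorAlgebra J)))
  rw [fibreCoord_fibreInv F E (hU x.2)] at h1
  rw [← h1, fibreInv_fibreCoord F E (hU x.2)]

theorem frameCoeff_parityOp (J : Finset (Fin (Module.finrank ℂ F)))
    (s : analyticSections V F E U) : frameCoeff hU J (parityOp V F E U s) =
      (-1 : ℂ) ^ J.card • parityOp V F E U (frameCoeff hU J s) := by
  refine Subtype.ext (funext fun x => ?_)
  change (frameCoeff hU J (parityOp V F E U s)).1 x =
    (-1 : ℂ) ^ J.card • SuperTensor.parity ((frameCoeff hU J s).1 x)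
  rw [frameCoeff_apply, frameCoeff_apply, parityOp_apply, fibreCoord_parity, slice_parity,
    parity_inl, map_smul, map_smul, map_eps]

theorem mul_form_of_even {η : analyticSections V F E U} (hη : η ∈ formSections U)
    (hp : parityOp V F E U η = η) (s : analyticSections V F E U) : s * η = η * s := by
  obtain ⟨θ, hθ⟩ := hη
  refine Subtype.ext (funext fun x => ?_)
  have h1 : η.1 x = inl (E x) (θ x) := congrFun hθ x
  have h2 : SuperTensor.parity (η.1 x) = η.1 x := congrFun (congrArg Subtype.val hp) x
  rw [h1, parity_inl] at h2
  change s.1 x * η.1 x = η.1 x * s.1 x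
  rw [h1]
  exact mul_inl_of_even _ (inl_injective h2)

theorem mul_form_of_odd {η : analyticSections V F E U} (hη : η ∈ formSections U)
    (hp : parityOp V F E U η = -η) (s : analyticSections V F E U) :
    s * η = η * parityOp V F E U s := by
  obtain ⟨θ, hθ⟩ := hη
  refine Subtype.ext (funext fun x => ?_)
  have h1 : η.1 x = inl (E x) (θ x) := congrFun hθ x
  have h2 : SuperTensor.parity (η.1 x) = -η.1 x := congrFun (congrArg Subtype.val hp) x
  rw [h1, parity_inl, ← map_neg] at h2
  change s.1 x * η.1 x = η.1 x * SuperTensor.parity (s.1 x)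
  rw [h1]
  exact mul_inl_of_odd _ (inl_injective h2)

/-- The algebra of `⋀E`-valued forms over a coordinate domain satisfies the hypotheses of
`IsSuperFrame.supertrace_comm`. -/
theorem isSuperFrame : IsSuperFrame (parityOp V F E U) (formSections U)
    (fun J : Finset (Fin (Module.finrank ℂ F)) => (-1 : ℂ) ^ J.card) (frame hU)
    (frameCoeff hU) where
  parity_parity := parityOp_parityOp
  parity_mul := parityOp_mul
  sign k := neg_one_pow_eq_or ℂ _
  expand := eq_sum_frame hU
  coeff_mem k s := ⟨_, funext fun x => frameCoeff_apply hU k s x⟩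
  coeff_mul k η hη := frameCoeff_mul hU k hη
  coeff_self k η hη := by rw [frameCoeff_mul hU k hη, frameCoeff_frame, if_pos rfl, mul_one]
  coeff_of_ne j k hjk η hη := by
    rw [frameCoeff_mul hU j hη, frameCoeff_frame, if_neg hjk, mul_zero]
  parity_frame := parityOp_frame hU
  coeff_parity := frameCoeff_parityOp hU
  comm_even _ := mul_form_of_even
  comm_odd _ := mul_form_of_odd

end LocalTrace

end Degrees

/-! ### Parity of the generalized supertrace -/

section Trace

variable {C : Type*} [AddCommGroup C] [Module ℂ C]
variable {W : Type*} [AddCommGroup W] [Module ℂ W]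

/-- The generalized supertrace of an even operator is even. -/
theorem act_genSupertrace_parity [Module.Finite ℂ W]
    {ψ : ExteriorAlgebra ℂ C ⊗[ℂ] Module.End ℂ (ExteriorAlgebra ℂ W)}
    (hψ : ∀ s, act ψ (SuperTensor.parity s) = SuperTensor.parity (act ψ s))
    (s : SuperTensor C W) :
    act (dualInclExt (genSupertraceExt ψ)) (SuperTensor.parity s) =
      SuperTensor.parity (act (dualInclExt (genSupertraceExt ψ)) s) := by
  rw [act_genSupertrace (Module.finBasis ℂ W) hψ, act_genSupertrace (Module.finBasis ℂ W) hψ,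
    parity_inl, map_sum eps]
  refine congrArg _ (Finset.sum_congr rfl fun J _ => ?_)
  have h1 : act ψ (inr C ((Module.finBasis ℂ W).ExteriorAlgebra J)) = (-1 : ℂ) ^ J.card •
      SuperTensor.parity (act ψ (inr C ((Module.finBasis ℂ W).ExteriorAlgebra J))) := by
    rw [← hψ, parity_inr_basis, map_smul, smul_smul, ← mul_pow, neg_one_mul, neg_neg, one_pow,
      one_smul]
  rw [h1, mul_smul_comm, ← map_mul, map_smul, slice_parity, map_smul, smul_smul, ← mul_pow,
    neg_one_mul, neg_neg, one_pow, one_smul, ← h1]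

end Trace

/-! ### Operators which are the action of a section -/

theorem finite_fibre {X : Type*} [TopologicalSpace X] (F : Type*) [NormedAddCommGroup F]
    [NormedSpace ℂ F] [FiniteDimensional ℂ F] {E : X → Type*} [∀ x, AddCommGroup (E x)]
    [∀ x, Module ℂ (E x)] [∀ x, TopologicalSpace (E x)] [TopologicalSpace (TotalSpace F E)]
    [FiberBundle F E] [VectorBundle ℂ F E] (x : X) : Module.Finite ℂ (E x) :=
  Module.Finite.equiv ((trivializationAt F E x).continuousLinearEquivAt ℂ x
    (FiberBundle.mem_baseSet_trivializationAt' x)).symm.toLinearEquiv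

section Action

set_option linter.unusedSectionVars false

variable {V : Type*} [NormedAddCommGroup V] [NormedSpace ℂ V] [FiniteDimensional ℂ V]
variable {X : Type*} [TopologicalSpace X] [ChartedSpace V X] [IsManifold 𝓘(ℂ, V) ω X]
variable {F : Type*} [NormedAddCommGroup F] [NormedSpace ℂ F] [FiniteDimensional ℂ F]
variable {E : X → Type*} [∀ x, AddCommGroup (E x)] [∀ x, Module ℂ (E x)]
variable [∀ x, TopologicalSpace (E x)] [TopologicalSpace (TotalSpace F E)]
variable [FiberBundle F E] [VectorBundle ℂ F E] [ContMDiffVectorBundle ω F E 𝓘(ℂ, V)]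
variable {τ : ∀ x : X, Module.Dual ℂ (E x)}

variable (F) in
/-- A section on a neighbourhood of `x` with a given value at `x`, linear in this value. -/
def sectionThrough (x : X) :
    Fibre V E x →ₐ[ℂ] analyticSections V F E (coordDomain (V := V) F E x) :=
  (constSec le_rfl).comp (fibreCoord F E x x)

theorem sectionThrough_apply (x : X) (t : Fibre V E x) :
    (sectionThrough F x t).1 ⟨x, mem_coordDomain F E x⟩ = t :=
  fibreInv_fibreCoord F E (mem_coordDomain F E x) t

variable {Φ : ∀ U : Opens X, Module.End ℂ (analyticSections V F E U)}

theorem IsActionOf.act_eq {ψ : ∀ x : X, EndFibre V E x} (h : IsActionOf (F := F) ψ Φ) (x : X)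
    (t : Fibre V E x) : act (ψ x) t =
      (Φ _ (sectionThrough F x t)).1 ⟨x, mem_coordDomain F E x⟩ := by
  rw [h, sectionThrough_apply]

/-- A local operator which is linear over the functions and right linear over the forms is the
action of a section. -/
theorem exists_isActionOf (hΦ : IsLocal Φ)
    (hleft : ∀ (U : Opens X) (x₀ : X), U ≤ coordDomain (V := V) F E x₀ →
      ∀ f, IsScalar f → ∀ s : analyticSections V F E U, Φ U (f * s) = f * Φ U s)
    (hright : ∀ (U : Opens X) (x₀ : X), U ≤ coordDomain (V := V) F E x₀ →
      ∀ η ∈ formSections U, ∀ s : analyticSections V F E U, Φ U (s * η) = Φ U s * η) :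
    ∃ ψ : ∀ x : X, EndFibre V E x, IsActionOf (F := F) ψ Φ := by
  have hfin : ∀ x, Module.Finite ℂ (E x) := finite_fibre F
  -- The endomorphism of the fibre at `x` induced by `Φ`: any extension of a vector to a section
  -- gives the same value, since `Φ` is linear over the functions.
  let φ : ∀ x : X, Module.End ℂ (Fibre V E x) := fun x =>
    { toFun := fun t => (Φ _ (sectionThrough F x t)).1 ⟨x, mem_coordDomain F E x⟩
      map_add' := fun s t => by
        rw [map_add, map_add]
        rfl
      map_smul' := fun z t => by
        rw [map_smul, map_smul]
        rfl }
  have hφ : ∀ x s a, φ x (s * inl (E x) a) = φ x s * inl (E x) a := by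
    intro x s a
    have hη : sectionThrough F x (inl (E x) a) ∈ formSections (coordDomain (V := V) F E x) := by
      refine ⟨fun z => ExteriorAlgebra.map (modelToCotangent V x z)
        (ExteriorAlgebra.map (cotangentToModel V x x) a), funext fun z => ?_⟩
      change fibreInv F E x z (fibreCoord F E x x (inl (E x) a)) = _
      rw [fibreCoord_inl, fibreInv_inl]
      rfl
    change (Φ _ (sectionThrough F x (s * inl (E x) a))).1 _ = _
    rw [map_mul, hright _ x le_rfl _ hη]
    exact congrArg (_ * ·) (sectionThrough_apply (F := F) x (inl (E x) a))
  choose ψ hψ using fun x => exists_act_eq (φ x) (hφ x)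
  refine ⟨ψ, fun U s x => ?_⟩
  have hW : U ⊓ coordDomain (V := V) F E (x : X) ≤ U := inf_le_left
  have hW' : U ⊓ coordDomain (V := V) F E (x : X) ≤ coordDomain (V := V) F E (x : X) := inf_le_right
  have hx : (x : X) ∈ U ⊓ coordDomain (V := V) F E (x : X) := ⟨x.2, mem_coordDomain F E _⟩
  rw [hψ, hΦ.apply_eq s x hW hx]
  have h2 : (φ x (s.1 x)) = (Φ _ (restrict hW' (sectionThrough F (x : X) (s.1 x)))).1 ⟨x, hx⟩ :=
    hΦ.apply_eq (sectionThrough F (x : X) (s.1 x)) ⟨x, mem_coordDomain F E _⟩ hW' hx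
  rw [h2]
  exact apply_eq_of_eq hW' (hleft _ x hW') (sectionThrough_apply (F := F) (x : X) (s.1 x)).symm

theorem isActionOf_unique {ψ ψ' : ∀ x : X, EndFibre V E x} (h : IsActionOf (F := F) ψ Φ)
    (h' : IsActionOf (F := F) ψ' Φ) : ψ = ψ' := by
  funext x
  have := finite_fibre (E := E) F x
  refine act_injective (LinearMap.ext fun t => ?_)
  rw [h.act_eq, h'.act_eq]

/-! ### The generalized supertrace of the powers of the curvature -/

section CurvaturePower

/-- The operators `R_A ^ r / r!`. -/
def curvaturePow (nabla : FlatConnection10 V F E) (δ : TwistingDifferential V F E τ) (r : ℕ)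
    (U : Opens X) : Module.End ℂ (analyticSections V F E U) :=
  (1 / (r.factorial : ℂ)) • (curvature nabla δ U) ^ r

variable (nabla : FlatConnection10 V F E) (δ : TwistingDifferential V F E τ) (r : ℕ)

theorem curvaturePow_isLocal : IsLocal (curvaturePow nabla δ r) :=
  ((curvature_isLocal nabla δ).pow r).smul _

theorem curvaturePow_hasWeight {U : Opens X} {s : analyticSections V F E U} {p : ℕ} {i : ℤ}
    (hs : HasWeight s p i) : HasWeight (curvaturePow nabla δ r U s) (p + r) (i + r) :=
  (curvature_pow_hasWeight nabla δ r hs).smul _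

section OnCoordDomain

variable {U : Opens X} {x₀ : X}

theorem curvaturePow_form_mul (hU : U ≤ coordDomain (V := V) F E x₀)
    {η : analyticSections V F E U} (hη : η ∈ formSections U)
    (s : analyticSections V F E U) :
    curvaturePow nabla δ r U (η * s) = η * curvaturePow nabla δ r U s :=
  smul_pow_apply_mul_left (curvature_mul hU nabla δ) (curvature_form hU nabla δ hη.choose_spec) _ r
    s

theorem curvaturePow_mul_form (hU : U ≤ coordDomain (V := V) F E x₀)
    {η : analyticSections V F E U} (hη : η ∈ formSections U)
    (s : analyticSections V F E U) :
    curvaturePow nabla δ r U (s * η) = curvaturePow nabla δ r U s * η :=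
  smul_pow_apply_mul_right (curvature_mul hU nabla δ) (curvature_form hU nabla δ hη.choose_spec) _ r
    s

theorem curvaturePow_parityOp (hU : U ≤ coordDomain (V := V) F E x₀)
    (s : analyticSections V F E U) :
    curvaturePow nabla δ r U (parityOp V F E U s) = parityOp V F E U (curvaturePow nabla δ r U s) :=
  smul_pow_apply_comm (curvature_parity hU nabla δ) _ r s

theorem curvaturePow_comm (hU : U ≤ coordDomain (V := V) F E x₀)
    (s : analyticSections V F E U) :
    curvaturePow nabla δ r U (δ.op U s) = δ.op U (curvaturePow nabla δ r U s) :=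
  smul_pow_apply_comm (fun s => LinearMap.congr_fun (curvature_comm hU nabla δ) s) _ r s

theorem IsScalar.mem_formSections {f : analyticSections V F E U} (hf : IsScalar f) :
    f ∈ formSections U :=
  ⟨_, hf.choose_spec⟩

end OnCoordDomain

variable {nabla δ r} {ψ : ∀ x : X, EndFibre V E x}

theorem IsActionOf.parity (hψ : IsActionOf (F := F) ψ (curvaturePow nabla δ r)) (x : X)
    (t : Fibre V E x) :
    act (ψ x) (SuperTensor.parity t) = SuperTensor.parity (act (ψ x) t) := by
  have h1 := hψ _ (parityOp V F E _ (sectionThrough F x t)) ⟨x, mem_coordDomain F E x⟩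
  rw [curvaturePow_parityOp nabla δ r le_rfl, parityOp_apply, parityOp_apply,
    sectionThrough_apply] at h1
  rw [← h1, hψ.act_eq]

theorem IsActionOf.weight (hψ : IsActionOf (F := F) ψ (curvaturePow nabla δ r)) (x : X)
    {t : Fibre V E x} {p : ℕ} {i : ℤ}
    (ht : t ∈ weight (E x) (cotangent10 V x) (cotangent01 V x) p i) :
    act (ψ x) t ∈ weight (E x) (cotangent10 V x) (cotangent01 V x) (p + r) (i + r) := by
  rw [hψ.act_eq]
  exact curvaturePow_hasWeight nabla δ r
    (constSec_hasWeight le_rfl (fibreCoord_mem_weight (F := F) (x₀ := x) ht))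
    ⟨x, mem_coordDomain F E x⟩

/-- The supertrace `s ↦ Str (l_s ∘ Φ)`, written in a local frame. -/
def localTrace {U : Opens X} {x₀ : X} (hU : U ≤ coordDomain (V := V) F E x₀)
    (Φ : Module.End ℂ (analyticSections V F E U)) (s : analyticSections V F E U) :
    analyticSections V F E U :=
  ∑ J : Finset (Fin (Module.finrank ℂ F)), (-1 : ℂ) ^ J.card •
    frameCoeff hU J (s * Φ (frame hU J))

theorem localTrace_apply {U : Opens X} {x₀ : X} (hU : U ≤ coordDomain (V := V) F E x₀)
    (Φ : Module.End ℂ (analyticSections V F E U)) (s : analyticSections V F E U) (x : U) :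
    (localTrace hU Φ s).1 x = inl (E x) (∑ J, (-1 : ℂ) ^ J.card •
      ExteriorAlgebra.map (modelToCotangent V x₀ x) (slice
        ((Module.finBasis ℂ F).ExteriorAlgebra.coord J)
          (fibreCoord F E x₀ x (s.1 x * (Φ (frame hU J)).1 x)))) := by
  have h1 : (localTrace hU Φ s).1 x = ∑ J : Finset (Fin (Module.finrank ℂ F)),
      (-1 : ℂ) ^ J.card • (frameCoeff hU J (s * Φ (frame hU J))).1 x :=
    coe_sum_smul _ _ x
  rw [h1, map_sum]
  refine Finset.sum_congr rfl fun J _ => ?_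
  rw [frameCoeff_apply, map_smul]
  rfl

/-- The generalized supertrace of the action on a section, written in a local frame. -/
theorem IsActionOf.genSupertrace_eq (hψ : IsActionOf (F := F) ψ (curvaturePow nabla δ r))
    {U : Opens X} {x₀ : X} (hU : U ≤ coordDomain (V := V) F E x₀) (s : analyticSections V F E U)
    (x : U) : act (dualInclExt (genSupertraceExt (ψ x))) (s.1 x) =
      (localTrace hU (curvaturePow nabla δ r U) s).1 x := by
  set b := (Module.finBasis ℂ F).map ((trivializationAt F E x₀).continuousLinearEquivAt ℂ (x : X)
    (hU x.2).2).symm.toLinearEquiv with hb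
  have hg : ∀ i, ((trivializationAt F E x₀).symmL ℂ (x : X)).toLinearMap
      (Module.finBasis ℂ F i) = b i := fun i => by
    rw [hb, Module.Basis.map_apply]
    exact congrArg (fun A : F →L[ℂ] E x => A (Module.finBasis ℂ F i))
      ((trivializationAt F E x₀).symm_continuousLinearEquivAt_eq' (R := ℂ) (hU x.2).2).symm
  have h1 : ∀ J, fibreInv F E x₀ (x : X)
      (inr (V →ₗ[ℝ] ℂ) ((Module.finBasis ℂ F).ExteriorAlgebra J)) =
      inr (Cotangent V (x : X)) (b.ExteriorAlgebra J) := by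
    intro J
    rw [fibreInv, inr_apply, SuperTensor.map_tmul, map_one, exteriorAlgebra_map_basis _ b _ hg]
    rfl
  have h2 : ∀ J, (curvaturePow nabla δ r U (frame hU J)).1 x =
      act (ψ x) (inr (Cotangent V (x : X)) (b.ExteriorAlgebra J)) := by
    intro J
    rw [hψ, frame, constSec_apply, h1]
  rw [act_genSupertrace b (hψ.parity x), localTrace_apply]
  refine congrArg _ (Finset.sum_congr rfl fun J _ => ?_)
  rw [h2, map_slice _ b (modelToCotangent V x₀ x) _ hg]
  congr 2
  exact (fibreInv_fibreCoord F E (hU x.2) _).symm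

/-- `Tr_Λ(ψ)` preserves real-analyticity: locally it is `localTrace`, a combination of operators on
real-analytic sections. -/
theorem isAnalyticSection_genSupertrace (hψ : IsActionOf (F := F) ψ (curvaturePow nabla δ r))
    {U : Opens X} (s : analyticSections V F E U) : IsAnalyticSection F fun x : U =>
      act (dualInclExt (genSupertraceExt (ψ x))) (s.1 x) := by
  refine isAnalyticSection_of_local _ fun x => ?_
  have hW : U ⊓ coordDomain (V := V) F E (x : X) ≤ U := inf_le_left
  have hW' : U ⊓ coordDomain (V := V) F E (x : X) ≤ coordDomain (V := V) F E (x : X) := inf_le_right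
  exact ⟨_, localTrace hW' (curvaturePow nabla δ r _) (restrict hW s),
    ⟨x.2, mem_coordDomain F E _⟩, fun z _ hz => hψ.genSupertrace_eq hW' (restrict hW s) ⟨z, hz⟩⟩

/-- The operator `Tr_Λ(ψ)` on the sheaf of `⋀E`-valued forms. -/
def traceOp (hψ : IsActionOf (F := F) ψ (curvaturePow nabla δ r)) : SheafEnd V F E where
  toFun _ :=
    { toFun := fun s => ⟨fun x => act (dualInclExt (genSupertraceExt (ψ x))) (s.1 x),
        isAnalyticSection_genSupertrace hψ s⟩
      map_add' := fun s t => Subtype.ext (funext fun x =>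
        (act (dualInclExt (genSupertraceExt (ψ x)))).map_add (s.1 x) (t.1 x))
      map_smul' := fun z s => Subtype.ext (funext fun x =>
        (act (dualInclExt (genSupertraceExt (ψ x)))).map_smul z (s.1 x)) }
  compat _ _ _ _ _ hst x :=
    congrArg (act (dualInclExt (genSupertraceExt (ψ x)))) (hst x)

theorem traceOp_apply (hψ : IsActionOf (F := F) ψ (curvaturePow nabla δ r)) {U : Opens X}
    (s : analyticSections V F E U) (x : U) : ((traceOp hψ).toFun U s).1 x =
      act (dualInclExt (genSupertraceExt (ψ x))) (s.1 x) := rfl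

theorem traceOp_parityOp (hψ : IsActionOf (F := F) ψ (curvaturePow nabla δ r)) {U : Opens X}
    (s : analyticSections V F E U) : (traceOp hψ).toFun U (parityOp V F E U s) =
      parityOp V F E U ((traceOp hψ).toFun U s) := by
  refine Subtype.ext (funext fun x => ?_)
  have := finite_fibre (E := E) F (x : X)
  rw [traceOp_apply, parityOp_apply, parityOp_apply, traceOp_apply,
    act_genSupertrace_parity (hψ.parity x)]

/-- `Tr_Λ(ψ)` commutes with `δ`: both operators are local, and over a coordinate domain
`IsSuperFrame.supertrace_comm` applies. -/
theorem traceOp_comm (hψ : IsActionOf (F := F) ψ (curvaturePow nabla δ r)) {U : Opens X}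
    (s : analyticSections V F E U) : (traceOp hψ).toFun U (δ.op U s) =
      δ.op U ((traceOp hψ).toFun U s) := by
  have hT := (traceOp hψ).isLocal
  refine Subtype.ext (funext fun x => ?_)
  have hW : U ⊓ coordDomain (V := V) F E (x : X) ≤ U := inf_le_left
  have hW' : U ⊓ coordDomain (V := V) F E (x : X) ≤ coordDomain (V := V) F E (x : X) := inf_le_right
  have hx : (x : X) ∈ U ⊓ coordDomain (V := V) F E (x : X) := ⟨x.2, mem_coordDomain F E _⟩
  have hD := δ.isFormDerivation (U ⊓ coordDomain (V := V) F E (x : X))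
  have h1 := (isSuperFrame hW').supertrace_comm hD.der
    (fun η hη => ⟨_, hD.forms _ η hη.choose_spec⟩)
    (fun η hη => parityOp_mem_formSections hη) (curvaturePow_parityOp nabla δ r hW')
    (fun η hη => curvaturePow_form_mul nabla δ r hW' hη) (curvaturePow_comm nabla δ r hW')
    (restrict hW s)
  have h2 : ∀ s : analyticSections V F E (U ⊓ coordDomain (V := V) F E (x : X)),
      (traceOp hψ).toFun _ s = localTrace hW' (curvaturePow nabla δ r _) s := fun s =>
    Subtype.ext (funext fun z => hψ.genSupertrace_eq hW' s z)
  have h3 : (traceOp hψ).toFun _ (δ.op _ (restrict hW s)) =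
      δ.op _ ((traceOp hψ).toFun _ (restrict hW s)) :=
    (h2 _).trans (h1.trans (congrArg (δ.op _) (h2 _).symm))
  have h4 := (hT.mul δ.isLocal).apply_eq s x hW hx
  have h5 := (δ.isLocal.mul hT).apply_eq s x hW hx
  exact h4.trans ((congrArg (fun t => t.1 ⟨x, hx⟩) h3).trans h5.symm)

/-- The values of `Tr_Λ(ψ)` are differential forms, of the expected degrees: for a section `s` of
`Tⁱ` and `e_J` in `⋀ᵐE`, the product `s ψ(e_J)` has form type `(r, *)` and total degree
`i - m + r`, so its coefficient on `e_J` has type `(r, r + i)`. -/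
theorem exists_traceOp_eq (hψ : IsActionOf (F := F) ψ (curvaturePow nabla δ r)) {U : Opens X}
    (s : analyticSections V F E U) : ∃ θ : ∀ x : U, FormFibre V (x : X),
      ((traceOp hψ).toFun U s).1 = formSection E θ ∧
        ∀ i, InTwisted s i → ∀ x : U, θ x ∈ dolbeaultPart V (x : X) r (r + i) := by
  have hfin : ∀ x, Module.Finite ℂ (E x) := finite_fibre F
  refine ⟨fun x => _, funext fun x => act_genSupertrace (Module.finBasis ℂ (E x)) (hψ.parity x) _,
    fun i hs x => Submodule.sum_mem _ fun J _ => Submodule.smul_mem _ _ ?_⟩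
  have h1 : s.1 x ∈ weight (E x) (cotangent10 V (x : X)) (cotangent01 V (x : X)) 0 i := hs x
  have h2 := hψ.weight x (inr_mem_weight (cotangent10 V (x : X)) (cotangent01 V (x : X))
    (basis_mem_exteriorPower (Module.finBasis ℂ (E x)) J))
  have h3 := slice_mem_of_mem_weight (Module.finBasis ℂ (E x)) J (mul_mem_weight h1 h2)
  rw [show 0 + (0 + r) = r by omega,
    show i + (-(J.card : ℤ) + r) + J.card = r + i by ring] at h3
  exact h3

end CurvaturePower

end Action

/-! ### Vanishing of the supercommutator -/

/-- An even operator which commutes with `a` also supercommutes with `a`. -/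
theorem superBracket_eq_zero {M : Type*} [AddCommGroup M] [Module ℂ M] {e a b : Module.End ℂ M}
    (he : ∀ s, e (e s) = s) (hb : ∀ s, b (e s) = e (b s)) (hab : ∀ s, b (a s) = a (b s)) :
    superBracket e a b = 0 := by
  have h1 : b - e * b * e = 0 := by
    ext1 s
    rw [LinearMap.sub_apply, Module.End.mul_apply, Module.End.mul_apply, hb, he, sub_self,
      LinearMap.zero_apply]
  have h2 : a * b - b * a = 0 := by
    ext1 s
    rw [LinearMap.sub_apply, Module.End.mul_apply, Module.End.mul_apply, hab, sub_self,
      LinearMap.zero_apply]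
  rw [superBracket, h1, h2, smul_zero, zero_mul, smul_zero, zero_add]

end

end TwistedDolbeault

theorem mainTheorem6
    {V : Type*} [NormedAddCommGroup V] [NormedSpace ℂ V] [FiniteDimensional ℂ V]
    {X : Type*} [TopologicalSpace X] [ChartedSpace V X] [IsManifold 𝓘(ℂ, V) ω X]
    {F : Type*} [NormedAddCommGroup F] [NormedSpace ℂ F] [FiniteDimensional ℂ F]
    (r : ℕ) (hr : Module.finrank ℂ F = r)
    {E : X → Type*} [∀ x, AddCommGroup (E x)] [∀ x, Module ℂ (E x)]
    [∀ x, TopologicalSpace (E x)] [TopologicalSpace (TotalSpace F E)]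
    [FiberBundle F E] [VectorBundle ℂ F E] [ContMDiffVectorBundle ω F E 𝓘(ℂ, V)]
    (τ : ∀ x : X, Module.Dual ℂ (E x))
    (hτ : TwistedDolbeault.IsAnalyticDualSection V F E τ)
    (nabla : TwistedDolbeault.FlatConnection10 V F E)
    (δ : TwistedDolbeault.TwistingDifferential V F E τ) :
    (∃! ψ : ∀ x : X, TwistedDolbeault.EndFibre V E x,
      TwistedDolbeault.IsActionOf (F := F) ψ fun U =>
        (1 / (r.factorial : ℂ)) • (TwistedDolbeault.curvature nabla δ U) ^ r) ∧
    ∀ ψ : ∀ x : X, TwistedDolbeault.EndFibre V E x,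
      (TwistedDolbeault.IsActionOf (F := F) ψ fun U =>
        (1 / (r.factorial : ℂ)) • (TwistedDolbeault.curvature nabla δ U) ^ r) →
      ∃ T : TwistedDolbeault.SheafEnd V F E,
        TwistedDolbeault.IsActionOf
          (fun x => TwistedDolbeault.dualInclExt (TwistedDolbeault.genSupertraceExt (ψ x)))
          T.toFun ∧
        (∀ U : Opens X,
          TwistedDolbeault.superBracket (TwistedDolbeault.parityOp V F E U)
            (δ.op U) (T.toFun U) = 0) ∧
        (∀ (U : Opens X) (s : TwistedDolbeault.analyticSections V F E U),
          ∃ θ : ∀ x : U, TwistedDolbeault.FormFibre V (x : X),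
            (T.toFun U s).1 = TwistedDolbeault.formSection E θ ∧
            (T.toFun U (δ.op U s)).1 =
              TwistedDolbeault.formSection E (TwistedDolbeault.delbar θ)) ∧
        (∀ (U : Opens X) (i : ℤ) (s : TwistedDolbeault.analyticSections V F E U),
          TwistedDolbeault.InTwisted s i →
          TwistedDolbeault.InTwisted (δ.op U s) (i + 1) ∧ δ.op U (δ.op U s) = 0 ∧
          ∃ θ : ∀ x : U, TwistedDolbeault.FormFibre V (x : X),
            (T.toFun U s).1 = TwistedDolbeault.formSection E θ ∧
            ∀ x : U, θ x ∈ TwistedDolbeault.dolbeaultPart V (x : X) r (r + i)) := by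
  refine ⟨?_, fun ψ hψ => ?_⟩
  · obtain ⟨ψ, hψ⟩ := TwistedDolbeault.exists_isActionOf
      (TwistedDolbeault.curvaturePow_isLocal nabla δ r)
      (fun U x₀ hU f hf s =>
        TwistedDolbeault.curvaturePow_form_mul nabla δ r hU hf.mem_formSections s)
      (fun U x₀ hU η hη s => TwistedDolbeault.curvaturePow_mul_form nabla δ r hU hη s)
    exact ⟨ψ, hψ, fun ψ' hψ' => TwistedDolbeault.isActionOf_unique hψ' hψ⟩
  · replace hψ : TwistedDolbeault.IsActionOf (F := F) ψ
      (TwistedDolbeault.curvaturePow nabla δ r) := hψ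
    refine ⟨TwistedDolbeault.traceOp hψ, fun U s x => rfl, fun U => ?_, fun U s => ?_,
      fun U i s hs => ⟨?_, ?_, ?_⟩⟩
    · exact TwistedDolbeault.superBracket_eq_zero TwistedDolbeault.parityOp_parityOp
        (TwistedDolbeault.traceOp_parityOp hψ) (TwistedDolbeault.traceOp_comm hψ)
    · obtain ⟨θ, hθ, -⟩ := TwistedDolbeault.exists_traceOp_eq hψ s
      refine ⟨θ, hθ, ?_⟩
      rw [TwistedDolbeault.traceOp_comm hψ, (δ.isFormDerivation U).forms θ _ hθ,
        ← TwistedDolbeault.delbar_eq_formD]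
    · exact δ.hasWeight nabla hs
    · exact δ.sq_zero U i s hs
    · obtain ⟨θ, hθ, hθ'⟩ := TwistedDolbeault.exists_traceOp_eq hψ s
      exact ⟨θ, hθ, hθ' i hs⟩
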